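/- Work in $\mathbb{R}^2$ with $v^\perp=(-v_2,v_1)$, and write $\chi_S$ for the characteristic function of a set $S$. A \emph{Yudovich solution} with initial vorticity $\omega_0$ is $\omega\in L^\infty([0,\infty);L^1\cap L^\infty(\mathbb{R}^2))$ such that $\omega(t,\cdot)=\omega_0\circ\Phi_t^{-1}$ a.e. for all $t\ge 0$, where $\Phi_t$ are area-preserving homeomorphisms of the plane with $\frac{d}{dt}\Phi_t(x)=u(t,\Phi_t(x))$, $\Phi_0(x)=x$, and $u(t,x)=\frac1{2\pi}\int_{\mathbb{R}^2}\frac{(x-y)^\perp}{|x-y|^2}\,\omega(t,y)\,dy$ is given by the Biot–Savart law. A \emph{weak Euler solution with bounded vorticity} with initial vorticity $\omega_0$ is a function $\omega\in L^\infty([0,\infty)\times\mathbb{R}^2)$ for which there is a continuous velocity field $u$ on $[0,\infty)\times\mathbb{R}^2$ with $|u(t,x)|\le C_T(1+|x|)$ for $0\le t\le T$, such that, in the sense of distributions, $\nabla\cdot u=0$ and $\nabla\times u=\omega$ at each time $t\ge 0$, and $\partial_t\omega+\nabla\cdot(u\,\omega)=0$ with $\omega|_{t=0}=\omega_0$. \textbf{Proposition.}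 Let $\omega_0=\chi_{\{y\ge 0\}}$. (1) For $n\ge 1$ let $$A_n=\Big\{\tfrac{x^2}{n^2}+\tfrac{(y-n)^2}{n^2}<1\Big\},\qquad B_n=\Big\{\tfrac{x^2}{4n^2}+\tfrac{(y-n)^2}{n^2}<1\Big\}.$$ The functions $\chi_{A_n}$ and $\chi_{B_n}$ are compactly supported, and both sequences converge to $\omega_0$ in $L^2_{loc}(\mathbb{R}^2)$ as $n\to\infty$. The unique Yudovich solution with initial vorticity $\chi_{A_n}$ is the stationary one, $\omega^{1,n}(t)=\chi_{A_n}$ for all $t\ge 0$. The unique Yudovich solution with initial vorticity $\chi_{B_n}$ is the rotating Kirchhoff ellipse $\omega^{2,n}(t)=\chi_{B_n(t)}$, $t\ge 0$, where $B_n(t)$ is $B_n$ rotated counterclockwise about its center $(0,n)$ by the angle $\tfrac29 t$. At time $t=1$ the two sequences of solutions converge in $L^2_{loc}$ to different functions. More precisely, $\omega^{1,n}(t)\to\chi_{\{y\ge0\}}$ for every $t\ge0$, whereas $\omega^{2,n}(t)\to 1$ in $L^2_{loc}$ for every $0<t<\tfrac{9\pi}{2}$. (2) There are infinitely many weak Euler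 solutions with bounded vorticity and with initial vorticity $\omega_0$, pairwise different (for any two of them there is a time $t\ge0$ at which they are not equal almost everywhere), each of which is the limit, in $L^2_{loc}(\mathbb{R}^2)$ uniformly for $t$ in bounded intervals, of a sequence of solutions $w_n\in C^\infty([0,\infty)\times\mathbb{R}^2)$ of $\partial_t w+u\cdot\nabla w=0$, with $u$ given by the Biot–Savart law from $w$, each compactly supported in space, locally uniformly in time. -/

import Mathlib

open Set Filter Topology MeasureTheory
open scoped NNReal ENNReal

namespace PlanarEuler

noncomputable section

/-- The Euclidean plane; the coordinates `(x, y)` of a point `p` are `(p 0, p 1)`. -/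
abbrev Plane := EuclideanSpace ℝ (Fin 2)

/-- The rotation of a vector by a right angle, counterclockwise: `(v₁, v₂)^⊥ = (-v₂, v₁)`. -/
def perp (v : Plane) : Plane := !₂[-(v 1), v 0]

/-- The counterclockwise rotation of a vector by the angle `θ`. -/
def rot (θ : ℝ) (v : Plane) : Plane := Real.cos θ • v + Real.sin θ • perp v

/-- The Biot-Savart kernel `K(z) = z^⊥ / (2π |z|²)`. -/
def biotSavartKernel (z : Plane) : Plane := (1 / (2 * Real.pi * ‖z‖ ^ 2)) • perp z

/-- The Biot-Savart law `u(x) = (1/2π) ∫ (x-y)^⊥ / |x-y|² ω(y) dy`. -/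
def biotSavart (ω : Plane → ℝ) (x : Plane) : Plane :=
  ∫ y, ω y • biotSavartKernel (x - y)

/-- The characteristic function of a set. -/
def chi (A : Set Plane) : Plane → ℝ := A.indicator fun _ => 1

/-- The closed upper half plane `y ≥ 0`. -/
def upperHalf : Set Plane := {p | 0 ≤ p 1}

/-- The disk of radius `n` centered at `(0, n)`. -/
def disk (n : ℕ) : Set Plane :=
  {p | p 0 ^ 2 / (n : ℝ) ^ 2 + (p 1 - n) ^ 2 / (n : ℝ) ^ 2 < 1}

/-- The ellipse with horizontal semi-axis `2n` and vertical semi-axis `n` centered at `(0, n)`. -/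
def ellipse (n : ℕ) : Set Plane :=
  {p | p 0 ^ 2 / (4 * (n : ℝ) ^ 2) + (p 1 - n) ^ 2 / (n : ℝ) ^ 2 < 1}

/-- The set `ellipse n` rotated counterclockwise about its center `(0, n)` by the angle `θ`. -/
def rotatedEllipse (n : ℕ) (θ : ℝ) : Set Plane :=
  {p | !₂[0, (n : ℝ)] + rot (-θ) (p - !₂[0, (n : ℝ)]) ∈ ellipse n}

/-- Convergence in `L²_loc` of measurable functions on the plane. -/
def TendstoL2loc (f : ℕ → Plane → ℝ) (g : Plane → ℝ) : Prop :=
  (∀ n, AEStronglyMeasurable (f n) volume) ∧ AEStronglyMeasurable g volume ∧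
  ∀ K : Set Plane, IsCompact K →
    Tendsto (fun n => eLpNorm (f n - g) 2 (volume.restrict K)) atTop (𝓝 0)

/-- Convergence of functions of `(t, x)`, `t ≥ 0`, in `L²_loc` with respect to `x`, uniformly for
`t` in bounded intervals. -/
def TendstoL2locUniform (f : ℕ → ℝ → Plane → ℝ) (g : ℝ → Plane → ℝ) : Prop :=
  (∀ t, 0 ≤ t →
    (∀ n, AEStronglyMeasurable (f n t) volume) ∧ AEStronglyMeasurable (g t) volume) ∧
  ∀ T : ℝ, ∀ K : Set Plane, IsCompact K →
    Tendsto (fun n => ⨆ t ∈ Icc (0 : ℝ) T, eLpNorm (f n t - g t) 2 (volume.restrict K))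
      atTop (𝓝 0)

/-- `ω` is a (global) Yudovich solution of the 2D Euler equation with initial vorticity `ω₀`: the
vorticity is in `L^∞([0,∞); L¹ ∩ L^∞)`, the velocity is given by the Biot-Savart law, and the
vorticity is transported by the area preserving flow `Φ` of the velocity. -/
def IsYudovichSolution (ω₀ : Plane → ℝ) (ω : ℝ → Plane → ℝ) : Prop :=
  (∃ M : ℝ≥0, ∀ t, 0 ≤ t →
    AEStronglyMeasurable (ω t) volume ∧ eLpNorm (ω t) 1 volume ≤ M ∧ eLpNorm (ω t) ⊤ volume ≤ M) ∧
  ∃ Φ : ℝ → Plane ≃ₜ Plane,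
    (∀ x, Φ 0 x = x) ∧
    (∀ t, 0 ≤ t → ∀ x,
      HasDerivWithinAt (fun s => Φ s x) (biotSavart (ω t) (Φ t x)) (Ici 0) t) ∧
    (∀ t, 0 ≤ t → MeasurePreserving (Φ t) volume volume) ∧
    (∀ t, 0 ≤ t → ω t =ᵐ[volume] fun x => ω₀ ((Φ t).symm x))

/-- `ω` is the unique Yudovich solution with initial vorticity `ω₀`. -/
def IsUniqueYudovichSolution (ω₀ : Plane → ℝ) (ω : ℝ → Plane → ℝ) : Prop :=
  IsYudovichSolution ω₀ ω ∧
  ∀ ω', IsYudovichSolution ω₀ ω' → ∀ t, 0 ≤ t → ω' t =ᵐ[volume] ω t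

/-- `ω` is a smooth solution on `[0, ∞)` of the vorticity equation `∂ₜω + u · ∇ω = 0`, with `u`
given by the Biot-Savart law, and is compactly supported in space, locally uniformly in time. -/
def IsSmoothCompactSolution (ω : ℝ → Plane → ℝ) : Prop :=
  ContDiffOn ℝ (⊤ : ℕ∞) (Function.uncurry ω) (Ici 0 ×ˢ univ) ∧
  (∀ T : ℝ, ∃ R : ℝ, ∀ t ∈ Icc 0 T, tsupport (ω t) ⊆ Metric.closedBall 0 R) ∧
  (∀ t, 0 ≤ t → ∀ x,
    derivWithin (fun s => ω s x) (Ici 0) t + fderiv ℝ (ω t) x (biotSavart (ω t) x) = 0)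

/-- `∇ · u = 0` in the sense of distributions. -/
def IsWeakDivFree (u : Plane → Plane) : Prop :=
  ∀ φ : Plane → ℝ, ContDiff ℝ (⊤ : ℕ∞) φ → HasCompactSupport φ → ∫ x, fderiv ℝ φ x (u x) = 0

/-- `∇ × u = ∂₁u₂ - ∂₂u₁ = ω` in the sense of distributions; note that
`∇φ · u^⊥ = u₁ ∂₂φ - u₂ ∂₁φ`. -/
def IsWeakCurl (u : Plane → Plane) (ω : Plane → ℝ) : Prop :=
  ∀ φ : Plane → ℝ, ContDiff ℝ (⊤ : ℕ∞) φ → HasCompactSupport φ →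
    ∫ x, fderiv ℝ φ x (perp (u x)) = ∫ x, ω x * φ x

/-- `ω` is a global weak solution of the 2D Euler equation with bounded, not necessarily decaying,
vorticity and with initial vorticity `ω₀`: there is a continuous velocity field `u`, growing at most
linearly in space, such that `∇ · u = 0`, `∇ × u = ω` and `∂ₜω + ∇ · (u ω) = 0`, `ω(0) = ω₀` in the
sense of distributions on `[0, ∞) × ℝ²`. -/
def IsWeakEulerSolution (ω₀ : Plane → ℝ) (ω : ℝ → Plane → ℝ) : Prop :=
  AEStronglyMeasurable (Function.uncurry ω) (volume.restrict (Ici (0 : ℝ) ×ˢ (univ : Set Plane))) ∧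
  (∃ M : ℝ, ∀ t, 0 ≤ t → AEStronglyMeasurable (ω t) volume ∧ ∀ᵐ x, |ω t x| ≤ M) ∧
  ω 0 =ᵐ[volume] ω₀ ∧
  ∃ u : ℝ → Plane → Plane,
    ContinuousOn (Function.uncurry u) (Ici 0 ×ˢ univ) ∧
    (∀ T : ℝ, ∃ C : ℝ, ∀ t ∈ Icc 0 T, ∀ x, ‖u t x‖ ≤ C * (1 + ‖x‖)) ∧
    (∀ t, 0 ≤ t → IsWeakDivFree (u t) ∧ IsWeakCurl (u t) (ω t)) ∧
    (∀ ψ : ℝ × Plane → ℝ, ContDiff ℝ (⊤ : ℕ∞) ψ → HasCompactSupport ψ →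
      (∫ p in Ici (0 : ℝ) ×ˢ (univ : Set Plane), ω p.1 p.2 * fderiv ℝ ψ p (1, u p.1 p.2)) +
        ∫ x, ω₀ x * ψ (0, x) = 0)

end

end PlanarEuler

open PlanarEuler

/-!
The two sequences of patches are treated by explicit velocity fields. A Lipschitz velocity field
which decays at infinity and which has almost everywhere no divergence and the curl `ω` is the
Biot-Savart velocity of `ω` (`biotSavart_eq_of_curl`). By Rademacher's theorem the divergence
theorem holds for Lipschitz fields, and one tests the two equations with the gradient of a
truncation of `log |x - y|`. For an ellipse `E`, the Cauchy transform of `χ_E` is the real-linear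
function `conj z - (a - b) / (a + b) z` inside of `E` and a multiple of the reciprocal of the
inverse of the Joukowski map outside; both formulas agree on the boundary, which makes the
velocity Lipschitz (`biotSavart_centeredEllipse`). In the frame that rotates at Kirchhoff's
angular speed `a b / (a + b)²`, this velocity becomes an autonomous field whose trajectories
inside of `E` move along similar ellipses, so its area preserving flow leaves `E` invariant, and
in the fixed frame `E` rotates (`isYudovichSolution_movedEllipse`). The disks are the case `a =
b`, and `a = 2 n`, `b = n` gives the angular speed `2/9`. Uniqueness is Yudovich's argument
(`yudovich_unique`): the distance `N` of two flows satisfies `N' ≤ C p N^(1 - 1/p)` for all `p ≥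
1`, so that `N ≤ (C t)^p`, and `p → ∞` gives `N = 0` for small `t`.

A disk or an ellipse of size `n` that is tangent to the axis `y = 0` at the origin converges to
the upper half plane. Once the ellipse is rotated by an angle that is not a multiple of `π`, the
origin lies inside, at a distance of order `n` from the boundary, and the ellipses fill the plane
(`tendstoL2loc_rotatedEllipse`).

The infinitely many solutions with the initial vorticity `χ_{y ≥ 0}` are the half planes `y ≥ k
sin (t / 2)`, which are moved by a uniform vertical flow (`isWeakEulerSolution_halfPlane`). They
are limits of exact smooth solutions, the superposition of two circular flows. The carrier is a
rigid rotation with angular speed `1/2` and vorticity `1` on a disk of radius greater than `3 n`.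
The carried vortex is radial about a point inside of this disk; its vorticity is `0` up to the
radius `n` and `-1` from there on, and is compensated further out such that the vortex has no
circulation and induces no velocity outside of its support. It is therefore transported by the
carrier without deformation (`IsCarrier.isSmoothCompactSolution`), and its center moves on a
circle of radius `k`, which starts at `(0, n)` in the vertical direction. Near the origin, the
total vorticity is `1` in the disk of radius `n` and `0` around it, and as `n → ∞` the boundary of
the disk becomes the moving line (`tendstoL2locUniform_approxSolution`).
-/

namespace PlanarEuler

/-! ### Planar vector calculus almost everywhere -/

/-- The first vector of the standard basis of the plane. -/
def e₀ : Plane := !₂[1, 0]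

/-- The second vector of the standard basis of the plane. -/
def e₁ : Plane := !₂[0, 1]

@[simp] lemma e₀_zero : e₀ 0 = 1 := rfl
@[simp] lemma e₀_one : e₀ 1 = 0 := rfl
@[simp] lemma e₁_zero : e₁ 0 = 0 := rfl
@[simp] lemma e₁_one : e₁ 1 = 1 := rfl
@[simp] lemma perp_zero_coord (v : Plane) : perp v 0 = -(v 1) := rfl
@[simp] lemma perp_one_coord (v : Plane) : perp v 1 = v 0 := rfl

lemma plane_ext {v w : Plane} (h0 : v 0 = w 0) (h1 : v 1 = w 1) : v = w := by
  ext i; fin_cases i <;> assumption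

lemma eq_smul_add_smul (v : Plane) : v = v 0 • e₀ + v 1 • e₁ := by
  apply plane_ext <;> simp

lemma normSq_plane (v : Plane) : ‖v‖ ^ 2 = v 0 ^ 2 + v 1 ^ 2 := by
  simp [EuclideanSpace.norm_sq_eq, Fin.sum_univ_two]

lemma abs_coord_le (v : Plane) (i : Fin 2) : |v i| ≤ ‖v‖ := PiLp.norm_apply_le v i

lemma norm_le_abs_add_abs (v : Plane) : ‖v‖ ≤ |v 0| + |v 1| := by
  apply le_of_sq_le_sq _ (by positivity)
  rw [normSq_plane]
  nlinarith [abs_nonneg (v 0), abs_nonneg (v 1), sq_abs (v 0), sq_abs (v 1),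
    mul_nonneg (abs_nonneg (v 0)) (abs_nonneg (v 1))]

/-- The rotation by a right angle as a continuous linear map. -/
noncomputable def perpL : Plane →L[ℝ] Plane :=
  LinearMap.toContinuousLinearMap
    { toFun := perp
      map_add' := fun v w => by apply plane_ext <;> simp; ring
      map_smul' := fun c v => by apply plane_ext <;> simp }

@[simp] lemma perpL_apply (v : Plane) : perpL v = perp v := rfl

lemma perp_add (v w : Plane) : perp (v + w) = perp v + perp w := map_add perpL v w
lemma perp_sub (v w : Plane) : perp (v - w) = perp v - perp w := map_sub perpL v w
lemma perp_smul (c : ℝ) (v : Plane) : perp (c • v) = c • perp v := map_smul perpL c v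

@[simp] lemma norm_perp (v : Plane) : ‖perp v‖ = ‖v‖ := by
  have : ‖perp v‖ ^ 2 = ‖v‖ ^ 2 := by simp [normSq_plane]; ring
  exact (sq_eq_sq₀ (norm_nonneg _) (norm_nonneg _)).1 this

lemma lipschitzWith_perp : LipschitzWith 1 perp :=
  LipschitzWith.of_dist_le_mul fun v w => by
    simp [dist_eq_norm, ← perp_sub]

/-- The coordinates as continuous linear forms. -/
noncomputable def coordL (i : Fin 2) : Plane →L[ℝ] ℝ := EuclideanSpace.proj i

@[simp] lemma coordL_apply (i : Fin 2) (v : Plane) : coordL i v = v i := rfl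

lemma lipschitzWith_coord (i : Fin 2) : LipschitzWith 1 (fun v : Plane => v i) :=
  LipschitzWith.of_dist_le_mul fun v w => by
    simpa [dist_eq_norm] using abs_coord_le (v - w) i

/-- The divergence `∂₀V₀ + ∂₁V₁`, computed from the (total) derivative. -/
noncomputable def divergence (V : Plane → Plane) (x : Plane) : ℝ :=
  fderiv ℝ V x e₀ 0 + fderiv ℝ V x e₁ 1

/-- The scalar curl `∂₀V₁ - ∂₁V₀`, computed from the (total) derivative. -/
noncomputable def curl (V : Plane → Plane) (x : Plane) : ℝ :=
  fderiv ℝ V x e₀ 1 - fderiv ℝ V x e₁ 0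

lemma hasFDerivAt_coord {V : Plane → Plane} {x : Plane} {V' : Plane →L[ℝ] Plane}
    (h : HasFDerivAt V V' x) (i : Fin 2) :
    HasFDerivAt (fun y => V y i) ((coordL i).comp V') x :=
  (coordL i).hasFDerivAt.comp x h

lemma fderiv_coord {V : Plane → Plane} {x : Plane} (h : DifferentiableAt ℝ V x) (i : Fin 2)
    (v : Plane) : fderiv ℝ (fun y => V y i) x v = fderiv ℝ V x v i := by
  rw [(hasFDerivAt_coord h.hasFDerivAt i).fderiv]; rfl

lemma fderiv_eq_coord (φ : Plane → ℝ) (x v : Plane) :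
    fderiv ℝ φ x v = v 0 * fderiv ℝ φ x e₀ + v 1 * fderiv ℝ φ x e₁ := by
  conv_lhs => rw [eq_smul_add_smul v]
  simp

lemma divergence_perp {V : Plane → Plane} {x : Plane} (h : DifferentiableAt ℝ V x) :
    divergence (fun y => perp (V y)) x = -curl V x := by
  have : HasFDerivAt (fun y => perp (V y)) (perpL.comp (fderiv ℝ V x)) x :=
    perpL.hasFDerivAt.comp x h.hasFDerivAt
  simp [divergence, curl, this.fderiv]; ring

section Lipschitz

variable {f φ : Plane → ℝ} {C D : ℝ≥0}

lemma integrable_mul_fderiv_of_lipschitz (hf : Continuous f) (hφ : LipschitzWith D φ)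
    (hs : HasCompactSupport φ) (v : Plane) : Integrable fun x => f x * fderiv ℝ φ x v := by
  have hK : IsCompact (tsupport φ) := hs
  obtain ⟨M, hM⟩ := hK.exists_bound_of_continuousOn hf.continuousOn
  have hI : Integrable ((tsupport φ).indicator fun _ => M * (D * ‖v‖)) :=
    (integrable_indicator_iff hK.measurableSet).2
      (integrableOn_const hK.measure_lt_top.ne)
  refine hI.mono' (hf.aestronglyMeasurable.mul
    (measurable_fderiv_apply_const ℝ φ v).aestronglyMeasurable) (ae_of_all _ fun x => ?_)
  by_cases hx : x ∈ tsupport φ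
  · rw [indicator_of_mem hx, norm_mul]
    have h1 : ‖fderiv ℝ φ x v‖ ≤ D * ‖v‖ :=
      (ContinuousLinearMap.le_opNorm _ _).trans
        (mul_le_mul_of_nonneg_right (norm_fderiv_le_of_lipschitz ℝ hφ) (norm_nonneg _))
    exact mul_le_mul (hM x hx) h1 (norm_nonneg _) ((norm_nonneg _).trans (hM x hx))
  · have : fderiv ℝ φ x = 0 := by
      by_contra h
      exact hx (support_fderiv_subset ℝ h)
    simp [this, indicator_of_notMem hx]

lemma integrable_fderiv_mul_of_lipschitz (hf : LipschitzWith C f) (hφ : Continuous φ)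
    (hs : HasCompactSupport φ) (v : Plane) : Integrable fun x => fderiv ℝ f x v * φ x := by
  have hI : Integrable fun x => (C * ‖v‖) * ‖φ x‖ :=
    ((hφ.integrable_of_hasCompactSupport hs).norm).const_mul _
  refine hI.mono' ((measurable_fderiv_apply_const ℝ f v).aestronglyMeasurable.mul
    hφ.aestronglyMeasurable) (ae_of_all _ fun x => ?_)
  rw [norm_mul]
  exact mul_le_mul_of_nonneg_right ((ContinuousLinearMap.le_opNorm _ _).trans
    (mul_le_mul_of_nonneg_right (norm_fderiv_le_of_lipschitz ℝ hf) (norm_nonneg _)))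
    (norm_nonneg _)

lemma integral_fderiv_mul_of_lipschitz (hf : LipschitzWith C f) (hφ : LipschitzWith D φ)
    (hs : HasCompactSupport φ) (v : Plane) :
    ∫ x, fderiv ℝ f x v * φ x = -∫ x, f x * fderiv ℝ φ x v := by
  have h := LipschitzWith.integral_lineDeriv_mul_eq (μ := (volume : Measure Plane)) hf hφ hs v
  have h1 : ∫ x, fderiv ℝ f x v * φ x = ∫ x, lineDeriv ℝ f x v * φ x := by
    refine integral_congr_ae ?_
    filter_upwards [hf.ae_differentiableAt (μ := volume)] with x hx
    rw [hx.lineDeriv_eq_fderiv]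
  have h2 : -∫ x, f x * fderiv ℝ φ x v = ∫ x, lineDeriv ℝ φ x (-v) * f x := by
    rw [← integral_neg]
    refine integral_congr_ae ?_
    filter_upwards [hφ.ae_differentiableAt (μ := volume)] with x hx
    rw [hx.lineDeriv_eq_fderiv, map_neg]; ring
  rw [h1, h2, h]

/-- The divergence theorem for Lipschitz functions: by Rademacher's theorem, all derivatives exist
almost everywhere. -/
theorem integral_fderiv_apply_of_lipschitz {V : Plane → Plane} (hV : LipschitzWith C V)
    (hφ : LipschitzWith D φ) (hs : HasCompactSupport φ) :
    ∫ x, fderiv ℝ φ x (V x) = -∫ x, divergence V x * φ x := by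
  have hc (i : Fin 2) : LipschitzWith (1 * C) fun x => V x i := (lipschitzWith_coord i).comp hV
  have h1 : ∫ x, fderiv ℝ φ x (V x) =
      (∫ x, V x 0 * fderiv ℝ φ x e₀) + ∫ x, V x 1 * fderiv ℝ φ x e₁ := by
    rw [← integral_add (integrable_mul_fderiv_of_lipschitz (hc 0).continuous hφ hs _)
      (integrable_mul_fderiv_of_lipschitz (hc 1).continuous hφ hs _)]
    exact integral_congr_ae (ae_of_all _ fun x => fderiv_eq_coord φ x (V x))
  have h2 : ∫ x, divergence V x * φ x = (∫ x, fderiv ℝ (fun y => V y 0) x e₀ * φ x) +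
      ∫ x, fderiv ℝ (fun y => V y 1) x e₁ * φ x := by
    rw [← integral_add (integrable_fderiv_mul_of_lipschitz (hc 0) hφ.continuous hs _)
      (integrable_fderiv_mul_of_lipschitz (hc 1) hφ.continuous hs _)]
    refine integral_congr_ae ?_
    filter_upwards [hV.ae_differentiableAt (μ := volume)] with x hx
    rw [fderiv_coord hx, fderiv_coord hx, divergence]; ring
  rw [h1, h2, integral_fderiv_mul_of_lipschitz (hc 0) hφ hs,
    integral_fderiv_mul_of_lipschitz (hc 1) hφ hs]
  ring

end Lipschitz

/-! ### Inverting the Biot-Savart law -/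

section RadialTest

variable {a : ℝ → ℝ}

lemma inner_plane (v w : Plane) : inner ℝ v w = v 0 * w 0 + v 1 * w 1 := by
  simp [PiLp.inner_apply, Fin.sum_univ_two]; ring

lemma hasFDerivAt_comp_normSq {a : ℝ → ℝ} {a' : ℝ} (x y : Plane)
    (ha : HasDerivAt a a' (‖y - x‖ ^ 2)) :
    HasFDerivAt (fun y : Plane => a (‖y - x‖ ^ 2))
      ((a' * 2) • (innerSL ℝ (y - x) : Plane →L[ℝ] ℝ)) y := by
  have h1 : HasFDerivAt (fun y : Plane => ‖y - x‖ ^ 2)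
      (2 • (innerSL ℝ (y - x) : Plane →L[ℝ] ℝ)) y :=
    ((hasFDerivAt_id y).sub_const x).norm_sq
  refine (ha.comp_hasFDerivAt y h1).congr_fderiv ?_
  ext v; simp; ring

lemma fderiv_radial_mul (ha : Differentiable ℝ a) (x y v : Plane) (i : Fin 2) :
    fderiv ℝ (fun y : Plane => a (‖y - x‖ ^ 2) * (y - x) i) y v =
      2 * deriv a (‖y - x‖ ^ 2) * inner ℝ (y - x) v * (y - x) i + a (‖y - x‖ ^ 2) * v i := by
  have h2 : HasFDerivAt (fun y : Plane => (y - x) i) (coordL i) y :=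
    hasFDerivAt_coord ((hasFDerivAt_id y).sub_const x) i
  have h3 : HasFDerivAt (fun y : Plane => a (‖y - x‖ ^ 2) * (y - x) i) _ y :=
    (hasFDerivAt_comp_normSq x y (ha _).hasDerivAt).mul h2
  rw [h3.fderiv]
  simp [inner_sub_left]; ring

lemma hasCompactSupport_of_radial {E : Type*} [Zero E] {f : Plane → E} (x : Plane) (R : ℝ)
    (h : ∀ y, R ^ 2 < ‖y - x‖ ^ 2 → f y = 0) : HasCompactSupport f := by
  refine HasCompactSupport.of_support_subset_isCompact (isCompact_closedBall x |R|) ?_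
  intro y hy
  by_contra hn
  refine hy (h y ?_)
  rw [Metric.mem_closedBall, not_le, dist_eq_norm] at hn
  rw [← sq_abs R]
  exact pow_lt_pow_left₀ hn (abs_nonneg _) two_ne_zero

/-- Testing `div u = 0` and `curl u = ω` with the curl-free radial field `a(|y-x|²) (y-x)`. With
`a(s) = 1/s` this would be the Biot-Savart law. -/
lemma integral_smul_radial_perp {u : Plane → Plane} {ω : Plane → ℝ} {C : ℝ≥0}
    (hu : LipschitzWith C u) (hdiv : ∀ᵐ x, divergence u x = 0) (hcurl : ∀ᵐ x, curl u x = ω x)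
    (ha : ContDiff ℝ 1 a) {R : ℝ} (haR : ∀ s, R ^ 2 < s → a s = 0) (x : Plane) :
    ∫ y, ω y • a (‖x - y‖ ^ 2) • perp (x - y) =
      ∫ y, (2 * (a (‖y - x‖ ^ 2) + ‖y - x‖ ^ 2 * deriv a (‖y - x‖ ^ 2))) • u y := by
  set φ : Fin 2 → Plane → ℝ := fun i y => a (‖y - x‖ ^ 2) * (y - x) i with hφ
  have hφs (i : Fin 2) : HasCompactSupport (φ i) :=
    hasCompactSupport_of_radial x R fun y hy => by simp [hφ, haR _ hy]
  have hφc (i : Fin 2) : ContDiff ℝ 1 (φ i) := by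
    refine (ha.comp ((contDiff_norm_sq ℝ).comp (contDiff_id.sub contDiff_const))).mul ?_
    exact (coordL i).contDiff.comp (contDiff_id.sub contDiff_const)
  have hφl (i : Fin 2) := (hφc i).lipschitzWith_of_hasCompactSupport (hφs i) (by simp)
  choose D hD using hφl
  have hd : Differentiable ℝ a := ha.differentiable (by simp)
  have hda : Continuous (deriv a) := ha.continuous_deriv le_rfl
  have hpu : LipschitzWith (1 * C) fun y => perp (u y) := lipschitzWith_perp.comp hu
  -- the divergence theorem for `u` and for its rotation, whose divergence is `-ω`
  have h1 (i : Fin 2) : ∫ y, fderiv ℝ (φ i) y (u y) = 0 := by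
    rw [integral_fderiv_apply_of_lipschitz hu (hD i) (hφs i), neg_eq_zero]
    refine integral_eq_zero_of_ae ?_
    filter_upwards [hdiv] with y hy
    simp [hy]
  have h2 (i : Fin 2) : ∫ y, fderiv ℝ (φ i) y (perp (u y)) = ∫ y, ω y * φ i y := by
    rw [integral_fderiv_apply_of_lipschitz hpu (hD i) (hφs i), ← integral_neg]
    refine integral_congr_ae ?_
    filter_upwards [hcurl, hu.ae_differentiableAt (μ := volume)] with y hy hy'
    rw [divergence_perp hy', hy]; ring
  have int (i : Fin 2) {V : Plane → Plane} (hV : Continuous V) :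
      Integrable fun y => fderiv ℝ (φ i) y (V y) := by
    refine (Continuous.integrable_of_hasCompactSupport ?_ ?_)
    · exact ((hφc i).continuous_fderiv (by simp)).clm_apply hV
    · exact ((hφs i).fderiv (𝕜 := ℝ)).mono fun y hy => by
        intro h; exact hy (by simp [h])
  have hRs : HasCompactSupport fun y =>
      (2 * (a (‖y - x‖ ^ 2) + ‖y - x‖ ^ 2 * deriv a (‖y - x‖ ^ 2))) • u y := by
    refine hasCompactSupport_of_radial x R fun y hy => ?_
    have : a =ᶠ[𝓝 (‖y - x‖ ^ 2)] fun _ => 0 := by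
      filter_upwards [lt_mem_nhds hy] with s hs using haR s hs
    simp [haR _ hy, this.deriv_eq]
  have hRi : Integrable fun y =>
      (2 * (a (‖y - x‖ ^ 2) + ‖y - x‖ ^ 2 * deriv a (‖y - x‖ ^ 2))) • u y := by
    refine Continuous.integrable_of_hasCompactSupport ?_ hRs
    have := hu.continuous
    have := ha.continuous
    fun_prop
  have hω (i : Fin 2) : Integrable fun y => ω y * φ i y := by
    refine ((integrable_fderiv_mul_of_lipschitz ((lipschitzWith_coord 1).comp hu)
      (hφc i).continuous (hφs i) e₀).sub (integrable_fderiv_mul_of_lipschitz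
      ((lipschitzWith_coord 0).comp hu) (hφc i).continuous (hφs i) e₁)).congr ?_
    filter_upwards [hcurl, hu.ae_differentiableAt (μ := volume)] with y hy hy'
    have e0 := fderiv_coord hy' 0 e₁
    have e1 := fderiv_coord hy' 1 e₀
    simp only [Function.comp_def, Pi.sub_apply] at *
    rw [e0, e1, ← hy, curl]; ring
  have hLi : Integrable fun y => ω y • a (‖x - y‖ ^ 2) • perp (x - y) := by
    have : (fun y => ω y • a (‖x - y‖ ^ 2) • perp (x - y)) =
        fun y => (ω y * φ 1 y) • e₀ - (ω y * φ 0 y) • e₁ := by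
      ext1 y
      apply plane_ext <;> (simp [hφ, norm_sub_rev x y]; try ring)
    rw [this]
    exact ((hω 1).smul_const _).sub ((hω 0).smul_const _)
  have coord (i : Fin 2) {f : Plane → Plane} (hf : Integrable f) : (∫ y, f y) i = ∫ y, f y i := by
    simpa using ((coordL i).integral_comp_comm hf).symm
  have hI (y : Plane) : ‖y - x‖ ^ 2 = (y - x) 0 ^ 2 + (y - x) 1 ^ 2 := normSq_plane _
  apply plane_ext
  · rw [coord 0 hLi, coord 0 hRi]
    have : ∫ y, (ω y • a (‖x - y‖ ^ 2) • perp (x - y)) 0 = ∫ y, ω y * φ 1 y :=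
      integral_congr_ae (ae_of_all _ fun y => by simp [hφ, norm_sub_rev x y])
    rw [this, ← h2 1, ← add_zero (∫ y, _), ← h1 0, ← integral_add (int 1 hpu.continuous)
      (int 0 hu.continuous)]
    refine integral_congr_ae (ae_of_all _ fun y => ?_)
    simp only [hφ, fderiv_radial_mul hd, inner_plane, perp_zero_coord, perp_one_coord,
      PiLp.smul_apply, smul_eq_mul]
    linear_combination (-2 * deriv a (‖y - x‖ ^ 2) * u y 0) * hI y
  · rw [coord 1 hLi, coord 1 hRi]
    have : ∫ y, (ω y • a (‖x - y‖ ^ 2) • perp (x - y)) 1 = -∫ y, ω y * φ 0 y := by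
      rw [← integral_neg]
      exact integral_congr_ae (ae_of_all _ fun y => by simp [hφ, norm_sub_rev x y]; ring)
    rw [this, ← h2 0, ← zero_sub, ← h1 1, ← integral_sub (int 1 hu.continuous)
      (int 0 hpu.continuous)]
    refine integral_congr_ae (ae_of_all _ fun y => ?_)
    simp only [hφ, fderiv_radial_mul hd, inner_plane, perp_zero_coord, perp_one_coord,
      PiLp.smul_apply, smul_eq_mul]
    linear_combination (-2 * deriv a (‖y - x‖ ^ 2) * u y 1) * hI y

end RadialTest

/-! ### The singularity of the Biot-Savart kernel -/

lemma volume_real_ball_zero_one : (volume : Measure Plane).real (Metric.ball 0 1) = Real.pi := by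
  simp [Measure.real, EuclideanSpace.volume_ball_fin_two, Real.pi_nonneg]

/-- Integration of radial functions in polar coordinates. -/
lemma integral_radial (f : ℝ → ℝ) :
    ∫ z : Plane, f ‖z‖ = 2 * Real.pi * ∫ r in Ioi (0 : ℝ), r * f r := by
  have := integral_fun_norm_addHaar (volume : Measure Plane) f
  rw [this, volume_real_ball_zero_one]
  simp; ring

lemma integrable_radial_iff (f : ℝ → ℝ) :
    Integrable (fun z : Plane => f ‖z‖) ↔ IntegrableOn (fun r => r * f r) (Ioi 0) := by
  simpa using integrable_fun_norm_addHaar (volume : Measure Plane) (f := f)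

section Singularity

variable {s : ℝ}

lemma integrableOn_singularity (hs : s < 2) :
    IntegrableOn (fun r : ℝ => r * (Iio (1 : ℝ)).indicator (fun r => r ^ (-s)) r) (Ioi 0) := by
  have h : IntegrableOn (fun r : ℝ => r ^ (1 - s)) (Ioo 0 1) := by
    have := (intervalIntegral.intervalIntegrable_rpow' (a := 0) (b := 1)
      (r := 1 - s) (by linarith)).1
    exact this.mono_set Ioo_subset_Ioc_self
  have h2 : IntegrableOn ((Ioo (0 : ℝ) 1).indicator fun r : ℝ => r ^ (1 - s)) (Ioi 0) :=
    ((integrable_indicator_iff measurableSet_Ioo).2 h).integrableOn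
  refine h2.congr_fun (fun r hr => ?_) measurableSet_Ioi
  rw [mem_Ioi] at hr
  have hr' := hr
  by_cases h1 : r < 1
  · simp [indicator, hr', h1, Real.rpow_sub hr', Real.rpow_neg hr'.le, div_eq_mul_inv]
  · simp [indicator, h1]

/-- The integral of `‖z‖^(-s)` over the unit disk of the plane. -/
lemma integral_singularity (hs : s < 2) :
    ∫ z : Plane, (Iio (1 : ℝ)).indicator (fun r => r ^ (-s)) ‖z‖ = 2 * Real.pi / (2 - s) := by
  rw [integral_radial]
  have h : ∫ r in Ioi (0 : ℝ), r * (Iio (1 : ℝ)).indicator (fun r => r ^ (-s)) r =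
      ∫ r in Ioo (0 : ℝ) 1, r ^ (1 - s) := by
    rw [← integral_indicator measurableSet_Ioo, ← integral_indicator measurableSet_Ioi]
    refine integral_congr_ae (ae_of_all _ fun r => ?_)
    by_cases hr' : 0 < r
    · by_cases h1 : r < 1
      · simp [indicator, hr', h1, Real.rpow_sub hr', Real.rpow_neg hr'.le, div_eq_mul_inv]
      · simp [indicator, h1]
    · simp [indicator, hr']
  rw [h, ← integral_Ioc_eq_integral_Ioo, ← intervalIntegral.integral_of_le zero_le_one,
    integral_rpow (Or.inl (by linarith)), Real.one_rpow, Real.zero_rpow (by linarith)]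
  field_simp
  ring

lemma integrable_singularity (hs : s < 2) :
    Integrable fun z : Plane => (Iio (1 : ℝ)).indicator (fun r => r ^ (-s)) ‖z‖ :=
  (integrable_radial_iff _).2 (integrableOn_singularity hs)

lemma rpow_neg_le_indicator_add_one (hs : 0 ≤ s) (r : ℝ) :
    r ^ (-s) ≤ (Iio (1 : ℝ)).indicator (fun r => r ^ (-s)) r + 1 := by
  by_cases h : r < 1
  · simp [indicator, h]
  · simpa [indicator, h] using Real.rpow_le_one_of_one_le_of_nonpos (not_lt.1 h) (by linarith)

lemma integrable_mul_singularity (hs0 : 0 ≤ s) (hs : s < 2) {f : Plane → ℝ} {M : ℝ}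
    (hf : Integrable f) (hM : ∀ᵐ y, |f y| ≤ M) (x : Plane) :
    Integrable fun y => f y * ‖x - y‖ ^ (-s) := by
  have h1 : Integrable fun y => M * (Iio (1 : ℝ)).indicator (fun r => r ^ (-s)) ‖x - y‖ + |f y| :=
    (((integrable_singularity hs).comp_sub_left x).const_mul M).add hf.abs
  have hmeas : Measurable fun y : Plane => ‖x - y‖ ^ (-s) :=
    (by fun_prop : Measurable fun y : Plane => ‖x - y‖).pow_const _
  refine h1.mono' (hf.aestronglyMeasurable.mul hmeas.aestronglyMeasurable) ?_
  filter_upwards [hM] with y hy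
  have h0 := rpow_neg_le_indicator_add_one hs0 ‖x - y‖
  have h2 : 0 ≤ (Iio (1 : ℝ)).indicator (fun r => r ^ (-s)) ‖x - y‖ :=
    indicator_apply_nonneg fun _ => by positivity
  rw [norm_mul, Real.norm_eq_abs, Real.norm_of_nonneg (by positivity)]
  nlinarith [abs_nonneg (f y)]

/-- A singularity `‖x - y‖^(-s)`, `s < 2`, is integrable against the indicator of a set `A` of
finite measure, uniformly in `x`. -/
lemma integral_singularity_le (hs0 : 0 ≤ s) (hs : s < 2) {A : Set Plane}
    (hAf : volume A ≠ ⊤) (x : Plane) :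
    ∫ y in A, ‖x - y‖ ^ (-s) ≤ 2 * Real.pi / (2 - s) + volume.real A := by
  have hi := (integrable_singularity hs).comp_sub_left x
  have h1 : IntegrableOn (fun y => (Iio (1 : ℝ)).indicator (fun r => r ^ (-s)) ‖x - y‖ + 1) A :=
    hi.integrableOn.add (integrableOn_const hAf)
  calc ∫ y in A, ‖x - y‖ ^ (-s)
      ≤ ∫ y in A, ((Iio (1 : ℝ)).indicator (fun r => r ^ (-s)) ‖x - y‖ + 1) := by
        refine integral_mono_of_nonneg (ae_of_all _ fun y => by positivity) h1
          (ae_of_all _ fun y => rpow_neg_le_indicator_add_one hs0 _)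
    _ = (∫ y in A, (Iio (1 : ℝ)).indicator (fun r => r ^ (-s)) ‖x - y‖) + volume.real A := by
        rw [integral_add hi.integrableOn (integrableOn_const hAf)]
        simp
    _ ≤ (∫ y, (Iio (1 : ℝ)).indicator (fun r => r ^ (-s)) ‖x - y‖) + volume.real A := by
        have := setIntegral_le_integral (s := A) hi (ae_of_all _ fun y =>
          indicator_apply_nonneg fun _ => by positivity)
        linarith
    _ = _ := by
        rw [integral_sub_left_eq_self (fun z : Plane =>
          (Iio (1 : ℝ)).indicator (fun r => r ^ (-s)) ‖z‖), integral_singularity hs]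

end Singularity

lemma norm_biotSavartKernel (z : Plane) : ‖biotSavartKernel z‖ = 1 / (2 * Real.pi) * ‖z‖⁻¹ := by
  rw [biotSavartKernel, norm_smul, norm_perp, Real.norm_of_nonneg (by positivity)]
  rcases eq_or_ne ‖z‖ 0 with h | h
  · simp [h]
  · field_simp

lemma measurable_biotSavartKernel : Measurable biotSavartKernel := by
  unfold biotSavartKernel
  have : Continuous perp := lipschitzWith_perp.continuous
  have h2 : Measurable fun z : Plane => perp z := this.measurable
  have h3 : Measurable fun z : Plane => 1 / (2 * Real.pi * ‖z‖ ^ 2) :=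
    measurable_const.div (by fun_prop)
  exact h3.smul h2

lemma integrable_smul_biotSavartKernel {f : Plane → ℝ} {M : ℝ}
    (hf : Integrable f) (hM : ∀ᵐ y, |f y| ≤ M) (x : Plane) :
    Integrable fun y => f y • biotSavartKernel (x - y) := by
  have h1 := (integrable_mul_singularity zero_le_one one_lt_two hf hM x).norm.const_mul
    (1 / (2 * Real.pi))
  refine h1.mono' (hf.aestronglyMeasurable.smul (measurable_biotSavartKernel.comp
    (measurable_const.sub measurable_id)).aestronglyMeasurable) (ae_of_all _ fun y => ?_)
  rw [norm_smul, norm_biotSavartKernel, norm_mul, Real.rpow_neg_one, norm_inv, norm_norm]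
  apply le_of_eq; ring

/-! ### The velocity field is determined by its divergence, its curl and its decay -/

/-- The quotient is smooth at `s = 0` because it vanishes near there. -/
lemma contDiff_div_self {n : WithTop ℕ∞} {m : ℝ → ℝ} (hm : ContDiff ℝ n m) {δ : ℝ} (hδ : 0 < δ)
    (h0 : ∀ s < δ, m s = 0) : ContDiff ℝ n fun s => m s / s := by
  rw [contDiff_iff_contDiffAt]
  intro s
  rcases lt_or_ge s δ with h | h
  · refine contDiffAt_const (c := (0 : ℝ)) |>.congr_of_eventuallyEq ?_
    filter_upwards [gt_mem_nhds h] with r hr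
    simp [h0 r hr]
  · exact hm.contDiffAt.div contDiffAt_id (hδ.trans_le h).ne'

/-- A smooth step from `0` (for `s ≤ 1/2`) to `1` (for `s ≥ 1`). -/
noncomputable def stepFn (s : ℝ) : ℝ := Real.smoothTransition (2 * s - 1)

lemma contDiff_stepFn : ContDiff ℝ 1 stepFn :=
  (Real.smoothTransition.contDiff (n := 1)).comp (by fun_prop)

lemma stepFn_eq_zero {s : ℝ} (h : s ≤ 1 / 2) : stepFn s = 0 :=
  Real.smoothTransition.zero_of_nonpos (by linarith)

lemma stepFn_eq_one {s : ℝ} (h : 1 ≤ s) : stepFn s = 1 :=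
  Real.smoothTransition.one_of_one_le (by linarith)

lemma continuous_deriv_stepFn : Continuous (deriv stepFn) := contDiff_stepFn.continuous_deriv le_rfl

lemma deriv_stepFn_eq_zero {s : ℝ} (h : 1 < s) : deriv stepFn s = 0 := by
  have : stepFn =ᶠ[𝓝 s] fun _ => 1 := by
    filter_upwards [lt_mem_nhds h] with r hr using stepFn_eq_one hr.le
  simp [this.deriv_eq]

lemma hasCompactSupport_deriv_stepFn_normSq :
    HasCompactSupport fun z : Plane => deriv stepFn (‖z‖ ^ 2) :=
  hasCompactSupport_of_radial 0 1 fun y hy => deriv_stepFn_eq_zero (by simpa using hy)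

lemma integrable_deriv_stepFn_normSq : Integrable fun z : Plane => deriv stepFn (‖z‖ ^ 2) := by
  refine Continuous.integrable_of_hasCompactSupport ?_ hasCompactSupport_deriv_stepFn_normSq
  have := continuous_deriv_stepFn
  fun_prop

lemma integral_deriv_stepFn_normSq : ∫ z : Plane, deriv stepFn (‖z‖ ^ 2) = Real.pi := by
  rw [integral_radial fun r => deriv stepFn (r ^ 2)]
  have hd (r : ℝ) : HasDerivAt (fun r => stepFn (r ^ 2)) (deriv stepFn (r ^ 2) * (2 * r)) r := by
    have := ((contDiff_stepFn.differentiable (by simp)) (r ^ 2)).hasDerivAt.comp r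
      (hasDerivAt_pow 2 r)
    refine this.congr_deriv ?_
    simp
  have hi := (integrable_radial_iff fun r => deriv stepFn (r ^ 2)).1 integrable_deriv_stepFn_normSq
  have h2 : IntegrableOn (fun r => deriv stepFn (r ^ 2) * (2 * r)) (Ioi 0) :=
    IntegrableOn.congr_fun (hi.const_mul 2) (fun r _ => by ring) measurableSet_Ioi
  have ht : Tendsto (fun r : ℝ => stepFn (r ^ 2)) atTop (𝓝 1) := by
    refine tendsto_const_nhds.congr' ?_
    filter_upwards [eventually_ge_atTop 1] with r hr
    exact (stepFn_eq_one (by nlinarith)).symm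
  have h3 := integral_Ioi_of_hasDerivAt_of_tendsto (hd 0).continuousAt.continuousWithinAt
    (fun r _ => hd r) h2 ht
  have h4 : ∫ r in Ioi (0 : ℝ), deriv stepFn (r ^ 2) * (2 * r) =
      2 * ∫ r in Ioi (0 : ℝ), r * deriv stepFn (r ^ 2) := by
    rw [← integral_const_mul]
    congr 1; ext r; ring
  rw [h4, stepFn_eq_zero (by norm_num)] at h3
  linear_combination Real.pi * h3

/-- The average `∫ 2 r⁻² σ'(‖y - x‖²/r²) u(y) dy` at scale `r`, after rescaling. -/
lemma integral_rescale {u : Plane → Plane} (x : Plane) {r : ℝ} (hr : 0 < r) :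
    ∫ y, (2 * (deriv stepFn (‖y - x‖ ^ 2 / r ^ 2) / r ^ 2)) • u y =
      ∫ z, (2 * deriv stepFn (‖z‖ ^ 2)) • u (x + r • z) := by
  have h := Measure.integral_comp_smul (volume : Measure Plane)
    (fun z => (2 * deriv stepFn (‖z‖ ^ 2 / r ^ 2)) • u (x + z)) r
  have h1 : (fun z : Plane => (2 * deriv stepFn (‖r • z‖ ^ 2 / r ^ 2)) • u (x + r • z)) =
      fun z => (2 * deriv stepFn (‖z‖ ^ 2)) • u (x + r • z) := by
    ext1 z
    rw [norm_smul, mul_pow, Real.norm_eq_abs, sq_abs, mul_div_cancel_left₀ _ (by positivity)]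
  rw [h1] at h
  rw [h, ← integral_add_left_eq_self _ x, ← integral_smul]
  refine integral_congr_ae (ae_of_all _ fun y => ?_)
  simp only [add_sub_cancel_left, smul_smul]
  congr 1
  rw [abs_of_pos (by positivity)]
  simp
  ring

/-- Averages of `u` at scales `r n` around `x`, both for `r n → 0`, where `v = u x`, and for
`r n → ∞`, where `v` is the limit of `u` at infinity. -/
lemma tendsto_average {u : Plane → Plane} (hu : Continuous u) {B : ℝ} (hB : ∀ x, ‖u x‖ ≤ B)
    (x v : Plane) (r : ℕ → ℝ)
    (h : ∀ z : Plane, z ≠ 0 → Tendsto (fun n => u (x + r n • z)) atTop (𝓝 v)) :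
    Tendsto (fun n => ∫ z, (2 * deriv stepFn (‖z‖ ^ 2)) • u (x + r n • z)) atTop
      (𝓝 ((2 * Real.pi) • v)) := by
  have hv : (2 * Real.pi) • v = ∫ z : Plane, (2 * deriv stepFn (‖z‖ ^ 2)) • v := by
    rw [integral_smul_const, integral_const_mul, integral_deriv_stepFn_normSq]
  rw [hv]
  have hc := continuous_deriv_stepFn
  refine tendsto_integral_of_dominated_convergence
    (fun z => ‖2 * deriv stepFn (‖z‖ ^ 2)‖ * B) (fun n => ?_)
    ((integrable_deriv_stepFn_normSq.const_mul 2).norm.mul_const B)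
    (fun n => ae_of_all _ fun z => ?_) ?_
  · exact Continuous.aestronglyMeasurable (by fun_prop)
  · rw [norm_smul]
    exact mul_le_mul_of_nonneg_left (hB _) (norm_nonneg _)
  · have : ∀ᵐ z : Plane, z ≠ 0 := by simp [ae_iff]
    filter_upwards [this] with z hz
    exact (h z hz).const_smul _

/-- A bounded Lipschitz velocity field which vanishes at infinity is given by the Biot-Savart law
from its curl, if it is divergence free. -/
theorem biotSavart_eq_of_curl {u : Plane → Plane} {ω : Plane → ℝ} {C : ℝ≥0} {M : ℝ}
    (hu : LipschitzWith C u) (hu0 : Tendsto u (cocompact Plane) (𝓝 0))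
    (hdiv : ∀ᵐ x, divergence u x = 0) (hcurl : ∀ᵐ x, curl u x = ω x)
    (hω : Integrable ω) (hM : ∀ᵐ x, |ω x| ≤ M) : biotSavart ω = u := by
  ext1 x
  obtain ⟨B, hB⟩ : ∃ B, ∀ x, ‖u x‖ ≤ B := by
    obtain ⟨K, hK, hK'⟩ := mem_cocompact.1 (hu0 (Metric.closedBall_mem_nhds 0 one_pos))
    obtain ⟨B, hB⟩ := hK.exists_bound_of_continuousOn hu.continuous.continuousOn
    refine ⟨max B 1, fun x => ?_⟩
    by_cases hx : x ∈ K
    · exact (hB x hx).trans (le_max_left _ _)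
    · have := hK' hx
      simp only [mem_preimage, mem_closedBall_zero_iff] at this
      exact this.trans (le_max_right _ _)
  set r : ℕ → ℝ := fun n => n + 1 with hr
  have hr1 (n : ℕ) : 1 ≤ r n := by simp [hr]
  have hr0 (n : ℕ) : 0 < r n := by positivity
  have hrt : Tendsto r atTop atTop := tendsto_atTop_add_const_right _ _ tendsto_natCast_atTop_atTop
  set m : ℕ → ℝ → ℝ := fun n s => stepFn (s * r n ^ 2) - stepFn (s / r n ^ 2) with hm
  have hmc (n : ℕ) : ContDiff ℝ 1 (m n) :=
    (contDiff_stepFn.comp (by fun_prop)).sub (contDiff_stepFn.comp (by fun_prop))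
  have hm0 (n : ℕ) (s : ℝ) (hs : s < 1 / (2 * r n ^ 2)) : m n s = 0 := by
    have h1 : s * r n ^ 2 ≤ 1 / 2 := by
      rw [lt_div_iff₀ (by positivity)] at hs; linarith
    have h2 : s / r n ^ 2 ≤ 1 / 2 := by
      have : 1 ≤ r n ^ 2 := one_le_pow₀ (hr1 n)
      rw [div_le_iff₀ (by positivity)]
      rcases le_or_gt s 0 with h | h
      · linarith
      · nlinarith
    simp [hm, stepFn_eq_zero h1, stepFn_eq_zero h2]
  have hm1 (n : ℕ) (s : ℝ) (hs : r n ^ 2 < s) : m n s = 0 := by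
    have h3 : 1 ≤ r n ^ 2 := one_le_pow₀ (hr1 n)
    have h1 : 1 ≤ s * r n ^ 2 := by nlinarith
    have h2 : 1 ≤ s / r n ^ 2 := by rw [le_div_iff₀ (by positivity)]; linarith
    simp [hm, stepFn_eq_one h1, stepFn_eq_one h2]
  have ha (n : ℕ) : ContDiff ℝ 1 fun s => m n s / s :=
    contDiff_div_self (hmc n) (by positivity) (hm0 n)
  have hcs := contDiff_stepFn.differentiable (by simp)
  have hmd (n : ℕ) (s : ℝ) : HasDerivAt (m n)
      (deriv stepFn (s * r n ^ 2) * r n ^ 2 - deriv stepFn (s / r n ^ 2) / r n ^ 2) s := by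
    have h1 := (hcs (s * r n ^ 2)).hasDerivAt.comp s ((hasDerivAt_id s).mul_const (r n ^ 2))
    have h2 := (hcs (s / r n ^ 2)).hasDerivAt.comp s ((hasDerivAt_id s).div_const (r n ^ 2))
    refine (h1.sub h2).congr_deriv ?_
    simp [div_eq_mul_inv]
  -- the product rule: the divergence of the test field `a(‖z‖²) z` is `2 m'(‖z‖²)`
  have hprod (n : ℕ) (s : ℝ) (hs : s ≠ 0) : m n s / s + s * deriv (fun s => m n s / s) s =
      deriv stepFn (s * r n ^ 2) * r n ^ 2 - deriv stepFn (s / r n ^ 2) / r n ^ 2 := by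
    have h : HasDerivAt (fun s => m n s / s) _ s := (hmd n s).div (hasDerivAt_id s) hs
    rw [h.deriv]
    simp
    field_simp
    ring
  have hid (n : ℕ) : ∫ y, ω y • (m n (‖x - y‖ ^ 2) / ‖x - y‖ ^ 2) • perp (x - y) =
      (∫ z, (2 * deriv stepFn (‖z‖ ^ 2)) • u (x + (r n)⁻¹ • z)) -
        ∫ z, (2 * deriv stepFn (‖z‖ ^ 2)) • u (x + r n • z) := by
    have hc := continuous_deriv_stepFn
    have huc := hu.continuous
    have hint (q : ℝ) (hq : 0 < q) :
        Integrable fun y => (2 * (deriv stepFn (‖y - x‖ ^ 2 / q ^ 2) / q ^ 2)) • u y := by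
      refine Continuous.integrable_of_hasCompactSupport (by fun_prop) ?_
      refine hasCompactSupport_of_radial x q fun y hy => ?_
      rw [deriv_stepFn_eq_zero]
      · simp
      · rwa [lt_div_iff₀ (by positivity), one_mul]
    rw [integral_smul_radial_perp hu hdiv hcurl (ha n) (R := r n)
      (fun s hs => by rw [hm1 n s hs, zero_div]) x,
      ← integral_rescale x (inv_pos.2 (hr0 n)), ← integral_rescale x (hr0 n),
      ← integral_sub (hint _ (inv_pos.2 (hr0 n))) (hint _ (hr0 n))]
    have : ∀ᵐ y : Plane, y ≠ x := by simp [ae_iff]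
    refine integral_congr_ae ?_
    filter_upwards [this] with y hy
    rw [hprod n _ (pow_ne_zero 2 (norm_ne_zero_iff.2 (sub_ne_zero.2 hy))), ← sub_smul]
    congr 1
    simp [div_eq_mul_inv]
    ring
  have hlim1 : Tendsto (fun n => ∫ z, (2 * deriv stepFn (‖z‖ ^ 2)) • u (x + (r n)⁻¹ • z)) atTop
      (𝓝 ((2 * Real.pi) • u x)) := by
    refine tendsto_average hu.continuous hB x (u x) _ fun z _ => ?_
    have h1 : Tendsto (fun n => x + (r n)⁻¹ • z) atTop (𝓝 (x + (0 : ℝ) • z)) :=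
      ((tendsto_inv_atTop_zero.comp hrt).smul_const z).const_add x
    rw [zero_smul, add_zero] at h1
    exact (hu.continuous.tendsto _).comp h1
  have hlim2 : Tendsto (fun n => ∫ z, (2 * deriv stepFn (‖z‖ ^ 2)) • u (x + r n • z)) atTop
      (𝓝 ((2 * Real.pi) • 0)) := by
    refine tendsto_average hu.continuous hB x 0 _ fun z hz => hu0.comp ?_
    rw [← Metric.cobounded_eq_cocompact, ← tendsto_norm_atTop_iff_cobounded]
    have h1 : Tendsto (fun n => r n * ‖z‖ - ‖x‖) atTop atTop :=
      tendsto_atTop_add_const_right _ _ (hrt.atTop_mul_const (norm_pos_iff.2 hz))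
    refine tendsto_atTop_mono (fun n => ?_) h1
    have := norm_sub_le (x + r n • z) x
    rw [add_sub_cancel_left, norm_smul, Real.norm_of_nonneg (hr0 n).le] at this
    linarith
  have hstep (s : ℝ) : 0 ≤ stepFn s ∧ stepFn s ≤ 1 :=
    ⟨Real.smoothTransition.nonneg _, Real.smoothTransition.le_one _⟩
  have hlim3 : Tendsto (fun n => ∫ y, ω y • (m n (‖x - y‖ ^ 2) / ‖x - y‖ ^ 2) • perp (x - y)) atTop
      (𝓝 (∫ y, ω y • (2 * Real.pi) • biotSavartKernel (x - y))) := by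
    refine tendsto_integral_of_dominated_convergence (fun y => ‖ω y * ‖x - y‖ ^ (-1 : ℝ)‖)
      (fun n => ?_) (integrable_mul_singularity zero_le_one one_lt_two hω hM x).norm
      (fun n => ae_of_all _ fun y => ?_) ?_
    · have h1 := (hmc n).continuous
      have h2 : Continuous perp := lipschitzWith_perp.continuous
      have h3 : Continuous fun y => perp (x - y) := by fun_prop
      have h4 : Measurable fun y => m n (‖x - y‖ ^ 2) := by fun_prop
      have h5 : Measurable fun y => m n (‖x - y‖ ^ 2) / ‖x - y‖ ^ 2 := h4.div (by fun_prop)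
      exact hω.aestronglyMeasurable.smul
        (h5.aestronglyMeasurable.smul h3.aestronglyMeasurable)
    · rw [norm_smul, norm_smul, norm_perp, norm_mul]
      refine mul_le_mul_of_nonneg_left ?_ (norm_nonneg _)
      rw [Real.rpow_neg_one, norm_inv, norm_norm, norm_div, norm_pow, norm_norm]
      have h1 : ‖m n (‖x - y‖ ^ 2)‖ ≤ 1 := by
        rw [Real.norm_eq_abs, abs_le]
        have h1 := hstep (‖x - y‖ ^ 2 * r n ^ 2)
        have h2 := hstep (‖x - y‖ ^ 2 / r n ^ 2)
        simp only [hm]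
        constructor <;> linarith
      rcases eq_or_ne ‖x - y‖ 0 with h | h
      · simp [h]
      · have h2 : 0 < ‖x - y‖ := lt_of_le_of_ne (norm_nonneg _) h.symm
        calc _ ≤ 1 / ‖x - y‖ ^ 2 * ‖x - y‖ := by gcongr
          _ = _ := by field_simp
    · have : ∀ᵐ y : Plane, y ≠ x := by simp [ae_iff]
      filter_upwards [this] with y hy
      refine tendsto_const_nhds.congr' ?_
      have hp : 0 < ‖x - y‖ ^ 2 := pow_pos (norm_pos_iff.2 (sub_ne_zero.2 hy.symm)) 2
      filter_upwards [hrt.eventually_ge_atTop (1 / ‖x - y‖ ^ 2),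
        hrt.eventually_ge_atTop (2 * ‖x - y‖ ^ 2)] with n h1 h2
      have h3 := hr1 n
      rw [div_le_iff₀ hp] at h1
      have e1 : stepFn (‖x - y‖ ^ 2 * r n ^ 2) = 1 := stepFn_eq_one (by nlinarith)
      have e2 : stepFn (‖x - y‖ ^ 2 / r n ^ 2) = 0 := by
        refine stepFn_eq_zero ?_
        rw [div_le_iff₀ (by positivity)]
        nlinarith
      simp only [hm, e1, e2, biotSavartKernel, smul_smul]
      congr 1
      field_simp
      simp
  have hlim4 := (hlim1.sub hlim2).congr fun n => (hid n).symm
  have h := tendsto_nhds_unique hlim3 hlim4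
  have h5 : ∫ y, ω y • (2 * Real.pi) • biotSavartKernel (x - y) =
      (2 * Real.pi) • biotSavart ω x := by
    rw [biotSavart, ← integral_smul]
    refine integral_congr_ae (ae_of_all _ fun y => ?_)
    simp only [smul_smul, mul_comm]
  rw [h5, smul_zero, sub_zero] at h
  exact smul_right_injective _ (by positivity) h

/-! ### Uniqueness of Yudovich solutions -/

/-- The kernel is, up to the factor `2π` and a reflection, the inversion in the unit circle. -/
lemma norm_biotSavartKernel_sub {z w : Plane} (hz : z ≠ 0) (hw : w ≠ 0) :
    ‖biotSavartKernel z - biotSavartKernel w‖ =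
      1 / (2 * Real.pi) * (‖z - w‖ * ‖z‖⁻¹ * ‖w‖⁻¹) := by
  have hz' : 0 < ‖z‖ := norm_pos_iff.2 hz
  have hw' : 0 < ‖w‖ := norm_pos_iff.2 hw
  have h1 : biotSavartKernel z - biotSavartKernel w =
      perp ((1 / (2 * Real.pi)) • ((‖z‖ ^ 2)⁻¹ • z - (‖w‖ ^ 2)⁻¹ • w)) := by
    have e (r : ℝ) : 1 / (2 * Real.pi * r) = 1 / (2 * Real.pi) * r⁻¹ := by
      rw [one_div, mul_inv, one_div]
    simp only [perp_smul, perp_sub, biotSavartKernel, smul_sub, smul_smul, e]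
  have h2 : ‖(‖z‖ ^ 2)⁻¹ • z - (‖w‖ ^ 2)⁻¹ • w‖ = ‖z - w‖ * ‖z‖⁻¹ * ‖w‖⁻¹ := by
    rw [← sq_eq_sq₀ (norm_nonneg _) (by positivity), mul_pow, mul_pow, norm_sub_sq_real,
      norm_sub_sq_real, norm_smul, norm_smul, inner_smul_left, inner_smul_right]
    simp only [norm_inv, norm_pow, norm_norm, conj_trivial]
    field_simp
    ring
  rw [h1, norm_perp, norm_smul, h2, Real.norm_of_nonneg (by positivity)]

/-- Hölder continuity of the kernel with any exponent `α ≤ 1`, at the price of the stronger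
singularity `‖z‖^(-(1+α))`, which is still integrable if `α < 1`. -/
lemma norm_biotSavartKernel_sub_le {α : ℝ} (h0 : 0 ≤ α) (h1 : α ≤ 1) {z w : Plane}
    (hz : z ≠ 0) (hw : w ≠ 0) :
    ‖biotSavartKernel z - biotSavartKernel w‖ ≤
      ‖z - w‖ ^ α * (‖z‖ ^ (-(1 + α)) + ‖w‖ ^ (-(1 + α))) := by
  have hz' : 0 < ‖z‖ := norm_pos_iff.2 hz
  have hw' : 0 < ‖w‖ := norm_pos_iff.2 hw
  rw [norm_biotSavartKernel_sub hz hw]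
  set d := ‖z - w‖ with hd
  have hd0 : 0 ≤ d := norm_nonneg _
  set P := max ‖z‖⁻¹ ‖w‖⁻¹ with hP
  have hP0 : 0 < P := lt_max_of_lt_left (by positivity)
  set X := d * ‖z‖⁻¹ * ‖w‖⁻¹ with hX
  have hX0 : 0 ≤ X := by positivity
  have hX1 : X ≤ d * P ^ 2 := by
    rw [hX, mul_assoc, sq]
    gcongr
    · exact le_max_left _ _
    · exact le_max_right _ _
  have hX2 : X ≤ 2 * P := by
    have h : d ≤ ‖z‖ + ‖w‖ := norm_sub_le _ _
    have e1 : X ≤ (‖z‖ + ‖w‖) * ‖z‖⁻¹ * ‖w‖⁻¹ := by rw [hX]; gcongr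
    have e2 : (‖z‖ + ‖w‖) * ‖z‖⁻¹ * ‖w‖⁻¹ = ‖w‖⁻¹ + ‖z‖⁻¹ := by field_simp
    linarith [le_max_left ‖z‖⁻¹ ‖w‖⁻¹, le_max_right ‖z‖⁻¹ ‖w‖⁻¹]
  have hXα : X ≤ 2 * (d ^ α * P ^ (1 + α)) := by
    calc X = X ^ α * X ^ (1 - α) := by
            rw [← Real.rpow_add' hX0 (by simp)]; simp
      _ ≤ (d * P ^ 2) ^ α * (2 * P) ^ (1 - α) := by
          gcongr
      _ = 2 ^ (1 - α) * (d ^ α * P ^ (1 + α)) := by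
          rw [Real.mul_rpow hd0 (by positivity), Real.mul_rpow (by norm_num) hP0.le,
            ← Real.rpow_natCast P 2, ← Real.rpow_mul hP0.le,
            show (1 + α) = ((2 : ℕ) : ℝ) * α + (1 - α) by push_cast; ring, Real.rpow_add hP0]
          ring
      _ ≤ 2 * (d ^ α * P ^ (1 + α)) := by
          gcongr
          exact (Real.rpow_le_rpow_of_exponent_le (by norm_num) (by linarith)).trans
            (Real.rpow_one 2).le
  have hPs : P ^ (1 + α) ≤ ‖z‖ ^ (-(1 + α)) + ‖w‖ ^ (-(1 + α)) := by
    rw [Real.rpow_neg hz'.le, Real.rpow_neg hw'.le, ← Real.inv_rpow hz'.le, ← Real.inv_rpow hw'.le]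
    rcases max_choice ‖z‖⁻¹ ‖w‖⁻¹ with h | h <;> rw [hP, h]
    · exact le_add_of_nonneg_right (by positivity)
    · exact le_add_of_nonneg_left (by positivity)
  have hpi : 1 / (2 * Real.pi) * 2 ≤ 1 := by
    rw [div_mul_eq_mul_div, div_le_one (by positivity)]
    linarith [Real.pi_gt_three]
  calc 1 / (2 * Real.pi) * X ≤ 1 / (2 * Real.pi) * (2 * (d ^ α * P ^ (1 + α))) := by gcongr
    _ = (1 / (2 * Real.pi) * 2) * (d ^ α * P ^ (1 + α)) := by ring
    _ ≤ 1 * (d ^ α * P ^ (1 + α)) := by gcongr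
    _ ≤ _ := by rw [one_mul]; gcongr

section PatchVelocity

variable {A : Set Plane}

lemma integrableOn_biotSavartKernel (hA : MeasurableSet A) (hAf : volume A ≠ ⊤) (x : Plane) :
    IntegrableOn (fun y => biotSavartKernel (x - y)) A := by
  have h1 : Integrable (A.indicator fun _ => (1 : ℝ)) :=
    (integrable_indicator_iff hA).2 (integrableOn_const hAf)
  have h2 := integrable_smul_biotSavartKernel (M := 1) h1 (ae_of_all _ fun y => by
    by_cases h : y ∈ A <;> simp [h]) x
  refine (integrable_indicator_iff hA).1 (h2.congr (ae_of_all _ fun y => ?_))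
  by_cases h : y ∈ A <;> simp [h]

lemma integrableOn_singularity_comp (hA : MeasurableSet A) (hAf : volume A ≠ ⊤) {s : ℝ}
    (hs0 : 0 ≤ s) (hs : s < 2) (x : Plane) : IntegrableOn (fun y => ‖x - y‖ ^ (-s)) A := by
  have h1 : Integrable (A.indicator fun _ => (1 : ℝ)) :=
    (integrable_indicator_iff hA).2 (integrableOn_const hAf)
  have h2 := integrable_mul_singularity (M := 1) hs0 hs h1 (ae_of_all _ fun y => by
    by_cases h : y ∈ A <;> simp [h]) x
  refine (integrable_indicator_iff hA).1 (h2.congr (ae_of_all _ fun y => ?_))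
  by_cases h : y ∈ A <;> simp [h]

variable {Φ Ψ : Plane ≃ₜ Plane}

lemma measurableSet_image_homeomorph (hA : MeasurableSet A) : MeasurableSet (Φ '' A) :=
  Φ.measurableEmbedding.measurableSet_image.2 hA

lemma volume_image_homeomorph (hΦ : MeasurePreserving Φ volume volume) :
    volume (Φ '' A) = volume A := by
  rw [← hΦ.measure_preimage_emb Φ.measurableEmbedding, preimage_image_eq _ Φ.injective]

/-- The Biot-Savart law in Lagrangian coordinates. -/
lemma biotSavart_of_flow (hA : MeasurableSet A) (hΦ : MeasurePreserving Φ volume volume)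
    {ω : Plane → ℝ} (hω : ω =ᵐ[volume] fun x => chi A (Φ.symm x)) (x : Plane) :
    biotSavart ω x = ∫ y in A, biotSavartKernel (x - Φ y) := by
  classical
  rw [← hΦ.setIntegral_image_emb Φ.measurableEmbedding (fun z => biotSavartKernel (x - z)),
    ← integral_indicator (measurableSet_image_homeomorph hA), biotSavart]
  refine integral_congr_ae ?_
  filter_upwards [hω] with y hy
  rw [hy, chi, indicator_apply, indicator_apply]
  have : Φ.symm y ∈ A ↔ y ∈ Φ '' A := by
    constructor
    · exact fun h => ⟨_, h, Φ.apply_symm_apply y⟩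
    · rintro ⟨z, hz, rfl⟩; simpa using hz
  by_cases h : y ∈ Φ '' A <;> simp [this, h]

lemma integrableOn_biotSavartKernel_flow (hA : MeasurableSet A) (hAf : volume A ≠ ⊤)
    (hΦ : MeasurePreserving Φ volume volume) (x : Plane) :
    IntegrableOn (fun y => biotSavartKernel (x - Φ y)) A :=
  (hΦ.integrableOn_image Φ.measurableEmbedding (f := fun z => biotSavartKernel (x - z))).1
    (integrableOn_biotSavartKernel (measurableSet_image_homeomorph hA)
      (by rwa [volume_image_homeomorph hΦ]) x)

lemma integrableOn_singularity_flow (hA : MeasurableSet A) (hAf : volume A ≠ ⊤) {s : ℝ}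
    (hs0 : 0 ≤ s) (hs : s < 2) (hΦ : MeasurePreserving Φ volume volume) (x : Plane) :
    IntegrableOn (fun y => ‖x - Φ y‖ ^ (-s)) A :=
  (hΦ.integrableOn_image Φ.measurableEmbedding (f := fun z => ‖x - z‖ ^ (-s))).1
    (integrableOn_singularity_comp (measurableSet_image_homeomorph hA)
      (by rwa [volume_image_homeomorph hΦ]) hs0 hs x)

lemma integral_singularity_flow_le (hAf : volume A ≠ ⊤) {s : ℝ}
    (hs0 : 0 ≤ s) (hs : s < 2) (hΦ : MeasurePreserving Φ volume volume) (x : Plane) :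
    ∫ y in A, ‖x - Φ y‖ ^ (-s) ≤ 2 * Real.pi / (2 - s) + volume.real A := by
  rw [← hΦ.setIntegral_image_emb Φ.measurableEmbedding (fun z => ‖x - z‖ ^ (-s))]
  refine (integral_singularity_le hs0 hs (by rwa [volume_image_homeomorph hΦ]) x).trans_eq ?_
  rw [Measure.real, volume_image_homeomorph hΦ, Measure.real]

lemma norm_velocity_le (hAf : volume A ≠ ⊤) (hΦ : MeasurePreserving Φ volume volume)
    (x : Plane) : ‖∫ y in A, biotSavartKernel (x - Φ y)‖ ≤ 2 * Real.pi + volume.real A := by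
  have h := integral_singularity_flow_le hAf zero_le_one one_lt_two hΦ x
  have h2 : ‖∫ y in A, biotSavartKernel (x - Φ y)‖ ≤
      1 / (2 * Real.pi) * ∫ y in A, ‖x - Φ y‖ ^ (-1 : ℝ) := by
    refine (norm_integral_le_integral_norm _).trans_eq ?_
    rw [← integral_const_mul]
    refine integral_congr_ae (ae_of_all _ fun y => ?_)
    simp only [norm_biotSavartKernel, Real.rpow_neg_one]
  have h3 : 1 / (2 * Real.pi) ≤ 1 := by
    rw [div_le_one (by positivity)]; linarith [Real.pi_gt_three]
  have h4 : 0 ≤ ∫ y in A, ‖x - Φ y‖ ^ (-1 : ℝ) := integral_nonneg fun y => by positivity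
  have : (2 * Real.pi) / (2 - 1) = 2 * Real.pi := by norm_num
  nlinarith

/-- The velocities of two patches, seen along their flows, differ by at most
`C p ‖Φ - Ψ‖_∞^(1 - 1/p)` for every `p ≥ 1`: the constant grows only linearly in `p`, which is the
quantitative form of the log-Lipschitz continuity of the velocity. -/
lemma norm_velocity_sub_le (hA : MeasurableSet A) (hAf : volume A ≠ ⊤)
    (hΦ : MeasurePreserving Φ volume volume) (hΨ : MeasurePreserving Ψ volume volume)
    {N : ℝ} (hN : ∀ x, ‖Φ x - Ψ x‖ ≤ N) {p : ℕ} (hp : 1 ≤ p) (x : Plane) :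
    ‖(∫ y in A, biotSavartKernel (Φ x - Φ y)) - ∫ y in A, biotSavartKernel (Ψ x - Ψ y)‖ ≤
      p * (8 * Real.pi + 4 * volume.real A) * N ^ (1 - 1 / (p : ℝ)) := by
  have hp' : (1 : ℝ) ≤ p := by exact_mod_cast hp
  set α : ℝ := 1 - 1 / (p : ℝ) with hα
  have hα0 : 0 ≤ α := by
    rw [hα, sub_nonneg, div_le_one (by linarith)]; exact hp'
  have hα1 : α < 1 := by
    have : 0 < 1 / (p : ℝ) := by positivity
    linarith
  have hN0 : 0 ≤ N := (norm_nonneg _).trans (hN x)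
  rw [← integral_sub (integrableOn_biotSavartKernel_flow hA hAf hΦ _)
    (integrableOn_biotSavartKernel_flow hA hAf hΨ _)]
  have i1 := integrableOn_singularity_flow hA hAf (s := 1 + α) (by linarith) (by linarith) hΦ (Φ x)
  have i2 := integrableOn_singularity_flow hA hAf (s := 1 + α) (by linarith) (by linarith) hΨ (Ψ x)
  have j1 := integral_singularity_flow_le hAf (s := 1 + α) (by linarith) (by linarith) hΦ (Φ x)
  have j2 := integral_singularity_flow_le hAf (s := 1 + α) (by linarith) (by linarith) hΨ (Ψ x)
  have hne : ∀ᵐ y : Plane, y ≠ x := by simp [ae_iff]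
  have e : 2 * Real.pi / (2 - (1 + α)) = 2 * Real.pi * p := by
    rw [hα]; field_simp; ring
  rw [e] at j1 j2
  have h2N : (2 * N) ^ α ≤ 2 * N ^ α := by
    rw [Real.mul_rpow (by norm_num) hN0]
    gcongr
    exact (Real.rpow_le_rpow_of_exponent_le (by norm_num) hα1.le).trans (Real.rpow_one 2).le
  have hv : 0 ≤ volume.real A := measureReal_nonneg
  calc _ ≤ ∫ y in A, (2 * N) ^ α * (‖Φ x - Φ y‖ ^ (-(1 + α)) + ‖Ψ x - Ψ y‖ ^ (-(1 + α))) := by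
        refine norm_integral_le_of_norm_le ((i1.add i2).const_mul _) ?_
        filter_upwards [ae_restrict_of_ae hne] with y hy
        refine (norm_biotSavartKernel_sub_le hα0 hα1.le (sub_ne_zero.2 (Φ.injective.ne hy.symm))
          (sub_ne_zero.2 (Ψ.injective.ne hy.symm))).trans ?_
        gcongr
        have : Φ x - Φ y - (Ψ x - Ψ y) = (Φ x - Ψ x) - (Φ y - Ψ y) := by abel
        rw [this]
        exact (norm_sub_le _ _).trans (by linarith [hN x, hN y])
    _ = (2 * N) ^ α * ((∫ y in A, ‖Φ x - Φ y‖ ^ (-(1 + α))) +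
          ∫ y in A, ‖Ψ x - Ψ y‖ ^ (-(1 + α))) := by
        rw [integral_const_mul, integral_add i1 i2]
    _ ≤ (2 * N ^ α) * ((2 * Real.pi * p + volume.real A) + (2 * Real.pi * p + volume.real A)) := by
        gcongr
    _ = (p * (8 * Real.pi) + 4 * volume.real A) * N ^ α := by ring
    _ ≤ _ := by
        gcongr
        nlinarith

end PatchVelocity

/-- Yudovich's uniqueness argument for the differential inequality `N' ≤ C p N^(1 - 1/p)` for all
`p ≥ 1`, where `N` is the supremum of the norms of a family of curves `f i` starting at `0`. It
implies `(N^(1/p))' ≤ C`, so that `N ≤ (C t)^p`, which tends to `0` for small `t`. -/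
lemma eq_zero_of_deriv_le_rpow {ι : Type*} {N : ℝ → ℝ} {f f' : ι → ℝ → Plane} {C : ℝ} (hC : 0 < C)
    (hN : Continuous N) (hNf : ∀ t, 0 ≤ t → ∀ i, ‖f i t‖ ≤ N t)
    (hNs : ∀ t, 0 ≤ t → ∀ b, (∀ i, ‖f i t‖ ≤ b) → N t ≤ b) (hN0 : ∀ t, 0 ≤ N t) (h0 : N 0 = 0)
    (hd : ∀ i t, 0 ≤ t → HasDerivWithinAt (f i) (f' i t) (Ici 0) t)
    (hf' : ∀ p : ℕ, 1 ≤ p → ∀ i t, 0 ≤ t → ‖f' i t‖ ≤ p * C * N t ^ (1 - 1 / (p : ℝ))) :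
    ∀ t, 0 ≤ t → N t = 0 := by
  have step (t₀ : ℝ) (ht₀ : 0 ≤ t₀) (hNt₀ : N t₀ = 0) (t : ℝ) (h1 : t₀ ≤ t)
      (h2 : t ≤ t₀ + 1 / (2 * C)) : N t = 0 := by
    have key (p : ℕ) (hp : 1 ≤ p) : N t ≤ (3 / 4 : ℝ) ^ p := by
      have hp' : (1 : ℝ) ≤ p := by exact_mod_cast hp
      have hp0 : (p : ℝ) ≠ 0 := by positivity
      have hα0 : 0 ≤ 1 - 1 / (p : ℝ) := by
        rw [sub_nonneg, div_le_one (by linarith)]; exact hp'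
      set g : ℝ → ℝ := fun s => p * C * N s ^ (1 - 1 / (p : ℝ)) with hg
      have hgc : Continuous g := continuous_const.mul (hN.rpow_const fun s => Or.inr hα0)
      have hg0 (s : ℝ) : 0 ≤ g s := by have := hN0 s; positivity
      -- a positive initial value makes `y^(1/p)` differentiable
      set y : ℝ → ℝ := fun s => (1 / 4 : ℝ) ^ p + ∫ r in t₀..s, g r with hy
      have hyd (s : ℝ) : HasDerivAt y (g s) s :=
        (hgc.integral_hasStrictDerivAt t₀ s).hasDerivAt.const_add _
      have hypos (s : ℝ) (hs : t₀ ≤ s) : 0 < y s :=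
        add_pos_of_pos_of_nonneg (by positivity)
          (intervalIntegral.integral_nonneg hs fun r _ => hg0 r)
      have hNy (s : ℝ) (hs : t₀ ≤ s) : N s ≤ y s := by
        refine hNs s (ht₀.trans hs) _ fun i => ?_
        refine image_norm_le_of_norm_deriv_right_le_deriv_boundary (f := f i) (f' := f' i)
          (a := t₀) (b := s) (fun r hr => ?_) (fun r hr => ?_) ?_ hyd (fun r hr => ?_)
          (right_mem_Icc.2 hs)
        · exact ((hd i r (ht₀.trans hr.1)).mono (fun q hq => ht₀.trans hq.1)).continuousWithinAt
        · exact (hd i r (ht₀.trans hr.1)).mono (Ici_subset_Ici.2 (ht₀.trans hr.1))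
        · refine (hNf t₀ ht₀ i).trans ?_
          rw [hNt₀]
          exact (hypos t₀ le_rfl).le
        · exact hf' p hp i r (ht₀.trans hr.1)
      have hz : y t ^ (1 / (p : ℝ)) ≤ 1 / 4 + C * (t - t₀) := by
        have hB (s : ℝ) : HasDerivAt (fun s => 1 / 4 + C * (s - t₀)) C s := by
          simpa using (((hasDerivAt_id s).sub_const t₀).const_mul C).const_add (1 / 4)
        refine image_le_of_deriv_right_le_deriv_boundary (a := t₀) (b := t)
          (f := fun s => y s ^ (1 / (p : ℝ)))
          (f' := fun s => g s * (1 / (p : ℝ)) * y s ^ (1 / (p : ℝ) - 1)) (fun r hr => ?_)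
          (fun r hr => ?_) ?_
          (fun r _ => (hB r).continuousAt.continuousWithinAt)
          (fun r _ => (hB r).hasDerivWithinAt) (fun r hr => ?_) (right_mem_Icc.2 h1)
        · exact ((hyd r).rpow_const (Or.inl (hypos r hr.1).ne')).continuousAt.continuousWithinAt
        · exact ((hyd r).rpow_const (Or.inl (hypos r hr.1).ne')).hasDerivWithinAt
        · simp only [hy, intervalIntegral.integral_same, add_zero, sub_self, mul_zero]
          rw [← Real.rpow_natCast, ← Real.rpow_mul (by norm_num), mul_one_div_cancel hp0,
            Real.rpow_one]
        · have h3 : g r ≤ p * C * y r ^ (1 - 1 / (p : ℝ)) := by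
            simp only [hg]
            have := hNy r hr.1
            have := hN0 r
            gcongr
          have hyr := hypos r hr.1
          calc g r * (1 / (p : ℝ)) * y r ^ (1 / (p : ℝ) - 1)
              ≤ p * C * y r ^ (1 - 1 / (p : ℝ)) * (1 / (p : ℝ)) * y r ^ (1 / (p : ℝ) - 1) := by
                gcongr
            _ = C * (y r ^ (1 - 1 / (p : ℝ)) * y r ^ (1 / (p : ℝ) - 1)) := by field_simp
            _ = C := by
                rw [← Real.rpow_add hyr]
                simp
      have hz2 : y t ^ (1 / (p : ℝ)) ≤ 3 / 4 := by
        have : C * (t - t₀) ≤ 1 / 2 := by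
          have h4 : t - t₀ ≤ 1 / (2 * C) := by linarith
          calc C * (t - t₀) ≤ C * (1 / (2 * C)) := by gcongr
            _ = 1 / 2 := by field_simp
        linarith
      calc N t ≤ y t := hNy t h1
        _ = (y t ^ (1 / (p : ℝ))) ^ p := by
            rw [← Real.rpow_natCast, ← Real.rpow_mul (hypos t h1).le, one_div_mul_cancel hp0,
              Real.rpow_one]
        _ ≤ (3 / 4 : ℝ) ^ p := by
            have := hypos t h1
            gcongr
    refine le_antisymm ?_ (hN0 t)
    refine ge_of_tendsto (tendsto_pow_atTop_nhds_zero_of_lt_one (r := (3 / 4 : ℝ)) (by norm_num)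
      (by norm_num)) ?_
    filter_upwards [eventually_ge_atTop 1] with p hp using key p hp
  have hk (k : ℕ) : ∀ t, 0 ≤ t → t ≤ k * (1 / (2 * C)) → N t = 0 := by
    induction k with
    | zero =>
      intro t h1 h2
      have : t = 0 := le_antisymm (by simpa using h2) h1
      rw [this, h0]
    | succ k ih =>
      intro t h1 h2
      have hk0 : 0 ≤ k * (1 / (2 * C)) := by positivity
      rcases le_total t (k * (1 / (2 * C))) with h | h
      · exact ih t h1 h
      · refine step _ hk0 (ih _ hk0 le_rfl) t h ?_
        push_cast at h2
        linarith
  intro t ht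
  obtain ⟨k, hk'⟩ := exists_nat_ge (t / (1 / (2 * C)))
  exact hk k t ht ((div_le_iff₀ (by positivity)).1 hk')

/-- Two Yudovich solutions which start from the same vortex patch of finite area have the same
flow, hence agree. -/
theorem yudovich_unique {A : Set Plane} (hA : MeasurableSet A) (hAf : volume A ≠ ⊤)
    {ω ω' : ℝ → Plane → ℝ} (h : IsYudovichSolution (chi A) ω)
    (h' : IsYudovichSolution (chi A) ω') (t : ℝ) (ht : 0 ≤ t) : ω' t =ᵐ[volume] ω t := by
  obtain ⟨-, Φ, hΦ0, hΦd, hΦm, hΦω⟩ := h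
  obtain ⟨-, Ψ, hΨ0, hΨd, hΨm, hΨω⟩ := h'
  set U := 2 * Real.pi + volume.real A with hU
  have hv : 0 ≤ volume.real A := measureReal_nonneg
  have hU0 : 0 ≤ U := by positivity
  have hΦd' (t : ℝ) (ht : 0 ≤ t) (x : Plane) : HasDerivWithinAt (fun s => Φ s x)
      (∫ y in A, biotSavartKernel (Φ t x - Φ t y)) (Ici 0) t := by
    rw [← biotSavart_of_flow hA (hΦm t ht) (hΦω t ht)]; exact hΦd t ht x
  have hΨd' (t : ℝ) (ht : 0 ≤ t) (x : Plane) : HasDerivWithinAt (fun s => Ψ s x)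
      (∫ y in A, biotSavartKernel (Ψ t x - Ψ t y)) (Ici 0) t := by
    rw [← biotSavart_of_flow hA (hΨm t ht) (hΨω t ht)]; exact hΨd t ht x
  set f : Plane → ℝ → Plane := fun x t => Φ t x - Ψ t x with hf
  set f' : Plane → ℝ → Plane := fun x t => (∫ y in A, biotSavartKernel (Φ t x - Φ t y)) -
    ∫ y in A, biotSavartKernel (Ψ t x - Ψ t y) with hf'
  have hfd (x : Plane) (t : ℝ) (ht : 0 ≤ t) : HasDerivWithinAt (f x) (f' x t) (Ici 0) t :=
    (hΦd' t ht x).sub (hΨd' t ht x)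
  have hfU (x : Plane) (t : ℝ) (ht : 0 ≤ t) : ‖f' x t‖ ≤ 2 * U := by
    refine (norm_sub_le _ _).trans ?_
    linarith [norm_velocity_le hAf (hΦm t ht) (Φ t x), norm_velocity_le hAf (hΨm t ht) (Ψ t x)]
  have hlip (x : Plane) {s t : ℝ} (hs : 0 ≤ s) (ht : 0 ≤ t) :
      ‖f x t - f x s‖ ≤ 2 * U * |t - s| :=
    (convex_Ici 0).norm_image_sub_le_of_norm_hasDerivWithin_le (fun r hr => hfd x r hr)
      (fun r hr => hfU x r hr) hs ht
  have hf0 (x : Plane) : f x 0 = 0 := by simp [hf, hΦ0, hΨ0]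
  have hbdd (t : ℝ) (ht : 0 ≤ t) : BddAbove (range fun x => ‖f x t‖) := by
    refine ⟨2 * U * |t|, ?_⟩
    rintro _ ⟨x, rfl⟩
    simpa [hf0] using hlip x le_rfl ht
  set N : ℝ → ℝ := fun t => ⨆ x, ‖f x (max t 0)‖ with hN
  have hNt {t : ℝ} (ht : 0 ≤ t) : N t = ⨆ x, ‖f x t‖ := by simp [hN, max_eq_left ht]
  have hNf (t : ℝ) (ht : 0 ≤ t) (x : Plane) : ‖f x t‖ ≤ N t := by
    rw [hNt ht]; exact le_ciSup (hbdd t ht) x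
  have hNs (t : ℝ) (ht : 0 ≤ t) (b : ℝ) (hb : ∀ x, ‖f x t‖ ≤ b) : N t ≤ b := by
    rw [hNt ht]; exact ciSup_le hb
  have hN0 (t : ℝ) : 0 ≤ N t := Real.iSup_nonneg fun x => norm_nonneg _
  have hNl : LipschitzWith (Real.toNNReal (2 * U)) N := by
    refine LipschitzWith.of_le_add_mul _ fun t s => ?_
    rw [Real.coe_toNNReal _ (by positivity)]
    refine ciSup_le fun x => ?_
    have h1 := hlip x (le_max_right s 0) (le_max_right t 0)
    have h2 : ‖f x (max s 0)‖ ≤ N s := le_ciSup (hbdd _ (le_max_right s 0)) x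
    have h3 : |max t 0 - max s 0| ≤ dist t s := abs_max_sub_max_le_abs t s 0
    have h4 := norm_sub_norm_le (f x (max t 0)) (f x (max s 0))
    have h5 : 2 * U * |max t 0 - max s 0| ≤ 2 * U * dist t s := by gcongr
    linarith
  have hzero := eq_zero_of_deriv_le_rpow (f := f) (f' := f') (N := N)
    (C := 8 * Real.pi + 4 * volume.real A) (by positivity) hNl.continuous hNf hNs hN0
    (by rw [hNt le_rfl]; simp [hf0]) hfd
    (fun p hp x t ht => norm_velocity_sub_le hA hAf (hΦm t ht) (hΨm t ht)
      (fun z => hNf t ht z) hp x)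
  have heq : Φ t = Ψ t := by
    ext1 x
    have := hNf t ht x
    rw [hzero t ht, norm_le_zero_iff] at this
    exact sub_eq_zero.1 this
  have e1 := hΦω t ht
  have e2 := hΨω t ht
  rw [← heq] at e2
  exact e2.trans e1.symm

/-! ### Flows of Lipschitz vector fields -/

lemma norm_intervalIntegral_le_exp {F : ℝ → Plane} {k M : ℝ} (hk : 0 < k) (hM : 0 ≤ M)
    (hF : ∀ s, ‖F s‖ ≤ M * Real.exp (2 * k * |s|)) (t : ℝ) :
    ‖∫ s in (0 : ℝ)..t, F s‖ ≤ M / (2 * k) * Real.exp (2 * k * |t|) := by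
  have pos {F : ℝ → Plane} (hF : ∀ s, ‖F s‖ ≤ M * Real.exp (2 * k * |s|)) {t : ℝ} (ht : 0 ≤ t) :
      ‖∫ s in (0 : ℝ)..t, F s‖ ≤ M / (2 * k) * Real.exp (2 * k * |t|) := by
    have h1 : ‖∫ s in (0 : ℝ)..t, F s‖ ≤ ∫ s in (0 : ℝ)..t, M * Real.exp (2 * k * s) := by
      refine intervalIntegral.norm_integral_le_of_norm_le ht (ae_of_all _ fun s hs => ?_)
        (Continuous.intervalIntegrable (by fun_prop) _ _)
      simpa [abs_of_pos hs.1] using hF s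
    have h2 : ∫ s in (0 : ℝ)..t, M * Real.exp (2 * k * s) =
        M / (2 * k) * Real.exp (2 * k * t) - M / (2 * k) := by
      have hd (s : ℝ) : HasDerivAt (fun s => M / (2 * k) * Real.exp (2 * k * s))
          (M * Real.exp (2 * k * s)) s := by
        have := (((hasDerivAt_id s).const_mul (2 * k)).exp).const_mul (M / (2 * k))
        refine this.congr_deriv ?_
        simp only [id, mul_one]
        field_simp
      rw [intervalIntegral.integral_eq_sub_of_hasDerivAt (fun s _ => hd s)
        (Continuous.intervalIntegrable (by fun_prop) _ _)]
      simp
    rw [abs_of_nonneg ht]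
    have : 0 ≤ M / (2 * k) := by positivity
    linarith
  rcases le_total 0 t with ht | ht
  · exact pos hF ht
  · have h := pos (F := fun s => F (-s)) (fun s => by simpa using hF (-s)) (neg_nonneg.2 ht)
    rw [intervalIntegral.integral_comp_neg, neg_neg, neg_zero, intervalIntegral.integral_symm,
      norm_neg, abs_neg] at h
    exact h

/-- Global existence for Lipschitz vector fields: in a norm with an exponential weight, the Picard
iteration is a contraction on the whole time axis. -/
lemma exists_global_solution {v : Plane → Plane} {K : ℝ≥0} (hv : LipschitzWith K v) (x : Plane) :
    ∃ γ : ℝ → Plane, γ 0 = x ∧ ∀ t, HasDerivAt γ (v (γ t)) t := by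
  set k : ℝ := K + 1 with hk
  have hk0 : 0 < k := by positivity
  set w : ℝ → ℝ := fun t => Real.exp (2 * k * |t|) with hw
  have hwc : Continuous w := by fun_prop
  have hw1 (t : ℝ) : 1 ≤ w t := Real.one_le_exp (by positivity)
  have hw0 (t : ℝ) : 0 < w t := Real.exp_pos _
  have hvc := hv.continuous
  have hvl (y z : Plane) : ‖v y - v z‖ ≤ k * ‖y - z‖ := by
    refine (hv.norm_sub_le y z).trans ?_
    gcongr
    simp [hk]
  set I : BoundedContinuousFunction ℝ Plane → ℝ → Plane :=
    fun g t => ∫ s in (0 : ℝ)..t, v (x + w s • g s) with hI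
  have hIc (g : BoundedContinuousFunction ℝ Plane) : Continuous fun s => v (x + w s • g s) := by
    have := g.continuous
    fun_prop
  have hId (g : BoundedContinuousFunction ℝ Plane) (t : ℝ) :
      HasDerivAt (I g) (v (x + w t • g t)) t :=
    ((hIc g).integral_hasStrictDerivAt 0 t).hasDerivAt
  set T : BoundedContinuousFunction ℝ Plane → BoundedContinuousFunction ℝ Plane := fun g =>
    BoundedContinuousFunction.ofNormedAddCommGroup (fun t => (w t)⁻¹ • I g t)
      ((hwc.inv₀ fun t => (hw0 t).ne').smul
        (continuous_iff_continuousAt.2 fun t => (hId g t).continuousAt))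
      ((‖v x‖ + k * ‖g‖) / (2 * k)) (fun t => by
        have h := norm_intervalIntegral_le_exp (F := fun s => v (x + w s • g s)) hk0
          (M := ‖v x‖ + k * ‖g‖) (by positivity) (fun s => ?_) t
        · rw [norm_smul, norm_inv, Real.norm_of_nonneg (hw0 t).le, inv_mul_le_iff₀ (hw0 t),
            mul_comm]
          exact h
        · have h1 := hvl (x + w s • g s) x
          rw [add_sub_cancel_left, norm_smul, Real.norm_of_nonneg (hw0 s).le] at h1
          have h2 := norm_sub_norm_le (v (x + w s • g s)) (v x)
          have h3 := g.norm_coe_le_norm s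
          have h4 := hw1 s
          have h5 : k * (w s * ‖g s‖) ≤ k * (w s * ‖g‖) := by gcongr
          have h6 : ‖v x‖ ≤ ‖v x‖ * w s := le_mul_of_one_le_right (norm_nonneg _) h4
          change _ ≤ (‖v x‖ + k * ‖g‖) * w s
          linarith) with hT
  have hTc : ContractingWith (1 / 2) T := by
    refine ⟨by rw [← NNReal.coe_lt_coe]; norm_num, LipschitzWith.of_dist_le_mul fun g₁ g₂ => ?_⟩
    refine (BoundedContinuousFunction.dist_le (by positivity)).2 fun t => ?_
    have e : T g₁ t - T g₂ t =
        (w t)⁻¹ • ∫ s in (0 : ℝ)..t, (v (x + w s • g₁ s) - v (x + w s • g₂ s)) := by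
      rw [intervalIntegral.integral_sub ((hIc g₁).intervalIntegrable _ _)
        ((hIc g₂).intervalIntegrable _ _), smul_sub]
      rfl
    rw [dist_eq_norm, e, norm_smul, norm_inv, Real.norm_of_nonneg (hw0 t).le,
      inv_mul_le_iff₀ (hw0 t)]
    refine (norm_intervalIntegral_le_exp hk0 (M := k * dist g₁ g₂) (by positivity)
      (fun s => ?_) t).trans_eq ?_
    · refine (hvl _ _).trans ?_
      rw [add_sub_add_left_eq_sub, ← smul_sub, norm_smul, Real.norm_of_nonneg (hw0 s).le,
        ← dist_eq_norm]
      have := BoundedContinuousFunction.dist_coe_le_dist (f := g₁) (g := g₂) s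
      have h5 : k * (w s * dist (g₁ s) (g₂ s)) ≤ k * (w s * dist g₁ g₂) := by
        have := (hw0 s).le
        gcongr
      change _ ≤ k * dist g₁ g₂ * w s
      linarith
    · push_cast
      change k * dist g₁ g₂ / (2 * k) * w t = _
      field_simp
  set g := hTc.fixedPoint T
  have hg : T g = g := hTc.fixedPoint_isFixedPt
  have hgt (t : ℝ) : w t • g t = I g t := by
    conv_lhs => rw [← hg]
    change w t • (w t)⁻¹ • I g t = _
    rw [smul_smul, mul_inv_cancel₀ (hw0 t).ne', one_smul]
  refine ⟨fun t => x + I g t, by simp [hI], fun t => ?_⟩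
  have := (hId g t).const_add x
  rwa [hgt] at this

lemma solution_unique {v : Plane → Plane} {K : ℝ≥0} (hv : LipschitzWith K v) {γ δ : ℝ → Plane}
    (hγ : ∀ t, HasDerivAt γ (v (γ t)) t) (hδ : ∀ t, HasDerivAt δ (v (δ t)) t)
    (h0 : γ 0 = δ 0) : γ = δ :=
  ODE_solution_unique_univ (v := fun _ => v) (s := fun _ => univ) (K := K) (t₀ := 0)
    (fun _ => hv.lipschitzOnWith) (fun t => ⟨hγ t, mem_univ _⟩) (fun t => ⟨hδ t, mem_univ _⟩) h0

lemma dist_solution_le {v : Plane → Plane} {K : ℝ≥0} (hv : LipschitzWith K v) {γ δ : ℝ → Plane}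
    (hγ : ∀ t, HasDerivAt γ (v (γ t)) t) (hδ : ∀ t, HasDerivAt δ (v (δ t)) t) (t : ℝ) :
    dist (γ t) (δ t) ≤ Real.exp (K * |t|) * dist (γ 0) (δ 0) := by
  have pos {v : Plane → Plane} (hv : LipschitzWith K v) {γ δ : ℝ → Plane}
      (hγ : ∀ t, HasDerivAt γ (v (γ t)) t) (hδ : ∀ t, HasDerivAt δ (v (δ t)) t) {t : ℝ}
      (ht : 0 ≤ t) : dist (γ t) (δ t) ≤ Real.exp (K * |t|) * dist (γ 0) (δ 0) := by
    have := dist_le_of_trajectories_ODE (v := fun _ => v) (a := 0) (b := t) (fun _ => hv)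
      (fun s _ => (hγ s).continuousAt.continuousWithinAt) (fun s _ => (hγ s).hasDerivWithinAt)
      (fun s _ => (hδ s).continuousAt.continuousWithinAt) (fun s _ => (hδ s).hasDerivWithinAt)
      le_rfl t (right_mem_Icc.2 ht)
    rwa [sub_zero, mul_comm, show (K : ℝ) * t = K * |t| by rw [abs_of_nonneg ht]] at this
  rcases le_total 0 t with ht | ht
  · exact pos hv hγ hδ ht
  · have hneg {γ : ℝ → Plane} (hγ : ∀ t, HasDerivAt γ (v (γ t)) t) (t : ℝ) :
        HasDerivAt (fun s => γ (-s)) (-v (γ (-t))) t :=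
      ((hγ (-t)).scomp t (hasDerivAt_neg t)).congr_deriv (by simp)
    simpa using pos (v := fun x => -v x) hv.neg (hneg hγ) (hneg hδ) (neg_nonneg.2 ht)

/-- `Ψ` is the flow of the autonomous vector field `v`, on the whole time axis. -/
structure IsFlow (v : Plane → Plane) (Ψ : ℝ → Plane ≃ₜ Plane) : Prop where
  zero : ∀ x, Ψ 0 x = x
  deriv : ∀ t x, HasDerivAt (fun s => Ψ s x) (v (Ψ t x)) t

theorem exists_isFlow {v : Plane → Plane} {K : ℝ≥0} (hv : LipschitzWith K v) :
    ∃ Ψ, IsFlow v Ψ := by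
  choose γ h0 hd using exists_global_solution hv
  have hgrp (s t : ℝ) (x : Plane) : γ (γ x s) t = γ x (s + t) := by
    have h : γ (γ x s) = fun t => γ x (s + t) := by
      refine solution_unique hv (hd _) (fun t => ?_) (by simp [h0])
      exact (hd x (s + t)).comp_const_add s t
    rw [h]
  have hc (t : ℝ) : Continuous fun x => γ x t := by
    refine (LipschitzWith.of_dist_le_mul (K := Real.toNNReal (Real.exp (K * |t|)))
      fun x y => ?_).continuous
    rw [Real.coe_toNNReal _ (Real.exp_pos _).le]
    simpa [h0] using dist_solution_le hv (hd x) (hd y) t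
  exact ⟨fun t =>
    { toFun := fun x => γ x t
      invFun := fun x => γ x (-t)
      left_inv := fun x => by simp only [hgrp, add_neg_cancel, h0]
      right_inv := fun x => by simp only [hgrp, neg_add_cancel, h0]
      continuous_toFun := hc t
      continuous_invFun := hc (-t) }, h0, fun t x => hd x t⟩

namespace IsFlow

variable {v : Plane → Plane} {Ψ : ℝ → Plane ≃ₜ Plane} {K : ℝ≥0}

lemma eq_of_solution (h : IsFlow v Ψ) (hv : LipschitzWith K v) {γ : ℝ → Plane}
    (hγ : ∀ t, HasDerivAt γ (v (γ t)) t) (t : ℝ) : Ψ t (γ 0) = γ t :=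
  congrFun (solution_unique hv (fun t => h.deriv t (γ 0)) hγ (h.zero _)) t

lemma add_apply (h : IsFlow v Ψ) (hv : LipschitzWith K v) (s t : ℝ) (x : Plane) :
    Ψ (s + t) x = Ψ t (Ψ s x) := by
  have := h.eq_of_solution hv (γ := fun t => Ψ (s + t) x)
    (fun t => (h.deriv (s + t) x).comp_const_add s t) t
  simpa using this.symm

lemma neg_apply_apply (h : IsFlow v Ψ) (hv : LipschitzWith K v) (t : ℝ) (x : Plane) :
    Ψ (-t) (Ψ t x) = x := by
  rw [← h.add_apply hv, add_neg_cancel, h.zero]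

lemma dist_le (h : IsFlow v Ψ) (hv : LipschitzWith K v) (t : ℝ) (x y : Plane) :
    dist (Ψ t x) (Ψ t y) ≤ Real.exp (K * |t|) * dist x y := by
  simpa [h.zero] using dist_solution_le hv (fun t => h.deriv t x) (fun t => h.deriv t y) t

lemma lipschitzWith (h : IsFlow v Ψ) (hv : LipschitzWith K v) (t : ℝ) :
    LipschitzWith (Real.toNNReal (Real.exp (K * |t|))) (Ψ t) :=
  LipschitzWith.of_dist_le_mul fun x y => by
    rw [Real.coe_toNNReal _ (Real.exp_pos _).le]; exact h.dist_le hv t x y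

/-- The derivative of `h ↦ ∫ g ∘ Ψ_h` at `h = 0` is `∫ ∇g · v = 0`. -/
lemma hasDerivAt_integral_comp (h : IsFlow v Ψ) (hv : LipschitzWith K v)
    (hdiv : ∀ᵐ x, divergence v x = 0) {g : Plane → ℝ} {C : ℝ≥0} (hg : LipschitzWith C g)
    (hgs : HasCompactSupport g) : HasDerivAt (fun s => ∫ x, g (Ψ s x)) 0 0 := by
  obtain ⟨R, hR⟩ := (IsCompact.isBounded hgs).subset_closedBall (0 : Plane)
  obtain ⟨M, hM⟩ := (isCompact_Icc (a := (-1 : ℝ)) (b := 1)).exists_bound_of_continuousOn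
    (f := fun s => Ψ s 0) fun s _ => (h.deriv s 0).continuousAt.continuousWithinAt
  have hM0 : 0 ≤ M := (norm_nonneg _).trans (hM 0 (by norm_num))
  set E := Real.exp K with hE
  have hE0 : 0 < E := Real.exp_pos _
  have hexp {s : ℝ} (hs : s ∈ Icc (-1 : ℝ) 1) : Real.exp (K * |s|) ≤ E := by
    refine Real.exp_le_exp.2 (mul_le_of_le_one_right K.2 (abs_le.2 hs))
  have hbd {s : ℝ} (hs : s ∈ Icc (-1 : ℝ) 1) (x : Plane) : ‖Ψ s x‖ ≤ E * ‖x‖ + M := by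
    have h1 := h.dist_le hv s x 0
    have h2 := hM s hs
    rw [dist_eq_norm, dist_zero_right] at h1
    have h3 := norm_sub_norm_le (Ψ s x) (Ψ s 0)
    have h4 : Real.exp (K * |s|) * ‖x‖ ≤ E * ‖x‖ := by gcongr; exact hexp hs
    linarith
  -- the curves which start outside of the ball of radius `R₁` do not meet the support of `g`
  set R₁ := E * R + M with hR₁
  have hout {s : ℝ} (hs : s ∈ Icc (-1 : ℝ) 1) (x : Plane) (hx : x ∉ Metric.closedBall 0 R₁) :
      g (Ψ s x) = 0 := by
    by_contra hne
    have h1 : Ψ s x ∈ Metric.closedBall 0 R := hR (subset_tsupport _ hne)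
    rw [mem_closedBall_zero_iff] at h1
    have h2 := hbd (s := -s) ⟨by linarith [hs.2], by linarith [hs.1]⟩ (Ψ s x)
    rw [h.neg_apply_apply hv] at h2
    apply hx
    rw [mem_closedBall_zero_iff]
    have : E * ‖Ψ s x‖ ≤ E * R := by gcongr
    linarith
  set B := ‖v 0‖ + K * (E * R₁ + M) with hB
  have hspeed {s : ℝ} (hs : s ∈ Icc (-1 : ℝ) 1) (x : Plane) (hx : x ∈ Metric.closedBall 0 R₁) :
      ‖v (Ψ s x)‖ ≤ B := by
    rw [mem_closedBall_zero_iff] at hx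
    have h1 := hv.norm_sub_le (Ψ s x) 0
    rw [sub_zero] at h1
    have h2 := norm_sub_norm_le (v (Ψ s x)) (v 0)
    have h3 : (K : ℝ) * ‖Ψ s x‖ ≤ K * (E * R₁ + M) := by
      gcongr
      exact (hbd hs x).trans (by gcongr)
    linarith
  have hsub : Metric.ball (0 : ℝ) 1 ⊆ Icc (-1) 1 := by
    rw [Real.ball_eq_Ioo]; norm_num; exact Ioo_subset_Icc_self
  have key := hasDerivAt_integral_of_dominated_loc_of_lip (μ := (volume : Measure Plane))
    (F := fun s x => g (Ψ s x)) (F' := fun x => fderiv ℝ g x (v x)) (x₀ := (0 : ℝ))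
    (s := Metric.ball (0 : ℝ) 1)
    (bound := (Metric.closedBall (0 : Plane) R₁).indicator fun _ => C * B)
    (Metric.ball_mem_nhds _ one_pos)
    (Eventually.of_forall fun s =>
      (hg.continuous.comp (Ψ s).continuous).aestronglyMeasurable)
    ((hg.continuous.comp (Ψ 0).continuous).integrable_of_hasCompactSupport
      (hgs.comp_homeomorph (Ψ 0)))
    (by
      have : (fun x => fderiv ℝ g x (v x)) =
          fun x => v x 0 * fderiv ℝ g x e₀ + v x 1 * fderiv ℝ g x e₁ := by
        ext1 x; exact fderiv_eq_coord g x (v x)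
      rw [this]
      have hc (i : Fin 2) : Continuous fun x => v x i :=
        (lipschitzWith_coord i).continuous.comp hv.continuous
      have m (i : Fin 2) : Measurable fun x => v x i := (hc i).measurable
      exact (((m 0).mul (measurable_fderiv_apply_const ℝ g e₀)).add
        ((m 1).mul (measurable_fderiv_apply_const ℝ g e₁))).aestronglyMeasurable)
    (ae_of_all _ fun x => by
      by_cases hx : x ∈ Metric.closedBall 0 R₁
      · have hB0 : 0 ≤ B := (norm_nonneg _).trans (hspeed (s := 0) (by norm_num) x hx)
        have h1 : LipschitzOnWith (Real.toNNReal B) (fun s => Ψ s x) (Metric.ball 0 1) :=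
          (convex_ball 0 1).lipschitzOnWith_of_nnnorm_hasDerivWithin_le
            (fun s _ => (h.deriv s x).hasDerivWithinAt) (fun s hs => by
              rw [← NNReal.coe_le_coe, Real.coe_toNNReal _ hB0]
              exact hspeed (hsub hs) x hx)
        have h2 := hg.comp_lipschitzOnWith h1
        refine h2.weaken (le_of_eq ?_)
        rw [indicator_of_mem hx]
        ext
        simp [Real.coe_toNNReal _ hB0, abs_of_nonneg hB0]
      · refine LipschitzOnWith.of_dist_le_mul fun s hs t ht => ?_
        simp only [hout (hsub hs) x hx, hout (hsub ht) x hx, dist_self]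
        positivity)
    ((integrable_indicator_iff measurableSet_closedBall).2
      (integrableOn_const (isCompact_closedBall _ _).measure_lt_top.ne))
    (by
      filter_upwards [hg.ae_differentiableAt (μ := volume)] with x hx
      have h1 := h.deriv 0 x
      have h2 : HasFDerivAt g (fderiv ℝ g x) (Ψ 0 x) := by
        rw [h.zero]; exact hx.hasFDerivAt
      rw [h.zero] at h1
      exact h2.comp_hasDerivAt 0 h1)
  have hz : ∫ x, fderiv ℝ g x (v x) = 0 := by
    rw [integral_fderiv_apply_of_lipschitz hv hg hgs, neg_eq_zero]
    refine integral_eq_zero_of_ae ?_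
    filter_upwards [hdiv] with x hx
    simp [hx]
  rw [hz] at key
  exact key.2

lemma integral_comp (h : IsFlow v Ψ) (hv : LipschitzWith K v)
    (hdiv : ∀ᵐ x, divergence v x = 0) {g : Plane → ℝ} {C : ℝ≥0} (hg : LipschitzWith C g)
    (hgs : HasCompactSupport g) (t : ℝ) : ∫ x, g (Ψ t x) = ∫ x, g x := by
  have hd (t : ℝ) : HasDerivAt (fun s => ∫ x, g (Ψ s x)) 0 t := by
    have h1 := h.hasDerivAt_integral_comp hv hdiv (hg.comp (h.lipschitzWith hv t))
      (hgs.comp_homeomorph (Ψ t))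
    have h2 : HasDerivAt (fun s => ∫ x, (g ∘ Ψ t) (Ψ s x)) 0 (t - t) := by rwa [sub_self]
    have h3 := h2.comp_sub_const t t
    refine h3.congr_of_eventuallyEq (Eventually.of_forall fun s => ?_)
    simp only [Function.comp, ← h.add_apply hv, sub_add_cancel]
  have := is_const_of_deriv_eq_zero (fun t => (hd t).differentiableAt) (fun t => (hd t).deriv) t 0
  simpa [h.zero] using this

/-- The flow of a Lipschitz vector field without divergence preserves the area. -/
theorem measurePreserving (h : IsFlow v Ψ) (hv : LipschitzWith K v)
    (hdiv : ∀ᵐ x, divergence v x = 0) (t : ℝ) : MeasurePreserving (Ψ t) volume volume := by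
  refine ⟨(Ψ t).continuous.measurable, ?_⟩
  have : (Measure.map (Ψ t) (volume : Measure Plane)).Regular := Measure.Regular.map (Ψ t)
  refine Measure.OuterRegular.ext_isOpen_isBounded fun U hU hUb => ?_
  have hUc : (Uᶜ : Set Plane).Nonempty := by
    rw [nonempty_compl]
    rintro rfl
    exact NormedSpace.unbounded_univ ℝ Plane hUb
  -- Lipschitz functions which increase to the indicator of `U`
  set g : ℕ → Plane → ℝ := fun n x => min 1 (n * Metric.infDist x Uᶜ) with hg
  have hg0 (n : ℕ) (x : Plane) (hx : x ∉ U) : g n x = 0 := by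
    simp [hg, Metric.infDist_zero_of_mem (mem_compl hx)]
  have hgn (n : ℕ) (x : Plane) : 0 ≤ g n x :=
    le_min zero_le_one (mul_nonneg n.cast_nonneg Metric.infDist_nonneg)
  have hgl (n : ℕ) : LipschitzWith (max 0 (n * 1)) (g n) := by
    refine (LipschitzWith.const (1 : ℝ)).min ?_
    refine LipschitzWith.of_dist_le_mul fun x y => ?_
    have := (Metric.lipschitz_infDist_pt Uᶜ).dist_le_mul x y
    rw [Real.dist_eq] at this ⊢
    rw [← mul_sub, abs_mul, Nat.abs_cast]
    push_cast at this ⊢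
    rw [mul_assoc]
    gcongr
  have hgs (n : ℕ) : HasCompactSupport (g n) :=
    HasCompactSupport.of_support_subset_isCompact hUb.isCompact_closure fun x hx => by
      by_contra hn
      exact hx (hg0 n x fun hxU => hn (subset_closure hxU))
  have hlim (x : Plane) : Tendsto (fun n => g n x) atTop (𝓝 (U.indicator (fun _ => 1) x)) := by
    by_cases hx : x ∈ U
    · have hp : 0 < Metric.infDist x Uᶜ :=
        (hU.isClosed_compl.notMem_iff_infDist_pos hUc).1 (not_not.2 hx)
      rw [indicator_of_mem hx]
      refine tendsto_const_nhds.congr' ?_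
      filter_upwards [(tendsto_natCast_atTop_atTop (R := ℝ)).eventually_ge_atTop
        (1 / Metric.infDist x Uᶜ)] with n hn
      exact (min_eq_left ((div_le_iff₀ hp).1 hn)).symm
    · simp [hg0 _ x hx, indicator_of_notMem hx]
  have hle (n : ℕ) (x : Plane) : ‖g n x‖ ≤ U.indicator (fun _ => (1 : ℝ)) x := by
    rw [Real.norm_of_nonneg (hgn n x)]
    by_cases hx : x ∈ U
    · rw [indicator_of_mem hx]; exact min_le_left _ _
    · rw [indicator_of_notMem hx, hg0 n x hx]
  have hUfin : volume U ≠ ⊤ := hUb.measure_lt_top.ne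
  have hpre : Bornology.IsBounded (Ψ t ⁻¹' U) := by
    rw [← (Ψ t).image_symm]
    refine ((hUb.isCompact_closure.image (Ψ t).symm.continuous).isBounded).subset ?_
    exact image_mono subset_closure
  have hPfin : volume (Ψ t ⁻¹' U) ≠ ⊤ := hpre.measure_lt_top.ne
  have hPo : MeasurableSet (Ψ t ⁻¹' U) := (hU.preimage (Ψ t).continuous).measurableSet
  have l1 := tendsto_integral_of_dominated_convergence (μ := (volume : Measure Plane))
    (F := g) (f := U.indicator fun _ => (1 : ℝ)) (U.indicator fun _ => (1 : ℝ))
    (fun n => (hgl n).continuous.aestronglyMeasurable)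
    ((integrable_indicator_iff hU.measurableSet).2 (integrableOn_const hUfin))
    (fun n => ae_of_all _ (hle n)) (ae_of_all _ hlim)
  have l2 := tendsto_integral_of_dominated_convergence (μ := (volume : Measure Plane))
    (F := fun n x => g n (Ψ t x)) (f := (Ψ t ⁻¹' U).indicator fun _ => (1 : ℝ))
    ((Ψ t ⁻¹' U).indicator fun _ => (1 : ℝ))
    (fun n => ((hgl n).continuous.comp (Ψ t).continuous).aestronglyMeasurable)
    ((integrable_indicator_iff hPo).2 (integrableOn_const hPfin))
    (fun n => ae_of_all _ fun x => hle n (Ψ t x)) (ae_of_all _ fun x => hlim (Ψ t x))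
  have e := tendsto_nhds_unique (l2.congr fun n => h.integral_comp hv hdiv (hgl n) (hgs n) t) l1
  rw [integral_indicator hPo, integral_indicator hU.measurableSet] at e
  simp only [integral_const, smul_eq_mul, mul_one, measureReal_restrict_apply_univ] at e
  rw [Measure.map_apply (Ψ t).continuous.measurable hU.measurableSet]
  exact (measureReal_eq_measureReal_iff hPfin hUfin).1 e

end IsFlow

/-! ### The Joukowski map and the velocity field of an ellipse -/

/-- The quadratic form `x²/a² + y²/b²`, whose unit ball is the ellipse with semi-axes `a`, `b`. -/
noncomputable def ellipseForm (a b : ℝ) (z : ℂ) : ℝ := z.re ^ 2 / a ^ 2 + z.im ^ 2 / b ^ 2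

/-- The Joukowski map; for `a ≥ b > 0` it maps the exterior of the unit disk conformally to the
exterior of the ellipse with semi-axes `a`, `b`. -/
noncomputable def joukowski (a b : ℝ) (ζ : ℂ) : ℂ :=
  ((a + b) / 2 : ℝ) * ζ + ((a - b) / 2 : ℝ) * ζ⁻¹

lemma continuous_ellipseForm (a b : ℝ) : Continuous (ellipseForm a b) := by
  unfold ellipseForm; fun_prop

section Joukowski

variable {a b : ℝ}

/-- The Joukowski map expands up to the unit circle, so that its inverse is Lipschitz up to the
boundary of the ellipse. -/
lemma norm_joukowski_sub (hb : 0 < b) (hab : b ≤ a) {ζ₁ ζ₂ : ℂ} (h1 : 1 ≤ ‖ζ₁‖) (h2 : 1 ≤ ‖ζ₂‖) :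
    b * ‖ζ₁ - ζ₂‖ ≤ ‖joukowski a b ζ₁ - joukowski a b ζ₂‖ := by
  have n1 : ζ₁ ≠ 0 := norm_pos_iff.1 (by linarith)
  have n2 : ζ₂ ≠ 0 := norm_pos_iff.1 (by linarith)
  have e : joukowski a b ζ₁ - joukowski a b ζ₂ =
      (((a + b) / 2 : ℝ) - ((a - b) / 2 : ℝ) * (ζ₁⁻¹ * ζ₂⁻¹)) * (ζ₁ - ζ₂) := by
    unfold joukowski; field_simp; ring
  rw [e, norm_mul]
  refine mul_le_mul_of_nonneg_right ?_ (norm_nonneg _)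
  have h3 : ‖(((a - b) / 2 : ℝ) : ℂ) * (ζ₁⁻¹ * ζ₂⁻¹)‖ ≤ (a - b) / 2 := by
    rw [norm_mul, norm_mul, norm_inv, norm_inv, Complex.norm_real,
      Real.norm_of_nonneg (by linarith)]
    have : ‖ζ₁‖⁻¹ * ‖ζ₂‖⁻¹ ≤ 1 := mul_le_one₀ (inv_le_one_of_one_le₀ h1) (by positivity)
      (inv_le_one_of_one_le₀ h2)
    exact mul_le_of_le_one_right (by linarith) this
  have h4 : ‖(((a + b) / 2 : ℝ) : ℂ)‖ = (a + b) / 2 := by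
    rw [Complex.norm_real, Real.norm_of_nonneg (by linarith)]
  have h5 := norm_sub_norm_le (((a + b) / 2 : ℝ) : ℂ) ((((a - b) / 2 : ℝ) : ℂ) * (ζ₁⁻¹ * ζ₂⁻¹))
  linarith

lemma hasDerivAt_joukowski {ζ : ℂ} (h : ζ ≠ 0) : HasDerivAt (joukowski a b)
    (((a + b) / 2 : ℝ) - ((a - b) / 2 : ℝ) * (ζ ^ 2)⁻¹) ζ := by
  have h1 := ((hasDerivAt_id ζ).const_mul (((a + b) / 2 : ℝ) : ℂ)).add
    ((hasDerivAt_inv h).const_mul (((a - b) / 2 : ℝ) : ℂ))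
  refine h1.congr_deriv ?_
  ring

lemma deriv_joukowski_ne_zero (hb : 0 < b) (hab : b ≤ a) {ζ : ℂ} (h : 1 ≤ ‖ζ‖) :
    (((a + b) / 2 : ℝ) : ℂ) - ((a - b) / 2 : ℝ) * (ζ ^ 2)⁻¹ ≠ 0 := by
  intro h0
  have h1 : (((a + b) / 2 : ℝ) : ℂ) = ((a - b) / 2 : ℝ) * (ζ ^ 2)⁻¹ := sub_eq_zero.1 h0
  have h2 := congrArg norm h1
  rw [norm_mul, Complex.norm_real, Complex.norm_real, Real.norm_of_nonneg (by linarith),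
    Real.norm_of_nonneg (by linarith), norm_inv, norm_pow] at h2
  have h3 : (‖ζ‖ ^ 2)⁻¹ ≤ 1 := inv_le_one_of_one_le₀ (one_le_pow₀ h)
  have h4 : (a - b) / 2 * (‖ζ‖ ^ 2)⁻¹ ≤ (a - b) / 2 := mul_le_of_le_one_right (by linarith) h3
  linarith

lemma joukowski_re_im {ζ : ℂ} (h : ζ ≠ 0) :
    (joukowski a b ζ).re = ζ.re / ‖ζ‖ * ((a + b) / 2 * ‖ζ‖ + (a - b) / 2 / ‖ζ‖) ∧
    (joukowski a b ζ).im = ζ.im / ‖ζ‖ * ((a + b) / 2 * ‖ζ‖ - (a - b) / 2 / ‖ζ‖) := by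
  have h0 : ‖ζ‖ ≠ 0 := norm_ne_zero_iff.2 h
  have hn : Complex.normSq ζ = ‖ζ‖ ^ 2 := Complex.normSq_eq_norm_sq ζ
  constructor
  · simp only [joukowski, Complex.add_re, Complex.re_ofReal_mul, Complex.inv_re, hn]
    field_simp
  · simp only [joukowski, Complex.add_im, Complex.im_ofReal_mul, Complex.inv_im, hn]
    field_simp
    ring

/-- The annulus between the critical circle of the Joukowski map and the unit circle is mapped
into the ellipse. -/
lemma ellipseForm_joukowski_lt (hb : 0 < b) (hab : b ≤ a) {ζ : ℂ} (h0 : ζ ≠ 0)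
    (h1 : (a - b) / (a + b) ≤ ‖ζ‖ ^ 2) (h2 : ‖ζ‖ < 1) : ellipseForm a b (joukowski a b ζ) < 1 := by
  have ha : 0 < a := hb.trans_le hab
  obtain ⟨hre, him⟩ := joukowski_re_im (a := a) (b := b) h0
  set r := ‖ζ‖ with hr
  have hr0 : 0 < r := norm_pos_iff.2 h0
  have hq : a - b < (a + b) * r := by
    rw [div_le_iff₀ (by linarith)] at h1
    nlinarith
  have hA : (a + b) / 2 * r + (a - b) / 2 / r < a := by
    rw [← sub_neg]
    have : (a + b) / 2 * r + (a - b) / 2 / r - a =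
        (r - 1) * ((a + b) * r - (a - b)) / (2 * r) := by field_simp; ring
    rw [this]
    exact div_neg_of_neg_of_pos (mul_neg_of_neg_of_pos (by linarith) (by linarith)) (by linarith)
  have hA0 : 0 ≤ (a + b) / 2 * r + (a - b) / 2 / r := by
    have : 0 ≤ a - b := by linarith
    positivity
  have hB : (a + b) / 2 * r - (a - b) / 2 / r < b := by
    rw [← sub_neg]
    have : (a + b) / 2 * r - (a - b) / 2 / r - b =
        (r - 1) * ((a + b) * r + (a - b)) / (2 * r) := by field_simp; ring
    rw [this]
    exact div_neg_of_neg_of_pos (mul_neg_of_neg_of_pos (by linarith) (by nlinarith)) (by linarith)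
  have hB' : -b < (a + b) / 2 * r - (a - b) / 2 / r := by
    rw [← sub_pos]
    have : (a + b) / 2 * r - (a - b) / 2 / r - -b =
        (r + 1) * ((a + b) * r - (a - b)) / (2 * r) := by field_simp; ring
    rw [this]
    exact div_pos (mul_pos (by linarith) (by linarith)) (by linarith)
  have hcs : (ζ.re / r) ^ 2 + (ζ.im / r) ^ 2 = 1 := by
    have : ζ.re ^ 2 + ζ.im ^ 2 = r ^ 2 := by
      rw [hr, ← Complex.normSq_eq_norm_sq, Complex.normSq_apply]; ring
    field_simp
    linarith
  set A := (a + b) / 2 * r + (a - b) / 2 / r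
  set B := (a + b) / 2 * r - (a - b) / 2 / r
  have hA2 : A ^ 2 / a ^ 2 < 1 := by
    rw [div_lt_one (by positivity)]; exact pow_lt_pow_left₀ hA hA0 two_ne_zero
  have hB2 : B ^ 2 / b ^ 2 < 1 := by
    rw [div_lt_one (by positivity)]; nlinarith
  rw [ellipseForm, hre, him]
  have e : (ζ.re / r * A) ^ 2 / a ^ 2 + (ζ.im / r * B) ^ 2 / b ^ 2 =
      (ζ.re / r) ^ 2 * (A ^ 2 / a ^ 2) + (ζ.im / r) ^ 2 * (B ^ 2 / b ^ 2) := by ring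
  rw [e]
  calc (ζ.re / r) ^ 2 * (A ^ 2 / a ^ 2) + (ζ.im / r) ^ 2 * (B ^ 2 / b ^ 2)
      ≤ (ζ.re / r) ^ 2 * max (A ^ 2 / a ^ 2) (B ^ 2 / b ^ 2) +
          (ζ.im / r) ^ 2 * max (A ^ 2 / a ^ 2) (B ^ 2 / b ^ 2) := by
        gcongr
        · exact le_max_left _ _
        · exact le_max_right _ _
    _ = max (A ^ 2 / a ^ 2) (B ^ 2 / b ^ 2) := by rw [← add_mul, hcs, one_mul]
    _ < 1 := max_lt hA2 hB2

lemma exists_joukowski_eq (hb : 0 < b) (hab : b ≤ a) {z : ℂ} (hz : 1 ≤ ellipseForm a b z) :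
    ∃ ζ : ℂ, 1 ≤ ‖ζ‖ ∧ joukowski a b ζ = z := by
  have hs : ((a + b : ℝ) : ℂ) ≠ 0 := by
    norm_cast; linarith
  obtain ⟨s, hs2⟩ := IsAlgClosed.exists_pow_nat_eq (z ^ 2 - ((a ^ 2 - b ^ 2 : ℝ) : ℂ)) two_pos
  -- of the two roots of the quadratic equation for `ζ`, the larger one
  obtain ⟨s, hs2, hmax⟩ : ∃ s : ℂ, s ^ 2 = z ^ 2 - ((a ^ 2 - b ^ 2 : ℝ) : ℂ) ∧
      ‖z - s‖ ≤ ‖z + s‖ := by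
    rcases le_total ‖z - s‖ ‖z + s‖ with h | h
    · exact ⟨s, hs2, h⟩
    · exact ⟨-s, by rw [neg_sq, hs2], by simpa [← sub_eq_add_neg] using h⟩
  set ζ := (z + s) / ((a + b : ℝ) : ℂ) with hζ
  set ζ' := (z - s) / ((a + b : ℝ) : ℂ) with hζ'
  have hprod : ζ * ζ' = (((a - b) / (a + b) : ℝ) : ℂ) := by
    have e : ζ * ζ' = (z ^ 2 - s ^ 2) / ((a + b : ℝ) : ℂ) ^ 2 := by
      rw [hζ, hζ']; field_simp; ring
    rw [e, hs2, sub_sub_cancel]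
    norm_cast
    have : a + b ≠ 0 := by linarith
    field_simp
    ring
  have hsum : ζ + ζ' = 2 * z / ((a + b : ℝ) : ℂ) := by rw [hζ, hζ']; ring
  have hle : ‖ζ'‖ ≤ ‖ζ‖ := by
    rw [hζ, hζ', norm_div, norm_div]; gcongr
  have hq : (a - b) / (a + b) ≤ ‖ζ‖ ^ 2 := by
    have h1 := congrArg norm hprod
    rw [norm_mul, Complex.norm_real, Real.norm_of_nonneg (div_nonneg (by linarith) (by linarith))]
      at h1
    rw [← h1, sq]
    gcongr
  have h0 : ζ ≠ 0 := by
    intro h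
    have h' : ζ' = 0 := by rw [h, norm_zero] at hle; exact norm_le_zero_iff.1 hle
    rw [h, h', add_zero] at hsum
    have : z = 0 := by
      rcases div_eq_zero_iff.1 hsum.symm with h3 | h3
      · simpa using h3
      · exact absurd h3 hs
    rw [this] at hz
    norm_num [ellipseForm] at hz
  have hJ : joukowski a b ζ = z := by
    have e : ζ' = (((a - b) / (a + b) : ℝ) : ℂ) * ζ⁻¹ := by
      rw [← hprod]; field_simp
    have e2 : joukowski a b ζ = ((a + b : ℝ) : ℂ) / 2 * (ζ + ζ') := by
      rw [e, joukowski]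
      push_cast
      have : (a : ℂ) + b ≠ 0 := by exact_mod_cast hs
      field_simp
    rw [e2, hsum]
    field_simp
  refine ⟨ζ, ?_, hJ⟩
  by_contra hlt
  have := ellipseForm_joukowski_lt hb hab h0 hq (not_le.1 hlt)
  rw [hJ] at this
  linarith

/-- The inverse of the Joukowski map on the exterior of the ellipse. -/
noncomputable def joukowskiInv (a b : ℝ) (z : ℂ) : ℂ :=
  Classical.epsilon fun ζ => 1 ≤ ‖ζ‖ ∧ joukowski a b ζ = z

lemma joukowskiInv_spec (hb : 0 < b) (hab : b ≤ a) {z : ℂ} (hz : 1 ≤ ellipseForm a b z) :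
    1 ≤ ‖joukowskiInv a b z‖ ∧ joukowski a b (joukowskiInv a b z) = z :=
  Classical.epsilon_spec (exists_joukowski_eq hb hab hz)

lemma norm_joukowskiInv_sub_le (hb : 0 < b) (hab : b ≤ a) {z w : ℂ} (hz : 1 ≤ ellipseForm a b z)
    (hw : 1 ≤ ellipseForm a b w) :
    b * ‖joukowskiInv a b z - joukowskiInv a b w‖ ≤ ‖z - w‖ := by
  have h1 := joukowskiInv_spec hb hab hz
  have h2 := joukowskiInv_spec hb hab hw
  have := norm_joukowski_sub hb hab h1.1 h2.1
  rwa [h1.2, h2.2] at this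

lemma hasDerivAt_joukowskiInv (hb : 0 < b) (hab : b ≤ a) {z : ℂ} (hz : 1 < ellipseForm a b z) :
    ∃ d, HasDerivAt (joukowskiInv a b) d z := by
  have hs := joukowskiInv_spec hb hab hz.le
  have hev : ∀ᶠ w in 𝓝 z, 1 < ellipseForm a b w :=
    (continuous_ellipseForm a b).continuousAt.eventually (lt_mem_nhds hz)
  have hc : ContinuousAt (joukowskiInv a b) z := by
    refine tendsto_iff_norm_sub_tendsto_zero.2 ?_
    have h1 : Tendsto (fun w : ℂ => b⁻¹ * ‖w - z‖) (𝓝 z) (𝓝 (b⁻¹ * ‖z - z‖)) :=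
      Continuous.tendsto (by fun_prop) z
    rw [sub_self, norm_zero, mul_zero] at h1
    refine squeeze_zero' (Eventually.of_forall fun _ => norm_nonneg _) ?_ h1
    filter_upwards [hev] with w hw
    rw [inv_mul_eq_div, le_div_iff₀ hb, mul_comm]
    exact norm_joukowskiInv_sub_le hb hab hw.le hz.le
  refine ⟨_, HasDerivAt.of_local_left_inverse hc
    (hasDerivAt_joukowski (norm_pos_iff.1 (by linarith [hs.1])))
    (deriv_joukowski_ne_zero hb hab hs.1) ?_⟩
  filter_upwards [hev] with w hw using (joukowskiInv_spec hb hab hw.le).2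

open scoped ComplexConjugate in
/-- The Cauchy transform `π⁻¹ ∫_E dA(w) / (z - w)` of the ellipse `E` with semi-axes `a`, `b`. -/
noncomputable def ellipseCauchy (a b : ℝ) (z : ℂ) : ℂ :=
  open Classical in
  if ellipseForm a b z ≤ 1 then conj z - ((a - b) / (a + b) : ℝ) * z
  else (2 * a * b / (a + b) : ℝ) * (joukowskiInv a b z)⁻¹

open scoped ComplexConjugate in
lemma ellipseCauchy_of_le {z : ℂ} (h : ellipseForm a b z ≤ 1) :
    ellipseCauchy a b z = conj z - ((a - b) / (a + b) : ℝ) * z := by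
  rw [ellipseCauchy, if_pos h]

/-- The interior and the exterior formula agree on the boundary of the ellipse. -/
lemma ellipseCauchy_of_ge (hb : 0 < b) (hab : b ≤ a) {z : ℂ} (h : 1 ≤ ellipseForm a b z) :
    ellipseCauchy a b z = (2 * a * b / (a + b) : ℝ) * (joukowskiInv a b z)⁻¹ := by
  have ha : 0 < a := hb.trans_le hab
  rcases h.lt_or_eq with h | h
  · rw [ellipseCauchy, if_neg (not_le.2 h)]
  rw [ellipseCauchy, if_pos h.symm.le]
  set ζ : ℂ := ⟨z.re / a, z.im / b⟩ with hζ
  have hn : Complex.normSq ζ = 1 := by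
    rw [h, ellipseForm, Complex.normSq_apply]; simp only [hζ]; field_simp
  have hn1 : ‖ζ‖ = 1 := by
    rw [Complex.normSq_eq_norm_sq] at hn
    exact (pow_eq_one_iff_of_nonneg (norm_nonneg _) two_ne_zero).1 hn
  have hJ : joukowski a b ζ = z := by
    have h0 : ζ ≠ 0 := norm_pos_iff.1 (by rw [hn1]; norm_num)
    obtain ⟨h1, h2⟩ := joukowski_re_im (a := a) (b := b) h0
    rw [hn1] at h1 h2
    apply Complex.ext
    · rw [h1]; simp only [hζ]; field_simp; ring
    · rw [h2]; simp only [hζ]; field_simp; ring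
  have hs := joukowskiInv_spec hb hab h.le
  have heq : joukowskiInv a b z = ζ := by
    have := norm_joukowski_sub hb hab hs.1 hn1.ge
    rw [hs.2, hJ, sub_self, norm_zero] at this
    have h3 : ‖joukowskiInv a b z - ζ‖ ≤ 0 := by
      by_contra h4
      nlinarith
    exact sub_eq_zero.1 (norm_le_zero_iff.1 h3)
  rw [heq]
  have hab' : a + b ≠ 0 := by linarith
  apply Complex.ext
  · simp only [Complex.sub_re, Complex.conj_re, Complex.re_ofReal_mul, Complex.inv_re, hn]
    simp only [hζ]; field_simp; ring
  · simp only [Complex.sub_im, Complex.conj_im, Complex.im_ofReal_mul, Complex.inv_im, hn]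
    simp only [hζ]; field_simp; ring

lemma lipschitzWith_ellipseCauchy (hb : 0 < b) (hab : b ≤ a) :
    LipschitzWith 2 (ellipseCauchy a b) := by
  have ha : 0 < a := hb.trans_le hab
  have hin {z w : ℂ} (hz : ellipseForm a b z ≤ 1) (hw : ellipseForm a b w ≤ 1) :
      ‖ellipseCauchy a b z - ellipseCauchy a b w‖ ≤ 2 * ‖z - w‖ := by
    rw [ellipseCauchy_of_le hz, ellipseCauchy_of_le hw]
    have e : (starRingEnd ℂ) z - (((a - b) / (a + b) : ℝ) : ℂ) * z -
        ((starRingEnd ℂ) w - (((a - b) / (a + b) : ℝ) : ℂ) * w) =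
        (starRingEnd ℂ) (z - w) - (((a - b) / (a + b) : ℝ) : ℂ) * (z - w) := by
      rw [map_sub]; ring
    rw [e]
    refine (norm_sub_le _ _).trans ?_
    rw [RCLike.norm_conj, norm_mul, Complex.norm_real,
      Real.norm_of_nonneg (div_nonneg (by linarith) (by linarith))]
    have : (a - b) / (a + b) ≤ 1 := by rw [div_le_one (by linarith)]; linarith
    nlinarith [norm_nonneg (z - w)]
  have hout {z w : ℂ} (hz : 1 ≤ ellipseForm a b z) (hw : 1 ≤ ellipseForm a b w) :
      ‖ellipseCauchy a b z - ellipseCauchy a b w‖ ≤ 2 * ‖z - w‖ := by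
    rw [ellipseCauchy_of_ge hb hab hz, ellipseCauchy_of_ge hb hab hw, ← mul_sub, norm_mul,
      Complex.norm_real, Real.norm_of_nonneg (by positivity)]
    have h1 := (joukowskiInv_spec hb hab hz).1
    have h2 := (joukowskiInv_spec hb hab hw).1
    have h3 := norm_joukowskiInv_sub_le hb hab hz hw
    set ζ₁ := joukowskiInv a b z
    set ζ₂ := joukowskiInv a b w
    have n1 : ζ₁ ≠ 0 := norm_pos_iff.1 (by linarith)
    have n2 : ζ₂ ≠ 0 := norm_pos_iff.1 (by linarith)
    have h4 : ‖ζ₁⁻¹ - ζ₂⁻¹‖ ≤ ‖ζ₁ - ζ₂‖ := by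
      rw [inv_sub_inv n1 n2, norm_div, norm_mul, norm_sub_rev]
      exact div_le_self (norm_nonneg _) (one_le_mul_of_one_le_of_one_le h1 h2)
    have h5 : 2 * a * b / (a + b) ≤ 2 * b := by
      rw [div_le_iff₀ (by linarith)]; nlinarith
    calc 2 * a * b / (a + b) * ‖ζ₁⁻¹ - ζ₂⁻¹‖ ≤ 2 * b * ‖ζ₁ - ζ₂‖ := by gcongr
      _ ≤ 2 * ‖z - w‖ := by linarith
  have hmix {z w : ℂ} (hz : ellipseForm a b z ≤ 1) (hw : 1 ≤ ellipseForm a b w) :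
      ‖ellipseCauchy a b z - ellipseCauchy a b w‖ ≤ 2 * ‖z - w‖ := by
    -- a point of the segment from `z` to `w` lies on the boundary
    have hc : Continuous fun s : ℝ => ellipseForm a b (z + s * (w - z)) :=
      (continuous_ellipseForm a b).comp (by fun_prop)
    obtain ⟨s, hs, hs1⟩ := intermediate_value_Icc (zero_le_one' ℝ) hc.continuousOn
      (show (1 : ℝ) ∈ Icc _ _ by simpa using ⟨hz, hw⟩)
    set p := z + s * (w - z) with hp
    have h1 := hin hz hs1.le
    have h2 := hout hs1.ge hw
    have e1 : ‖z - p‖ = s * ‖z - w‖ := by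
      have : z - p = s * (z - w) := by rw [hp]; ring
      rw [this, norm_mul, Complex.norm_real, Real.norm_of_nonneg hs.1]
    have e2 : ‖p - w‖ = (1 - s) * ‖z - w‖ := by
      have : p - w = ((1 - s : ℝ) : ℂ) * (z - w) := by rw [hp]; push_cast; ring
      rw [this, norm_mul, Complex.norm_real, Real.norm_of_nonneg (by linarith [hs.2])]
    have h3 := norm_sub_le_norm_sub_add_norm_sub (ellipseCauchy a b z) (ellipseCauchy a b p)
      (ellipseCauchy a b w)
    rw [e1] at h1
    rw [e2] at h2
    linarith
  refine LipschitzWith.of_dist_le_mul fun z w => ?_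
  rw [dist_eq_norm, dist_eq_norm]
  change _ ≤ (2 : ℝ) * _
  rcases le_total (ellipseForm a b z) 1 with hz | hz <;>
    rcases le_total (ellipseForm a b w) 1 with hw | hw
  · exact hin hz hw
  · exact hmix hz hw
  · rw [norm_sub_rev, norm_sub_rev z]; exact hmix hw hz
  · exact hout hz hw

lemma norm_ellipseCauchy_mul_le (hb : 0 < b) (hab : b ≤ a) {z : ℂ} (hz : 1 ≤ ellipseForm a b z) :
    ‖ellipseCauchy a b z‖ * ‖z‖ ≤ 2 * a * b / (a + b) * a := by
  have ha : 0 < a := hb.trans_le hab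
  obtain ⟨h1, h2⟩ := joukowskiInv_spec hb hab hz
  rw [ellipseCauchy_of_ge hb hab hz, norm_mul, Complex.norm_real,
    Real.norm_of_nonneg (by positivity), norm_inv, mul_assoc]
  refine mul_le_mul_of_nonneg_left ?_ (by positivity)
  set ζ := joukowskiInv a b z
  rw [inv_mul_le_iff₀ (by linarith), ← h2]
  refine (norm_add_le _ _).trans ?_
  rw [norm_mul, norm_mul, Complex.norm_real, Complex.norm_real, norm_inv,
    Real.norm_of_nonneg (by linarith), Real.norm_of_nonneg (by linarith)]
  have h3 : ‖ζ‖⁻¹ ≤ ‖ζ‖ := (inv_le_one_of_one_le₀ h1).trans h1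
  have h4 : (a - b) / 2 * ‖ζ‖⁻¹ ≤ (a - b) / 2 * ‖ζ‖ :=
    mul_le_mul_of_nonneg_left h3 (by linarith)
  linarith

lemma hasDerivAt_ellipseCauchy (hb : 0 < b) (hab : b ≤ a) {z : ℂ} (hz : 1 < ellipseForm a b z) :
    ∃ d, HasDerivAt (ellipseCauchy a b) d z := by
  obtain ⟨d, hd⟩ := hasDerivAt_joukowskiInv hb hab hz
  have hn : joukowskiInv a b z ≠ 0 :=
    norm_pos_iff.1 (by linarith [(joukowskiInv_spec hb hab hz.le).1])
  refine ⟨_, ((hd.inv hn).const_mul ((2 * a * b / (a + b) : ℝ) : ℂ)).congr_of_eventuallyEq ?_⟩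
  filter_upwards [(continuous_ellipseForm a b).continuousAt.eventually (lt_mem_nhds hz)] with w hw
  exact ellipseCauchy_of_ge hb hab hw.le

end Joukowski

/-- The identification of the plane with `ℂ`. -/
noncomputable def toComplex : Plane →L[ℝ] ℂ :=
  LinearMap.toContinuousLinearMap
    { toFun := fun p => ⟨p 0, p 1⟩
      map_add' := fun v w => by apply Complex.ext <;> simp
      map_smul' := fun c v => by apply Complex.ext <;> simp }

@[simp] lemma toComplex_re (p : Plane) : (toComplex p).re = p 0 := rfl
@[simp] lemma toComplex_im (p : Plane) : (toComplex p).im = p 1 := rfl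

lemma norm_toComplex (p : Plane) : ‖toComplex p‖ = ‖p‖ := by
  rw [← sq_eq_sq₀ (norm_nonneg _) (norm_nonneg _), normSq_plane, ← Complex.normSq_eq_norm_sq,
    Complex.normSq_apply, toComplex_re, toComplex_im]
  ring

/-- The velocity whose complex form is `u₀ - i u₁ = F / (2 i)`. -/
noncomputable def velocityOfComplex : ℂ →L[ℝ] Plane :=
  LinearMap.toContinuousLinearMap
    { toFun := fun w => !₂[w.im / 2, w.re / 2]
      map_add' := fun v w => by apply plane_ext <;> simp <;> ring
      map_smul' := fun c v => by apply plane_ext <;> simp <;> ring }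

@[simp] lemma velocityOfComplex_zero_coord (w : ℂ) : velocityOfComplex w 0 = w.im / 2 := rfl
@[simp] lemma velocityOfComplex_one_coord (w : ℂ) : velocityOfComplex w 1 = w.re / 2 := rfl

lemma norm_velocityOfComplex (w : ℂ) : ‖velocityOfComplex w‖ = ‖w‖ / 2 := by
  rw [← sq_eq_sq₀ (norm_nonneg _) (by positivity), normSq_plane, div_pow,
    ← Complex.normSq_eq_norm_sq, Complex.normSq_apply]
  simp
  ring

/-- The ellipse with semi-axes `a`, `b` centered at the origin. -/
def centeredEllipse (a b : ℝ) : Set Plane := {p | ellipseForm a b (toComplex p) < 1}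

/-- The velocity field generated by the elliptic patch with semi-axes `a`, `b`. -/
noncomputable def ellipseVelocity (a b : ℝ) (p : Plane) : Plane :=
  velocityOfComplex (ellipseCauchy a b (toComplex p))

section EllipseVelocity

variable {a b : ℝ}

lemma ellipseForm_toComplex (a b : ℝ) (p : Plane) :
    ellipseForm a b (toComplex p) = p 0 ^ 2 / a ^ 2 + p 1 ^ 2 / b ^ 2 := rfl

lemma continuous_ellipseForm_toComplex (a b : ℝ) :
    Continuous fun p => ellipseForm a b (toComplex p) :=
  (continuous_ellipseForm a b).comp toComplex.continuous

lemma isOpen_centeredEllipse (a b : ℝ) : IsOpen (centeredEllipse a b) :=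
  isOpen_lt (continuous_ellipseForm_toComplex a b) continuous_const

lemma norm_sq_le_of_ellipseForm (hb : 0 < b) (hab : b ≤ a) (p : Plane) :
    ‖p‖ ^ 2 ≤ a ^ 2 * ellipseForm a b (toComplex p) := by
  have ha : 0 < a := hb.trans_le hab
  rw [normSq_plane, ellipseForm_toComplex, mul_add]
  have h1 : a ^ 2 * (p 0 ^ 2 / a ^ 2) = p 0 ^ 2 := by field_simp
  have h2 : p 1 ^ 2 ≤ a ^ 2 * (p 1 ^ 2 / b ^ 2) := by
    rw [← mul_div_assoc, le_div_iff₀ (by positivity), mul_comm]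
    gcongr
  linarith

lemma centeredEllipse_subset (hb : 0 < b) (hab : b ≤ a) :
    centeredEllipse a b ⊆ Metric.closedBall 0 a := by
  intro p hp
  have ha : 0 < a := hb.trans_le hab
  rw [mem_closedBall_zero_iff]
  refine le_of_sq_le_sq ?_ ha.le
  have hp' : ellipseForm a b (toComplex p) < 1 := hp
  nlinarith [norm_sq_le_of_ellipseForm hb hab p, pow_pos ha 2]

lemma volume_centeredEllipse_ne_top (hb : 0 < b) (hab : b ≤ a) :
    volume (centeredEllipse a b) ≠ ⊤ :=
  ((measure_mono (centeredEllipse_subset hb hab)).trans_lt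
    (isCompact_closedBall _ _).measure_lt_top).ne

lemma ae_ellipseForm_ne_one (hb : 0 < b) (hab : b ≤ a) :
    ∀ᵐ p : Plane, ellipseForm a b (toComplex p) ≠ 1 := by
  have ha : 0 < a := hb.trans_le hab
  let S : Plane ≃ₗ[ℝ] Plane :=
    { toFun := fun p => !₂[p 0 / a, p 1 / b]
      invFun := fun p => !₂[p 0 * a, p 1 * b]
      map_add' := fun v w => by apply plane_ext <;> simp <;> ring
      map_smul' := fun c v => by apply plane_ext <;> simp <;> ring
      left_inv := fun p => by apply plane_ext <;> simp <;> field_simp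
      right_inv := fun p => by apply plane_ext <;> simp <;> field_simp }
  have h := Measure.addHaar_preimage_linearEquiv (volume : Measure Plane) S (Metric.sphere 0 1)
  rw [Measure.addHaar_sphere, mul_zero] at h
  rw [ae_iff]
  refine measure_mono_null (fun p hp => ?_) h
  have hp' : ellipseForm a b (toComplex p) = 1 := not_not.1 hp
  rw [mem_preimage, mem_sphere_zero_iff_norm]
  refine (pow_eq_one_iff_of_nonneg (norm_nonneg _) two_ne_zero).1 ?_
  rw [normSq_plane, ← hp', ellipseForm_toComplex]
  change (p 0 / a) ^ 2 + (p 1 / b) ^ 2 = _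
  rw [div_pow, div_pow]

lemma lipschitzWith_ellipseVelocity (hb : 0 < b) (hab : b ≤ a) :
    LipschitzWith 1 (ellipseVelocity a b) := by
  refine LipschitzWith.of_dist_le_mul fun p q => ?_
  have h := (lipschitzWith_ellipseCauchy hb hab).dist_le_mul (toComplex p) (toComplex q)
  rw [dist_eq_norm, dist_eq_norm, ← map_sub, norm_toComplex] at h
  rw [dist_eq_norm, dist_eq_norm, ellipseVelocity, ellipseVelocity, ← map_sub,
    norm_velocityOfComplex]
  push_cast at h ⊢
  linarith

lemma ellipseVelocity_of_mem (hb : 0 < b) (hab : b ≤ a) {p : Plane} (hp : p ∈ centeredEllipse a b) :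
    ellipseVelocity a b p = !₂[-(a / (a + b)) * p 1, b / (a + b) * p 0] := by
  have hp' : ellipseForm a b (toComplex p) < 1 := hp
  have : a + b ≠ 0 := by linarith
  rw [ellipseVelocity, ellipseCauchy_of_le hp'.le]
  apply plane_ext
  · simp only [velocityOfComplex_zero_coord, Complex.sub_im, Complex.conj_im,
      Complex.im_ofReal_mul, toComplex_im, Matrix.cons_val_zero]
    field_simp
    ring
  · simp only [velocityOfComplex_one_coord, Complex.sub_re, Complex.conj_re,
      Complex.re_ofReal_mul, toComplex_re,
      Matrix.cons_val_one, Matrix.cons_val_zero]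
    field_simp
    ring

lemma divergence_curl_ellipseVelocity_of_mem (hb : 0 < b) (hab : b ≤ a) {p : Plane}
    (hp : p ∈ centeredEllipse a b) :
    divergence (ellipseVelocity a b) p = 0 ∧ curl (ellipseVelocity a b) p = 1 := by
  let L : Plane →L[ℝ] Plane := LinearMap.toContinuousLinearMap
    { toFun := fun p => !₂[-(a / (a + b)) * p 1, b / (a + b) * p 0]
      map_add' := fun v w => by apply plane_ext <;> simp <;> ring
      map_smul' := fun c v => by apply plane_ext <;> simp <;> ring }
  have hL (v : Plane) : L v = !₂[-(a / (a + b)) * v 1, b / (a + b) * v 0] := rfl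
  have h : HasFDerivAt (ellipseVelocity a b) L p := by
    refine L.hasFDerivAt.congr_of_eventuallyEq ?_
    filter_upwards [(isOpen_centeredEllipse a b).mem_nhds hp] with q hq
    exact ellipseVelocity_of_mem hb hab hq
  have : a + b ≠ 0 := by linarith
  constructor
  · simp [divergence, h.fderiv, hL]
  · simp [curl, h.fderiv, hL]
    field_simp
    ring

/-- Outside of the ellipse, the Cauchy-Riemann equations say that the velocity has neither
divergence nor curl. -/
lemma divergence_curl_ellipseVelocity_of_lt (hb : 0 < b) (hab : b ≤ a) {p : Plane}
    (hp : 1 < ellipseForm a b (toComplex p)) :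
    divergence (ellipseVelocity a b) p = 0 ∧ curl (ellipseVelocity a b) p = 0 := by
  obtain ⟨d, hd⟩ := hasDerivAt_ellipseCauchy hb hab hp
  have h1 : HasFDerivAt (fun p => ellipseCauchy a b (toComplex p)) _ p :=
    (hd.hasFDerivAt.restrictScalars ℝ).comp p toComplex.hasFDerivAt
  have h : HasFDerivAt (ellipseVelocity a b) _ p := velocityOfComplex.hasFDerivAt.comp p h1
  constructor
  · simp [divergence, h.fderiv]; ring
  · simp [curl, h.fderiv]

lemma tendsto_ellipseVelocity (hb : 0 < b) (hab : b ≤ a) :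
    Tendsto (ellipseVelocity a b) (cocompact Plane) (𝓝 0) := by
  have ha : 0 < a := hb.trans_le hab
  have h1 : Tendsto (fun p : Plane => 2 * a * b / (a + b) * a / ‖p‖) (cocompact Plane) (𝓝 0) :=
    (tendsto_norm_cocompact_atTop (E := Plane)).const_div_atTop _
  refine squeeze_zero_norm' ?_ h1
  filter_upwards [(tendsto_norm_cocompact_atTop (E := Plane)).eventually_ge_atTop a] with p hp
  have hp0 : 0 < ‖p‖ := ha.trans_le hp
  have hf : 1 ≤ ellipseForm a b (toComplex p) := by
    have h2 := norm_sq_le_of_ellipseForm hb hab p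
    by_contra h3
    have : a ^ 2 * ellipseForm a b (toComplex p) < a ^ 2 * 1 := by
      have := pow_pos ha 2
      gcongr
      exact not_le.1 h3
    nlinarith
  have h2 := norm_ellipseCauchy_mul_le hb hab hf
  rw [norm_toComplex] at h2
  rw [ellipseVelocity, norm_velocityOfComplex, le_div_iff₀ hp0]
  have : 0 ≤ ‖ellipseCauchy a b (toComplex p)‖ * ‖p‖ := by positivity
  linarith

lemma ae_divergence_curl_ellipseVelocity (hb : 0 < b) (hab : b ≤ a) :
    ∀ᵐ p, divergence (ellipseVelocity a b) p = 0 ∧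
      curl (ellipseVelocity a b) p = chi (centeredEllipse a b) p := by
  filter_upwards [ae_ellipseForm_ne_one hb hab] with p hp
  rcases lt_or_gt_of_ne hp with h | h
  · rw [chi, indicator_of_mem (show p ∈ centeredEllipse a b from h)]
    exact divergence_curl_ellipseVelocity_of_mem hb hab h
  · rw [chi, indicator_of_notMem (show p ∉ centeredEllipse a b from not_lt.2 h.le)]
    exact divergence_curl_ellipseVelocity_of_lt hb hab h

theorem biotSavart_centeredEllipse (hb : 0 < b) (hab : b ≤ a) :
    biotSavart (chi (centeredEllipse a b)) = ellipseVelocity a b :=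
  biotSavart_eq_of_curl (M := 1) (lipschitzWith_ellipseVelocity hb hab)
    (tendsto_ellipseVelocity hb hab)
    ((ae_divergence_curl_ellipseVelocity hb hab).mono fun _ h => h.1)
    ((ae_divergence_curl_ellipseVelocity hb hab).mono fun _ h => h.2)
    ((integrable_indicator_iff (isOpen_centeredEllipse a b).measurableSet).2
      (integrableOn_const (volume_centeredEllipse_ne_top hb hab)))
    (ae_of_all _ fun p => by
      by_cases h : p ∈ centeredEllipse a b <;> simp [chi, h])

end EllipseVelocity

/-! ### Rotations -/

@[simp] lemma rot_zero_coord (θ : ℝ) (v : Plane) :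
    rot θ v 0 = Real.cos θ * v 0 - Real.sin θ * v 1 := by
  simp [rot]; ring

@[simp] lemma rot_one_coord (θ : ℝ) (v : Plane) :
    rot θ v 1 = Real.cos θ * v 1 + Real.sin θ * v 0 := by
  simp [rot]

lemma rot_rot (θ η : ℝ) (v : Plane) : rot θ (rot η v) = rot (θ + η) v := by
  apply plane_ext <;> simp [Real.cos_add, Real.sin_add] <;> ring

@[simp] lemma rot_zero (v : Plane) : rot 0 v = v := by simp [rot]

lemma norm_rot (θ : ℝ) (v : Plane) : ‖rot θ v‖ = ‖v‖ := by
  rw [← sq_eq_sq₀ (norm_nonneg _) (norm_nonneg _), normSq_plane, normSq_plane]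
  simp only [rot_zero_coord, rot_one_coord]
  linear_combination (v 0 ^ 2 + v 1 ^ 2) * Real.sin_sq_add_cos_sq θ

lemma perp_rot (θ : ℝ) (v : Plane) : perp (rot θ v) = rot θ (perp v) := by
  apply plane_ext <;> simp <;> ring

/-- The rotation by the angle `θ` as a linear isometry. -/
noncomputable def rotL (θ : ℝ) : Plane ≃ₗᵢ[ℝ] Plane where
  toFun := rot θ
  invFun := rot (-θ)
  map_add' v w := by apply plane_ext <;> simp <;> ring
  map_smul' c v := by apply plane_ext <;> simp <;> ring
  left_inv v := by simp [rot_rot]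
  right_inv v := by simp [rot_rot]
  norm_map' v := norm_rot θ v

@[simp] lemma rotL_apply (θ : ℝ) (v : Plane) : rotL θ v = rot θ v := rfl

lemma hasDerivAt_rot_mul (Ω : ℝ) {y : ℝ → Plane} {y' : Plane} {t : ℝ} (hy : HasDerivAt y y' t) :
    HasDerivAt (fun s => rot (Ω * s) (y s)) (rot (Ω * t) (Ω • perp (y t) + y')) t := by
  have h0 : HasDerivAt (fun s => Ω * s) Ω t := by
    simpa using (hasDerivAt_id t).const_mul Ω
  have hp : HasDerivAt (fun s => perp (y s)) (perp y') t :=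
    perpL.hasFDerivAt.comp_hasDerivAt t hy
  have h : HasDerivAt (fun s => rot (Ω * s) (y s)) _ t := (h0.cos.smul hy).add (h0.sin.smul hp)
  refine h.congr_deriv ?_
  apply plane_ext <;> simp <;> ring

lemma biotSavartKernel_rot (θ : ℝ) (z : Plane) :
    biotSavartKernel (rot θ z) = rot θ (biotSavartKernel z) := by
  rw [biotSavartKernel, biotSavartKernel, norm_rot, perp_rot, ← rotL_apply θ (_ • _), map_smul,
    rotL_apply]

/-- The Biot-Savart law commutes with orientation preserving rigid motions. -/
lemma biotSavart_rigid (ω : Plane → ℝ) (c : Plane) (θ : ℝ) (x : Plane) :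
    biotSavart (fun y => ω (rot (-θ) (y - c))) x =
      rot θ (biotSavart ω (rot (-θ) (x - c))) := by
  rw [biotSavart, ← integral_add_right_eq_self _ c,
    ← (rotL θ).measurePreserving.integral_comp (rotL θ).toHomeomorph.measurableEmbedding,
    biotSavart, ← rotL_apply θ (∫ _, _)]
  have h := ((rotL θ).toContinuousLinearEquiv).integral_comp_comm (μ := (volume : Measure Plane))
    (fun y => ω y • biotSavartKernel (rot (-θ) (x - c) - y))
  refine Eq.trans ?_ h
  refine integral_congr_ae (ae_of_all _ fun y => ?_)
  have e : x - (rot θ y + c) = rot θ (rot (-θ) (x - c) - y) := by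
    rw [← rotL_apply θ (_ - _), map_sub, rotL_apply, rotL_apply, rot_rot, add_neg_cancel, rot_zero]
    abel
  change ω (rot (-θ) (rotL θ y + c - c)) • biotSavartKernel (x - (rotL θ y + c)) =
    rotL θ (ω y • biotSavartKernel (rot (-θ) (x - c) - y))
  rw [map_smul, rotL_apply, rotL_apply, e, biotSavartKernel_rot, add_sub_cancel_right, rot_rot,
    neg_add_cancel, rot_zero]

/-! ### Kirchhoff's rotating ellipses -/

/-- The ellipse with semi-axes `a`, `b` centered at `c`, rotated about its center by the
angle `θ`. -/
def movedEllipse (a b : ℝ) (c : Plane) (θ : ℝ) : Set Plane :=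
  {p | rot (-θ) (p - c) ∈ centeredEllipse a b}

/-- The angular speed of Kirchhoff's ellipse. -/
noncomputable def kirchhoffSpeed (a b : ℝ) : ℝ := a * b / (a + b) ^ 2

/-- The velocity field of the elliptic patch in the rotating frame. -/
noncomputable def kirchhoffField (a b : ℝ) (z : Plane) : Plane :=
  ellipseVelocity a b z - kirchhoffSpeed a b • perp z

section Kirchhoff

variable {a b : ℝ}

lemma continuous_rot_sub (c : Plane) (θ : ℝ) : Continuous fun p => rot θ (p - c) :=
  (rotL θ).continuous.comp (continuous_id.sub continuous_const)

lemma isOpen_movedEllipse (a b : ℝ) (c : Plane) (θ : ℝ) : IsOpen (movedEllipse a b c θ) :=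
  (isOpen_centeredEllipse a b).preimage (continuous_rot_sub c (-θ))

lemma volume_movedEllipse (a b : ℝ) (c : Plane) (θ : ℝ) :
    volume (movedEllipse a b c θ) = volume (centeredEllipse a b) := by
  have h : MeasurePreserving (fun p : Plane => rot (-θ) (p - c)) volume volume :=
    (rotL (-θ)).measurePreserving.comp (measurePreserving_sub_right volume c)
  exact h.measure_preimage (isOpen_centeredEllipse a b).measurableSet.nullMeasurableSet

lemma exists_lipschitzWith_kirchhoffField (hb : 0 < b) (hab : b ≤ a) :
    ∃ K, LipschitzWith K (kirchhoffField a b) := by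
  have h : LipschitzWith _ fun z : Plane => (kirchhoffSpeed a b • perpL) z :=
    ContinuousLinearMap.lipschitz _
  exact ⟨_, (lipschitzWith_ellipseVelocity hb hab).sub h⟩

lemma ae_divergence_kirchhoffField (hb : 0 < b) (hab : b ≤ a) :
    ∀ᵐ p, divergence (kirchhoffField a b) p = 0 := by
  filter_upwards [ae_divergence_curl_ellipseVelocity hb hab,
    (lipschitzWith_ellipseVelocity hb hab).ae_differentiableAt (μ := volume)] with p hp hd
  have h : HasFDerivAt (kirchhoffField a b)
      (fderiv ℝ (ellipseVelocity a b) p - kirchhoffSpeed a b • perpL) p :=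
    hd.hasFDerivAt.sub (kirchhoffSpeed a b • perpL).hasFDerivAt
  rw [← hp.1]
  simp [divergence, h.fderiv]

/-- In the rotating frame, the particles inside of the ellipse move along similar ellipses. -/
lemma kirchhoffFlow_mem (hb : 0 < b) (hab : b ≤ a) {Ψ : ℝ → Plane ≃ₜ Plane}
    (hΨ : IsFlow (kirchhoffField a b) Ψ) {z : Plane} (hz : z ∈ centeredEllipse a b) (t : ℝ) :
    Ψ t z ∈ centeredEllipse a b := by
  have ha : 0 < a := hb.trans_le hab
  obtain ⟨K, hK⟩ := exists_lipschitzWith_kirchhoffField hb hab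
  set Ω := kirchhoffSpeed a b with hΩ
  set γ : ℝ → Plane := fun t =>
    Real.cos (Ω * t) • z + Real.sin (Ω * t) • !₂[-(a / b * z 1), b / a * z 0] with hγ
  have hγ0 (t : ℝ) : γ t 0 = Real.cos (Ω * t) * z 0 - Real.sin (Ω * t) * (a / b * z 1) := by
    simp [hγ]; ring
  have hγ1 (t : ℝ) : γ t 1 = Real.cos (Ω * t) * z 1 + Real.sin (Ω * t) * (b / a * z 0) := by
    simp [hγ]
  have hmem (t : ℝ) : γ t ∈ centeredEllipse a b := by
    have h : ellipseForm a b (toComplex (γ t)) = ellipseForm a b (toComplex z) := by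
      rw [ellipseForm_toComplex, ellipseForm_toComplex, hγ0, hγ1]
      field_simp
      linear_combination (b ^ 2 * z 0 ^ 2 + a ^ 2 * z 1 ^ 2) * Real.sin_sq_add_cos_sq (Ω * t)
    change ellipseForm a b (toComplex (γ t)) < 1
    rw [h]
    exact hz
  have hd (t : ℝ) : HasDerivAt γ (kirchhoffField a b (γ t)) t := by
    have h0 : HasDerivAt (fun s => Ω * s) Ω t := by
      simpa using (hasDerivAt_id t).const_mul Ω
    have h : HasDerivAt γ _ t := (h0.cos.smul_const z).add
      (h0.sin.smul_const !₂[-(a / b * z 1), b / a * z 0])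
    refine h.congr_deriv ?_
    have hs : a + b ≠ 0 := by linarith
    rw [kirchhoffField, ellipseVelocity_of_mem hb hab (hmem t), ← hΩ]
    apply plane_ext
    · simp only [PiLp.add_apply, PiLp.sub_apply, PiLp.smul_apply, perp_zero_coord, hγ0, hγ1,
        smul_eq_mul, Matrix.cons_val_zero]
      simp only [hΩ, kirchhoffSpeed]
      field_simp
      ring
    · simp only [PiLp.add_apply, PiLp.sub_apply, PiLp.smul_apply, perp_one_coord, hγ0, hγ1,
        smul_eq_mul,
        Matrix.cons_val_one, Matrix.cons_val_zero]
      simp only [hΩ, kirchhoffSpeed]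
      field_simp
      ring
  have := hΨ.eq_of_solution hK hd t
  rw [show γ 0 = z by simp [hγ]] at this
  rw [this]
  exact hmem t

lemma chi_comp_rigid (a b : ℝ) (c : Plane) (θ : ℝ) : chi (movedEllipse a b c θ) =
    fun y => chi (centeredEllipse a b) (rot (-θ) (y - c)) := rfl

/-- Kirchhoff's ellipse is a Yudovich solution. Its flow is, up to the rotation of the frame, the
flow of an autonomous Lipschitz vector field. -/
theorem isYudovichSolution_movedEllipse (hb : 0 < b) (hab : b ≤ a) (c : Plane) :
    IsYudovichSolution (chi (movedEllipse a b c 0))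
      (fun t => chi (movedEllipse a b c (kirchhoffSpeed a b * t))) := by
  set Ω := kirchhoffSpeed a b with hΩ
  obtain ⟨K, hK⟩ := exists_lipschitzWith_kirchhoffField hb hab
  obtain ⟨Ψ, hΨ⟩ := exists_isFlow hK
  have hfin := volume_centeredEllipse_ne_top hb hab
  have hchi (A : Set Plane) (x : Plane) : ‖chi A x‖ ≤ 1 := by
    by_cases h : x ∈ A <;> simp [chi, h]
  refine ⟨⟨max 1 (volume (centeredEllipse a b)).toNNReal, fun t _ => ⟨?_, ?_, ?_⟩⟩, ?_⟩
  · exact (measurable_const.indicator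
      (isOpen_movedEllipse a b c _).measurableSet).aestronglyMeasurable
  · beta_reduce
    unfold chi
    rw [eLpNorm_indicator_const (isOpen_movedEllipse a b c _).measurableSet one_ne_zero
      ENNReal.one_ne_top, volume_movedEllipse]
    simp only [enorm_one, ENNReal.toReal_one, div_one, ENNReal.rpow_one, one_mul]
    rw [ENNReal.coe_max, ENNReal.coe_toNNReal hfin]
    exact le_max_right _ _
  · refine (eLpNormEssSup_le_of_ae_bound (C := 1) (ae_of_all _ (hchi _))).trans ?_
    rw [ENNReal.coe_max]
    simp
  refine ⟨fun t => (Homeomorph.subRight c).trans ((Ψ t).trans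
    ((rotL (Ω * t)).toHomeomorph.trans (Homeomorph.addRight c))), ?_, ?_, ?_, ?_⟩
  · intro x
    change rot (Ω * 0) (Ψ 0 (x - c)) + c = x
    rw [hΨ.zero, mul_zero, rot_zero, sub_add_cancel]
  · intro t _ x
    change HasDerivWithinAt (fun s => rot (Ω * s) (Ψ s (x - c)) + c)
      (biotSavart _ (rot (Ω * t) (Ψ t (x - c)) + c)) _ _
    beta_reduce
    rw [chi_comp_rigid, biotSavart_rigid, biotSavart_centeredEllipse hb hab]
    have h := (hasDerivAt_rot_mul Ω (hΨ.deriv t (x - c))).add_const c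
    refine (h.congr_deriv ?_).hasDerivWithinAt
    rw [add_sub_cancel_right, rot_rot, neg_add_cancel, rot_zero, kirchhoffField, add_sub_cancel]
  · intro t _
    exact (measurePreserving_add_right volume c).comp ((rotL (Ω * t)).measurePreserving.comp
      ((hΨ.measurePreserving hK (ae_divergence_kirchhoffField hb hab) t).comp
        (measurePreserving_sub_right volume c)))
  · intro t _
    refine Eventually.of_forall fun x => ?_
    change chi (centeredEllipse a b) (rot (-(Ω * t)) (x - c)) =
      chi (centeredEllipse a b) (rot (-0) ((Ψ t).symm (rot (-(Ω * t)) (x + -c)) + c - c))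
    rw [neg_zero, rot_zero, add_sub_cancel_right, ← sub_eq_add_neg]
    set z := rot (-(Ω * t)) (x - c)
    have hs : (Ψ t).symm z = Ψ (-t) z := by
      rw [Homeomorph.symm_apply_eq]
      simpa using (hΨ.neg_apply_apply hK (-t) z).symm
    rw [hs]
    by_cases hz : z ∈ centeredEllipse a b
    · rw [chi, indicator_of_mem hz, indicator_of_mem (kirchhoffFlow_mem hb hab hΨ hz _)]
    · have : Ψ (-t) z ∉ centeredEllipse a b := fun h => by
        have h2 := kirchhoffFlow_mem hb hab hΨ h t
        have h3 := hΨ.neg_apply_apply hK (-t) z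
        rw [neg_neg] at h3
        rw [h3] at h2
        exact hz h2
      rw [chi, indicator_of_notMem hz, indicator_of_notMem this]

theorem isUniqueYudovichSolution_movedEllipse (hb : 0 < b) (hab : b ≤ a) (c : Plane) :
    IsUniqueYudovichSolution (chi (movedEllipse a b c 0))
      (fun t => chi (movedEllipse a b c (kirchhoffSpeed a b * t))) := by
  have h := isYudovichSolution_movedEllipse hb hab c
  refine ⟨h, fun ω' h' t ht => yudovich_unique (isOpen_movedEllipse a b c 0).measurableSet ?_
    h h' t ht⟩
  rw [volume_movedEllipse]
  exact volume_centeredEllipse_ne_top hb hab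

end Kirchhoff

/-- The point `(0, n)`. -/
noncomputable def center (n : ℕ) : Plane := !₂[0, (n : ℝ)]

@[simp] lemma center_zero_coord (n : ℕ) : center n 0 = 0 := rfl
@[simp] lemma center_one_coord (n : ℕ) : center n 1 = n := rfl

lemma rotatedEllipse_eq (n : ℕ) (θ : ℝ) :
    rotatedEllipse n θ = movedEllipse (2 * n) n (center n) θ := by
  ext p
  change (_ / _ + _ / _ < (1 : ℝ)) ↔ (_ / _ + _ / _ < (1 : ℝ))
  change ((center n + rot (-θ) (p - center n)) 0 ^ 2 / (4 * (n : ℝ) ^ 2) +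
    ((center n + rot (-θ) (p - center n)) 1 - n) ^ 2 / (n : ℝ) ^ 2 < (1 : ℝ)) ↔
    (rot (-θ) (p - center n)) 0 ^ 2 / (2 * (n : ℝ)) ^ 2 +
      (rot (-θ) (p - center n)) 1 ^ 2 / (n : ℝ) ^ 2 < 1
  rw [PiLp.add_apply, PiLp.add_apply, center_zero_coord, center_one_coord, zero_add,
    add_sub_cancel_left, mul_pow]
  norm_num

lemma ellipse_eq (n : ℕ) : ellipse n = movedEllipse (2 * n) n (center n) 0 := by
  rw [← rotatedEllipse_eq]
  ext p
  change _ ↔ center n + rot (-0) (p - center n) ∈ ellipse n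
  rw [neg_zero, rot_zero, add_sub_cancel]

/-- The rotation about its center does not change a disk. -/
lemma disk_eq (n : ℕ) (θ : ℝ) : disk n = movedEllipse n n (center n) θ := by
  ext p
  change (p 0 ^ 2 / (n : ℝ) ^ 2 + (p 1 - n) ^ 2 / (n : ℝ) ^ 2 < 1) ↔
    (rot (-θ) (p - center n)) 0 ^ 2 / (n : ℝ) ^ 2 +
      (rot (-θ) (p - center n)) 1 ^ 2 / (n : ℝ) ^ 2 < 1
  rw [← add_div, ← add_div, ← normSq_plane, norm_rot, normSq_plane]
  simp

theorem isUniqueYudovichSolution_disk {n : ℕ} (hn : 1 ≤ n) :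
    IsUniqueYudovichSolution (chi (disk n)) (fun _ => chi (disk n)) := by
  have hn' : (0 : ℝ) < n := by exact_mod_cast hn
  have h := isUniqueYudovichSolution_movedEllipse hn' le_rfl (center n)
  simpa only [← disk_eq] using h

theorem isUniqueYudovichSolution_ellipse {n : ℕ} (hn : 1 ≤ n) :
    IsUniqueYudovichSolution (chi (ellipse n)) (fun t => chi (rotatedEllipse n (2 / 9 * t))) := by
  have hn' : (0 : ℝ) < n := by exact_mod_cast hn
  have h := isUniqueYudovichSolution_movedEllipse (a := 2 * n) hn' (by linarith) (center n)
  have hs : kirchhoffSpeed (2 * n) n = 2 / 9 := by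
    rw [kirchhoffSpeed]; field_simp; norm_num
  rw [hs, ← ellipse_eq] at h
  simpa only [rotatedEllipse_eq] using h

/-! ### Smooth vortices that carry a rotating shielded vortex -/

/-- The vorticity of the circular flow `G(|x|²) x^⊥`, as a function of `s = |x|²`. -/
noncomputable def radialVorticity (G : ℝ → ℝ) (s : ℝ) : ℝ := 2 * (G s + s * deriv G s)

lemma contDiff_radialVorticity {G : ℝ → ℝ} (hG : ContDiff ℝ (⊤ : ℕ∞) G) :
    ContDiff ℝ (⊤ : ℕ∞) (radialVorticity G) := by
  have h := (contDiff_infty_iff_deriv.1 hG).2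
  exact contDiff_const.mul (hG.add (contDiff_id.mul h))

lemma radialVorticity_congr {G H : ℝ → ℝ} {s : ℝ} (h : G =ᶠ[𝓝 s] H) :
    radialVorticity G s = radialVorticity H s := by
  rw [radialVorticity, radialVorticity, h.deriv_eq, h.eq_of_nhds]

lemma radialVorticity_const (c s : ℝ) : radialVorticity (fun _ => c) s = 2 * c := by
  simp [radialVorticity]

/-- The circular flow about `c` with the angular speed `G(|x - c|²)`. -/
noncomputable def circularFlow (G : ℝ → ℝ) (c x : Plane) : Plane := G (‖x - c‖ ^ 2) • perp (x - c)

lemma contDiff_circularFlow {G : ℝ → ℝ} (hG : ContDiff ℝ (⊤ : ℕ∞) G) (c : Plane) :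
    ContDiff ℝ (⊤ : ℕ∞) (circularFlow G c) :=
  (hG.comp ((contDiff_norm_sq ℝ).comp (contDiff_id.sub contDiff_const))).smul
    (perpL.contDiff.comp (contDiff_id.sub contDiff_const))

lemma fderiv_circularFlow {G : ℝ → ℝ} (hG : Differentiable ℝ G) (c x v : Plane) :
    fderiv ℝ (circularFlow G c) x v =
      G (‖x - c‖ ^ 2) • perp v +
        (deriv G (‖x - c‖ ^ 2) * 2 * inner ℝ (x - c) v) • perp (x - c) := by
  have h1 : HasFDerivAt (fun y : Plane => perp (y - c)) perpL x :=
    perpL.hasFDerivAt.comp x ((hasFDerivAt_id x).sub_const c)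
  have h : HasFDerivAt (circularFlow G c) _ x :=
    (hasFDerivAt_comp_normSq c x (hG _).hasDerivAt).smul h1
  rw [h.fderiv]
  simp [inner_sub_left]

lemma divergence_circularFlow {G : ℝ → ℝ} (hG : Differentiable ℝ G) (c x : Plane) :
    divergence (circularFlow G c) x = 0 := by
  simp only [divergence, fderiv_circularFlow hG, inner_plane]
  simp
  ring

lemma curl_circularFlow {G : ℝ → ℝ} (hG : Differentiable ℝ G) (c x : Plane) :
    curl (circularFlow G c) x = radialVorticity G (‖x - c‖ ^ 2) := by
  have h := normSq_plane (x - c)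
  simp only [curl, fderiv_circularFlow hG, inner_plane, radialVorticity]
  simp only [PiLp.add_apply, PiLp.smul_apply, perp_zero_coord, perp_one_coord, smul_eq_mul,
    e₀_zero, e₀_one, e₁_zero, e₁_one]
  linear_combination (-2 * deriv G (‖x - c‖ ^ 2)) * h

lemma inner_perp_self (v : Plane) : inner ℝ v (perp v) = 0 := by
  rw [inner_plane]; simp; ring

/-- Two superposed circular flows with the angular speeds `G` and `H`, as functions of the squared
distance to their centers, which are apart by `d`. The flow `H` is at rest outside of the disk of
radius `σ` about its center: its vortex is shielded. This disk lies inside of the disk of radius `r`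
in which the carrier `G` is a rigid rotation with the angular speed `1/2`; the carrier is at rest
outside of the disk of radius `ρ`. -/
structure IsCarrier (G H : ℝ → ℝ) (d : Plane) (σ r ρ : ℝ) : Prop where
  contDiff_carrier : ContDiff ℝ (⊤ : ℕ∞) G
  contDiff_bump : ContDiff ℝ (⊤ : ℕ∞) H
  carrier_inside : ∀ s < r ^ 2, G s = 1 / 2
  carrier_outside : ∀ s, ρ ^ 2 < s → G s = 0
  bump_outside : ∀ s, σ ^ 2 < s → H s = 0
  nonneg : 0 ≤ σ
  dist_lt : ‖d‖ + σ < r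
  le : r ≤ ρ

/-- The center of the carried vortex, which rotates about `c` at the angular speed `1/2`. -/
noncomputable def orbit (c d : Plane) (t : ℝ) : Plane := c + rot (1 / 2 * t) d

/-- The vorticity of the superposed flows. -/
noncomputable def carriedVorticity (G H : ℝ → ℝ) (c d : Plane) (t : ℝ) (x : Plane) : ℝ :=
  radialVorticity G (‖x - c‖ ^ 2) + radialVorticity H (‖x - orbit c d t‖ ^ 2)

/-- The velocity of the superposed flows. -/
noncomputable def carriedVelocity (G H : ℝ → ℝ) (c d : Plane) (t : ℝ) (x : Plane) : Plane :=
  circularFlow G c x + circularFlow H (orbit c d t) x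

lemma contDiff_orbit (c d : Plane) : ContDiff ℝ (⊤ : ℕ∞) (orbit c d) := by
  have : orbit c d = fun t => c + (Real.cos (1 / 2 * t) • d + Real.sin (1 / 2 * t) • perp d) := rfl
  rw [this]
  fun_prop

lemma hasDerivAt_orbit (c d : Plane) (t : ℝ) :
    HasDerivAt (orbit c d) ((1 / 2 : ℝ) • perp (orbit c d t - c)) t := by
  have h := (hasDerivAt_rot_mul (1 / 2) (hasDerivAt_const t d)).const_add c
  refine h.congr_deriv ?_
  rw [add_zero, orbit, add_sub_cancel_left, perp_rot, ← rotL_apply, map_smul, rotL_apply]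

namespace IsCarrier

variable {G H : ℝ → ℝ} {d : Plane} {σ r ρ : ℝ}

lemma norm_sub_lt (h : IsCarrier G H d σ r ρ) (c : Plane) (t : ℝ) {x : Plane} (hx :
    ‖x - orbit c d t‖ ^ 2 ≤ σ ^ 2) :
    ‖x - c‖ < r := by
  have h1 : ‖x - orbit c d t‖ ≤ σ := le_of_sq_le_sq hx h.nonneg
  have h2 : x - c = (x - orbit c d t) + rot (1 / 2 * t) d := by rw [orbit]; abel
  rw [h2]
  have := norm_add_le (x - orbit c d t) (rot (1 / 2 * t) d)
  rw [norm_rot] at this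
  linarith [h.dist_lt]

lemma pos (h : IsCarrier G H d σ r ρ) : 0 < r := by linarith [h.dist_lt, norm_nonneg d, h.nonneg]

lemma eventually_carrier_inside (h : IsCarrier G H d σ r ρ) {s : ℝ} (hs : s < r ^ 2) :
    G =ᶠ[𝓝 s] fun _ => 1 / 2 := by
  filter_upwards [gt_mem_nhds hs] with q hq using h.carrier_inside q hq

lemma radialVorticity_inside (h : IsCarrier G H d σ r ρ) {s : ℝ} (hs : s < r ^ 2) :
    radialVorticity G s = 1 := by
  rw [radialVorticity_congr (h.eventually_carrier_inside hs), radialVorticity_const]; norm_num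

lemma deriv_radialVorticity_inside (h : IsCarrier G H d σ r ρ) {s : ℝ} (hs : s < r ^ 2) :
    deriv (radialVorticity G) s = 0 := by
  have : radialVorticity G =ᶠ[𝓝 s] fun _ => 1 := by
    filter_upwards [gt_mem_nhds hs] with q hq using h.radialVorticity_inside hq
  simp [this.deriv_eq]

lemma radialVorticity_carrier_outside (h : IsCarrier G H d σ r ρ) {s : ℝ} (hs : ρ ^ 2 < s) :
    radialVorticity G s = 0 := by
  have : G =ᶠ[𝓝 s] fun _ => 0 := by
    filter_upwards [lt_mem_nhds hs] with q hq using h.carrier_outside q hq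
  rw [radialVorticity_congr this, radialVorticity_const, mul_zero]

lemma radialVorticity_bump_outside (h : IsCarrier G H d σ r ρ) {s : ℝ} (hs : σ ^ 2 < s) :
    radialVorticity H s = 0 := by
  have : H =ᶠ[𝓝 s] fun _ => 0 := by
    filter_upwards [lt_mem_nhds hs] with q hq using h.bump_outside q hq
  rw [radialVorticity_congr this, radialVorticity_const, mul_zero]

lemma deriv_radialVorticity_bump_outside (h : IsCarrier G H d σ r ρ) {s : ℝ} (hs : σ ^ 2 < s) :
    deriv (radialVorticity H) s = 0 := by
  have : radialVorticity H =ᶠ[𝓝 s] fun _ => 0 := by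
    filter_upwards [lt_mem_nhds hs] with q hq using h.radialVorticity_bump_outside hq
  simp [this.deriv_eq]

lemma outside (h : IsCarrier G H d σ r ρ) (c : Plane) (t : ℝ) {x : Plane} (hx :
    ρ ^ 2 < ‖x - c‖ ^ 2) :
    σ ^ 2 < ‖x - orbit c d t‖ ^ 2 := by
  by_contra hn
  have h1 := h.norm_sub_lt c t (not_lt.1 hn)
  have h2 : ‖x - c‖ ^ 2 ≤ ρ ^ 2 := pow_le_pow_left₀ (norm_nonneg _) (h1.le.trans h.le) 2
  linarith

lemma carriedVorticity_outside (h : IsCarrier G H d σ r ρ) (c : Plane) (t : ℝ) {x : Plane} (hx :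
    ρ ^ 2 < ‖x - c‖ ^ 2) :
    carriedVorticity G H c d t x = 0 := by
  rw [carriedVorticity, h.radialVorticity_carrier_outside hx,
    h.radialVorticity_bump_outside (h.outside c t hx), add_zero]

lemma contDiff_carriedVorticity (h : IsCarrier G H d σ r ρ) (c : Plane) :
    ContDiff ℝ (⊤ : ℕ∞) (Function.uncurry (carriedVorticity G H c d)) := by
  have h1 : ContDiff ℝ (⊤ : ℕ∞) fun q : ℝ × Plane => ‖q.2 - c‖ ^ 2 :=
    (contDiff_norm_sq ℝ).comp (contDiff_snd.sub contDiff_const)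
  have h2 : ContDiff ℝ (⊤ : ℕ∞) fun q : ℝ × Plane => ‖q.2 - orbit c d q.1‖ ^ 2 :=
    (contDiff_norm_sq ℝ).comp (contDiff_snd.sub ((contDiff_orbit c d).comp contDiff_fst))
  exact ((contDiff_radialVorticity h.contDiff_carrier).comp h1).add
    ((contDiff_radialVorticity h.contDiff_bump).comp h2)

lemma contDiff_carriedVelocity (h : IsCarrier G H d σ r ρ) (c : Plane) (t : ℝ) :
    ContDiff ℝ (⊤ : ℕ∞) (carriedVelocity G H c d t) :=
  (contDiff_circularFlow h.contDiff_carrier c).add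
    (contDiff_circularFlow h.contDiff_bump (orbit c d t))

lemma hasCompactSupport_carriedVelocity (h : IsCarrier G H d σ r ρ) (c : Plane) (t : ℝ) :
    HasCompactSupport (carriedVelocity G H c d t) :=
  hasCompactSupport_of_radial c ρ fun y hy => by
    rw [carriedVelocity, circularFlow, circularFlow, h.carrier_outside _ hy,
      h.bump_outside _ (h.outside c t hy), zero_smul, zero_smul, add_zero]

lemma hasCompactSupport_carriedVorticity (h : IsCarrier G H d σ r ρ) (c : Plane) (t : ℝ) :
    HasCompactSupport (carriedVorticity G H c d t) :=
  hasCompactSupport_of_radial c ρ fun _ hy => h.carriedVorticity_outside c t hy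

lemma continuous_carriedVorticity (h : IsCarrier G H d σ r ρ) (c : Plane) (t : ℝ) :
    Continuous (carriedVorticity G H c d t) := by
  have h1 := (contDiff_radialVorticity h.contDiff_carrier).continuous
  have h2 := (contDiff_radialVorticity h.contDiff_bump).continuous
  unfold carriedVorticity
  fun_prop

lemma fderiv_carriedVelocity (h : IsCarrier G H d σ r ρ) (c : Plane) (t : ℝ) (x : Plane) :
    fderiv ℝ (carriedVelocity G H c d t) x =
      fderiv ℝ (circularFlow G c) x + fderiv ℝ (circularFlow H (orbit c d t)) x :=
  (((contDiff_circularFlow h.contDiff_carrier c).differentiable (by simp) x).hasFDerivAt.add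
    ((contDiff_circularFlow h.contDiff_bump _).differentiable (by simp) x).hasFDerivAt).fderiv

lemma divergence_carriedVelocity (h : IsCarrier G H d σ r ρ) (c : Plane) (t : ℝ) (x : Plane) :
    divergence (carriedVelocity G H c d t) x = 0 := by
  have h1 := divergence_circularFlow (h.contDiff_carrier.differentiable (by simp)) c x
  have h2 := divergence_circularFlow (h.contDiff_bump.differentiable (by simp)) (orbit c d t) x
  simp only [divergence] at h1 h2
  simp only [divergence, h.fderiv_carriedVelocity, add_apply, PiLp.add_apply]
  linarith

lemma curl_carriedVelocity (h : IsCarrier G H d σ r ρ) (c : Plane) (t : ℝ) (x : Plane) :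
    curl (carriedVelocity G H c d t) x = carriedVorticity G H c d t x := by
  rw [carriedVorticity, ← curl_circularFlow (h.contDiff_carrier.differentiable (by simp)),
    ← curl_circularFlow (h.contDiff_bump.differentiable (by simp))]
  simp only [curl, h.fderiv_carriedVelocity, add_apply, PiLp.add_apply]
  ring

lemma biotSavart_carriedVorticity (h : IsCarrier G H d σ r ρ) (c : Plane) (t : ℝ) :
    biotSavart (carriedVorticity G H c d t) = carriedVelocity G H c d t := by
  have hs := h.hasCompactSupport_carriedVelocity c t
  have hws := h.hasCompactSupport_carriedVorticity c t
  have hwc := h.continuous_carriedVorticity c t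
  obtain ⟨C, hC⟩ :=
    (h.contDiff_carriedVelocity c t).lipschitzWith_of_hasCompactSupport hs (by simp)
  obtain ⟨M, hM⟩ := hws.exists_bound_of_continuous hwc
  exact biotSavart_eq_of_curl hC hs.is_zero_at_infty
    (ae_of_all _ (h.divergence_carriedVelocity c t)) (ae_of_all _ (h.curl_carriedVelocity c t))
    (hwc.integrable_of_hasCompactSupport hws) (ae_of_all _ hM)

/-- On its support, the carried vortex only feels the rigid rotation of the carrier, which
transports it along its orbit; the carrier is constant there and is not deformed. -/
theorem isSmoothCompactSolution (h : IsCarrier G H d σ r ρ) (c : Plane) :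
    IsSmoothCompactSolution (carriedVorticity G H c d) := by
  refine ⟨(h.contDiff_carriedVorticity c).contDiffOn, fun T => ⟨‖c‖ + ρ, fun t _ => ?_⟩,
    fun t _ x => ?_⟩
  · refine closure_minimal (fun x hx => ?_) Metric.isClosed_closedBall
    by_contra hn
    refine hx (h.carriedVorticity_outside c t ?_)
    rw [mem_closedBall_zero_iff, not_le] at hn
    have h1 : ρ < ‖x - c‖ := by linarith [norm_sub_norm_le x c]
    exact pow_lt_pow_left₀ h1 (h.pos.le.trans h.le) two_ne_zero
  · set p := orbit c d t with hp
    have hW := (contDiff_radialVorticity h.contDiff_carrier).differentiable (by simp)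
    have hB := (contDiff_radialVorticity h.contDiff_bump).differentiable (by simp)
    have hx : HasFDerivAt (carriedVorticity G H c d t) _ x :=
      (hasFDerivAt_comp_normSq c x (hW _).hasDerivAt).add
        (hasFDerivAt_comp_normSq p x (hB _).hasDerivAt)
    have ht : HasDerivAt (fun s => carriedVorticity G H c d s x)
        (deriv (radialVorticity H) (‖x - p‖ ^ 2) *
          (2 * inner ℝ (x - p) (-((1 / 2 : ℝ) • perp (p - c))))) t := by
      have h1 := ((hasDerivAt_orbit c d t).const_sub x).norm_sq
      have h2 := (hB (‖x - orbit c d t‖ ^ 2)).hasDerivAt.comp t h1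
      exact h2.const_add (radialVorticity G (‖x - c‖ ^ 2))
    rw [ht.hasDerivWithinAt.derivWithin (uniqueDiffOn_Ici 0 t ‹_›), hx.fderiv,
      h.biotSavart_carriedVorticity c t]
    simp only [add_apply, smul_apply, innerSL_apply_apply,
      smul_eq_mul, ← hp, carriedVelocity, circularFlow, inner_add_right,
      inner_smul_right, inner_perp_self, inner_neg_right, mul_zero, zero_add, add_zero]
    rcases le_or_gt (‖x - p‖ ^ 2) (σ ^ 2) with hs | hs
    · have hlt : ‖x - c‖ ^ 2 < r ^ 2 :=
        pow_lt_pow_left₀ (h.norm_sub_lt c t hs) (norm_nonneg _) two_ne_zero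
      have e : perp (x - c) = perp (x - p) + perp (p - c) := by
        rw [← perp_add, sub_add_sub_cancel]
      rw [h.deriv_radialVorticity_inside hlt, h.carrier_inside _ hlt, e, inner_add_right,
        inner_perp_self]
      ring
    · rw [h.deriv_radialVorticity_bump_outside hs, h.bump_outside _ hs]
      ring

end IsCarrier

/-! ### The half plane as a limit of shielded disks -/

/-- A smooth cutoff: `1` for `s ≤ 1`, `0` for `2 ≤ s`. -/
noncomputable def cutoff (s : ℝ) : ℝ := 1 - Real.smoothTransition (s - 1)

lemma contDiff_cutoff : ContDiff ℝ (⊤ : ℕ∞) cutoff :=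
  contDiff_const.sub (Real.smoothTransition.contDiff.comp (contDiff_id.sub contDiff_const))

lemma cutoff_eq_one {s : ℝ} (h : s ≤ 1) : cutoff s = 1 := by
  rw [cutoff, Real.smoothTransition.zero_of_nonpos (by linarith), sub_zero]

lemma cutoff_eq_zero {s : ℝ} (h : 2 ≤ s) : cutoff s = 0 := by
  rw [cutoff, Real.smoothTransition.one_of_one_le (by linarith), sub_self]

/-- A smooth function which is `0` for `r ≤ 0` and `r` for `1 ≤ r`. -/
noncomputable def ramp (r : ℝ) : ℝ := r * Real.smoothTransition r

lemma contDiff_ramp : ContDiff ℝ (⊤ : ℕ∞) ramp :=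
  contDiff_id.mul Real.smoothTransition.contDiff

lemma ramp_eq_zero {r : ℝ} (h : r ≤ 0) : ramp r = 0 := by
  rw [ramp, Real.smoothTransition.zero_of_nonpos h, mul_zero]

lemma deriv_ramp_of_neg {r : ℝ} (h : r < 0) : deriv ramp r = 0 := by
  have : ramp =ᶠ[𝓝 r] fun _ => 0 := by
    filter_upwards [gt_mem_nhds h] with q hq using ramp_eq_zero hq.le
  simp [this.deriv_eq]

lemma deriv_ramp_of_one_lt {r : ℝ} (h : 1 < r) : deriv ramp r = 1 := by
  have : ramp =ᶠ[𝓝 r] fun q => q := by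
    filter_upwards [lt_mem_nhds h] with q hq
    rw [ramp, Real.smoothTransition.one_of_one_le hq.le, mul_one]
  simp [this.deriv_eq]

lemma exists_abs_one_sub_deriv_ramp_le : ∃ B, 1 ≤ B ∧ ∀ r, |1 - deriv ramp r| ≤ B := by
  have hc : Continuous fun r => 1 - deriv ramp r :=
    continuous_const.sub (contDiff_ramp.continuous_deriv (by simp))
  obtain ⟨B, hB⟩ := (isCompact_Icc (a := (0 : ℝ)) (b := 1)).exists_bound_of_continuousOn
    hc.continuousOn
  refine ⟨max B 1, le_max_right _ _, fun r => ?_⟩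
  rcases lt_or_ge r 0 with h | h
  · simp [deriv_ramp_of_neg h]
  rcases lt_or_ge 1 r with h1 | h1
  · simp [deriv_ramp_of_one_lt h1]
  · exact (hB r ⟨h, h1⟩).trans (le_max_left _ _)

/-- The angular speed of the carrier: the vorticity is `1` on the disk of radius `r`. -/
noncomputable def carrierProfile (r s : ℝ) : ℝ := 1 / 2 * cutoff (s / r ^ 2)

/-- The angular speed of the carried vortex: its vorticity is `0` on the disk of radius `n` and,
after a smooth transition, `-1` around this disk, up to the radius `2 n`; the vortex ends before the
radius `3 n`. -/
noncomputable def bumpProfile (n s : ℝ) : ℝ :=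
  -(1 / 2) * (ramp (s - n ^ 2) * cutoff (s / (4 * n ^ 2))) / s

lemma isCarrier_profile {n : ℝ} (hn : 0 < n) {k : ℝ} (hk : 0 ≤ k) :
    IsCarrier (carrierProfile (3 * n + k + 1)) (bumpProfile n) (k • e₀) (3 * n) (3 * n + k + 1)
      (2 * (3 * n + k + 1)) where
  contDiff_carrier := contDiff_const.mul (contDiff_cutoff.comp (contDiff_id.div_const _))
  contDiff_bump := contDiff_div_self (contDiff_const.mul
    ((contDiff_ramp.comp (contDiff_id.sub contDiff_const)).mul
      (contDiff_cutoff.comp (contDiff_id.div_const _)))) (pow_pos hn 2) fun s hs => by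
    simp [ramp_eq_zero (sub_nonpos.2 hs.le)]
  carrier_inside s hs := by
    rw [carrierProfile, cutoff_eq_one (div_le_one_of_le₀ hs.le (by positivity)), mul_one]
  carrier_outside s hs := by
    rw [carrierProfile, cutoff_eq_zero, mul_zero]
    rw [le_div_iff₀ (by positivity)]
    nlinarith [sq_nonneg (3 * n + k + 1)]
  bump_outside s hs := by
    rw [bumpProfile, cutoff_eq_zero]
    · simp
    · rw [le_div_iff₀ (by positivity)]
      nlinarith [sq_nonneg n]
  nonneg := by positivity
  dist_lt := by
    have h : ‖e₀‖ = 1 := by simp [e₀, EuclideanSpace.norm_eq]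
    rw [norm_smul, h, Real.norm_of_nonneg hk]
    linarith
  le := by linarith

/-- The vorticity is `2 (s H)'`, and `s H = -ramp (s - n²) / 2` as long as the cutoff is `1`. -/
lemma radialVorticity_bumpProfile {n : ℝ} (hn : 0 < n) {k : ℝ} (hk : 0 ≤ k) {s : ℝ}
    (hs : s < 4 * n ^ 2) : radialVorticity (bumpProfile n) s = -deriv ramp (s - n ^ 2) := by
  have hd := ((isCarrier_profile hn hk).contDiff_bump.differentiable (by simp) s).hasDerivAt
  have h1 := (hasDerivAt_id s).mul hd
  have h2 : (fun s => s * bumpProfile n s) =ᶠ[𝓝 s] fun s => -(1 / 2) * ramp (s - n ^ 2) := by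
    filter_upwards [gt_mem_nhds hs] with q hq
    rw [bumpProfile, cutoff_eq_one (div_le_one_of_le₀ hq.le (by positivity)), mul_one]
    rcases eq_or_ne q 0 with rfl | h0
    · rw [ramp_eq_zero (by simp; positivity)]; simp
    · field_simp
  have h3 : HasDerivAt (fun s => -(1 / 2) * ramp (s - n ^ 2)) _ s :=
    (((contDiff_ramp.differentiable (by simp) (s - n ^ 2)).hasDerivAt.comp_sub_const s _)).const_mul
      (-(1 / 2))
  have h4 := h1.unique (h3.congr_of_eventuallyEq h2)
  simp only [id] at h4
  rw [radialVorticity]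
  linarith

/-- The height of the boundary of the half plane that moves with the velocity of the carrier. -/
noncomputable def height (k t : ℝ) : ℝ := k * Real.sin (1 / 2 * t)

/-- The half plane `y ≥ h`. -/
def halfPlane (h : ℝ) : Set Plane := {p | h ≤ p 1}

lemma isClosed_halfPlane (h : ℝ) : IsClosed (halfPlane h) :=
  isClosed_le continuous_const (coordL 1).continuous

/-- The center of the carrier. -/
noncomputable def carrierCenter (k n : ℝ) : Plane := !₂[-k, n]

@[simp] lemma carrierCenter_zero (k n : ℝ) : carrierCenter k n 0 = -k := rfl
@[simp] lemma carrierCenter_one (k n : ℝ) : carrierCenter k n 1 = n := rfl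

/-- Smooth solutions of the Euler equation which approximate the moving half plane. -/
noncomputable def approxSolution (k n : ℝ) : ℝ → Plane → ℝ :=
  carriedVorticity (carrierProfile (3 * n + k + 1)) (bumpProfile n) (carrierCenter k n) (k • e₀)

lemma isSmoothCompactSolution_approxSolution {k n : ℝ} (hk : 0 ≤ k) (hn : 0 < n) :
    IsSmoothCompactSolution (approxSolution k n) :=
  (isCarrier_profile hn hk).isSmoothCompactSolution _

/-- The distance to the moving center is measured from the height of the half plane. -/
lemma normSq_sub_orbit (k n t : ℝ) (x : Plane) :
    ‖x - orbit (carrierCenter k n) (k • e₀) t‖ ^ 2 - n ^ 2 =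
      (x 0 + k - k * Real.cos (1 / 2 * t)) ^ 2 + (x 1 - height k t) ^ 2 -
        2 * n * (x 1 - height k t) := by
  rw [normSq_plane]
  simp [orbit, height]
  ring

lemma approxSolution_eq {k n R t : ℝ} (hk : 0 ≤ k) {x : Plane} (hx : ‖x‖ ≤ R)
    (hn : R + 3 * k < n) :
    approxSolution k n t x =
      1 - deriv ramp (‖x - orbit (carrierCenter k n) (k • e₀) t‖ ^ 2 - n ^ 2) := by
  have hR : 0 ≤ R := (norm_nonneg x).trans hx
  have hn0 : 0 < n := by linarith
  have h0 := abs_le.1 ((abs_coord_le x 0).trans hx)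
  have h1 := abs_le.1 ((abs_coord_le x 1).trans hx)
  have hc : ‖carrierCenter k n‖ ≤ k + n := by
    refine (norm_le_abs_add_abs _).trans ?_
    simp [abs_of_nonneg hk, abs_of_pos hn0]
  have he : ‖k • e₀‖ = k := by
    have h : ‖e₀‖ = 1 := by simp [e₀, EuclideanSpace.norm_eq]
    rw [norm_smul, h, Real.norm_of_nonneg hk, mul_one]
  have hxc : ‖x - carrierCenter k n‖ ≤ R + (k + n) := (norm_sub_le _ _).trans (add_le_add hx hc)
  have hxp : ‖x - orbit (carrierCenter k n) (k • e₀) t‖ ≤ R + (k + n) + k := by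
    rw [orbit, ← sub_sub]
    refine (norm_sub_le _ _).trans (add_le_add hxc ?_)
    rw [norm_rot, he]
  have h2 : ‖x - carrierCenter k n‖ ^ 2 < (3 * n + k + 1) ^ 2 :=
    pow_lt_pow_left₀ (by linarith) (norm_nonneg _) two_ne_zero
  have h3 : ‖x - orbit (carrierCenter k n) (k • e₀) t‖ ^ 2 < (2 * n) ^ 2 :=
    pow_lt_pow_left₀ (by linarith) (norm_nonneg _) two_ne_zero
  rw [approxSolution, carriedVorticity, (isCarrier_profile hn0 hk).radialVorticity_inside h2,
    radialVorticity_bumpProfile hn0 hk (by linarith), ← sub_eq_add_neg]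

/-- On a ball, the approximate solutions agree with the half plane outside of a thin strip around
its boundary: near the ball, the disk of radius `n` is close to the half plane. -/
lemma approxSolution_eq_chi {k n R t : ℝ} (hk : 0 ≤ k) {x : Plane} (hx : ‖x‖ ≤ R)
    (hn : R + 3 * k < n) (hs : ((R + 2 * k) ^ 2 + (R + k) ^ 2 + 1) / n < |x 1 - height k t|) :
    approxSolution k n t x = chi (halfPlane (height k t)) x := by
  have hR : 0 ≤ R := (norm_nonneg x).trans hx
  have hn0 : 0 < n := by linarith
  have h0 := abs_le.1 ((abs_coord_le x 0).trans hx)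
  have h1 := abs_le.1 ((abs_coord_le x 1).trans hx)
  rw [div_lt_iff₀ hn0] at hs
  rw [approxSolution_eq hk hx hn, normSq_sub_orbit]
  have hh : |height k t| ≤ k := by
    rw [height, abs_mul, abs_of_nonneg hk]
    exact mul_le_of_le_one_right hk (Real.abs_sin_le_one _)
  have hh' := abs_le.1 hh
  have hcos1 : k * Real.cos (1 / 2 * t) ≤ k := mul_le_of_le_one_right hk (Real.cos_le_one _)
  have hcos2 : -k ≤ k * Real.cos (1 / 2 * t) := by
    nlinarith [Real.neg_one_le_cos (1 / 2 * t)]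
  have e1 : (x 0 + k - k * Real.cos (1 / 2 * t)) ^ 2 ≤ (R + 2 * k) ^ 2 :=
    sq_le_sq' (by linarith) (by linarith)
  have e2 : (x 1 - height k t) ^ 2 ≤ (R + k) ^ 2 := sq_le_sq' (by linarith) (by linarith)
  rcases le_total (height k t) (x 1) with h | h
  · rw [abs_of_nonneg (by linarith)] at hs
    rw [deriv_ramp_of_neg (by nlinarith), chi, indicator_of_mem (show x ∈ halfPlane _ from h),
      sub_zero]
  · rw [abs_of_nonpos (by linarith)] at hs
    have h' : x ∉ halfPlane (height k t) := fun h'' => by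
      have : x 1 - height k t = 0 := by linarith [show height k t ≤ x 1 from h'']
      rw [this] at hs
      nlinarith [sq_nonneg (R + 2 * k), sq_nonneg (R + k)]
    rw [deriv_ramp_of_one_lt (by nlinarith), chi, indicator_of_notMem h', sub_self]

lemma measurable_coord (i : Fin 2) : Measurable fun p : Plane => p i := (coordL i).measurable

/-- The closed rectangle `[a, b] × [c, d]`. -/
def box (a b c d : ℝ) : Set Plane := {p | (a ≤ p 0 ∧ p 0 ≤ b) ∧ c ≤ p 1 ∧ p 1 ≤ d}

lemma measurableSet_box (a b c d : ℝ) : MeasurableSet (box a b c d) := by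
  have h0 := measurable_coord 0
  have h1 := measurable_coord 1
  exact ((measurableSet_le measurable_const h0).inter (measurableSet_le h0 measurable_const)).inter
    ((measurableSet_le measurable_const h1).inter (measurableSet_le h1 measurable_const))

lemma volume_box (a b c d : ℝ) :
    volume (box a b c d) = ENNReal.ofReal (b - a) * ENNReal.ofReal (d - c) := by
  have h := (PiLp.volume_preserving_ofLp (Fin 2)).measure_preimage
    (measurableSet_Icc (a := ![a, c]) (b := ![b, d])).nullMeasurableSet
  rw [Real.volume_Icc_pi, Fin.prod_univ_two] at h
  rw [← show _ = ENNReal.ofReal (b - a) * ENNReal.ofReal (d - c) from h]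
  congr 1
  ext p
  simp only [box, mem_ofPred_eq, mem_preimage, mem_Icc, Pi.le_def, Fin.forall_fin_two,
    Matrix.cons_val_zero, Matrix.cons_val_one]
  tauto

lemma eLpNorm_le_of_eq_outside_box {F : Plane → ℝ} {K : Set Plane} (hK : MeasurableSet K)
    {B a b c d : ℝ} (hB : ∀ x ∈ K, |F x| ≤ B) (hF : ∀ x ∈ K, x ∉ box a b c d → F x = 0) :
    eLpNorm F 2 (volume.restrict K) ≤
      ENNReal.ofReal B * (ENNReal.ofReal (b - a) * ENNReal.ofReal (d - c)) ^ (1 / 2 : ℝ) := by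
  have hS := measurableSet_box a b c d
  calc eLpNorm F 2 (volume.restrict K)
      ≤ eLpNorm ((box a b c d).indicator fun _ => max B 0) 2 (volume.restrict K) := by
        refine eLpNorm_mono_ae ((ae_restrict_iff' hK).2 (ae_of_all _ fun x hx => ?_))
        by_cases h : x ∈ box a b c d
        · rw [indicator_of_mem h, Real.norm_of_nonneg (le_max_right _ _)]
          exact (hB x hx).trans (le_max_left _ _)
        · rw [indicator_of_notMem h, hF x hx h]
    _ = ENNReal.ofReal B * (volume.restrict K (box a b c d)) ^ (1 / 2 : ℝ) := by
        rw [eLpNorm_indicator_const hS two_ne_zero ENNReal.ofNat_ne_top,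
          Real.enorm_of_nonneg (le_max_right _ _), ENNReal.ofReal_max]
        simp
    _ ≤ _ := by
        rw [← volume_box]
        gcongr
        exact Measure.restrict_le_self

lemma abs_one_sub_sub_chi_le {B q : ℝ} (h : |1 - q| ≤ B) (A : Set Plane) (x : Plane) :
    |1 - q - chi A x| ≤ B + 1 := by
  have h1 : |chi A x| ≤ 1 := by by_cases h : x ∈ A <;> simp [chi, h]
  exact (abs_sub _ _).trans (add_le_add h h1)

/-- The shielded disks converge to the moving half plane, uniformly in time. -/
theorem tendstoL2locUniform_approxSolution {k : ℝ} (hk : 0 ≤ k) :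
    TendstoL2locUniform (fun n : ℕ => approxSolution k (n + 1))
      (fun t => chi (halfPlane (height k t))) := by
  refine ⟨fun t _ => ⟨fun n => ?_, (measurable_const.indicator
    (isClosed_halfPlane _).measurableSet).aestronglyMeasurable⟩, fun T K hK => ?_⟩
  · exact ((isCarrier_profile (n := (n : ℝ) + 1) (by positivity) hk).continuous_carriedVorticity
      _ t).aestronglyMeasurable
  obtain ⟨R, hR⟩ := hK.isBounded.subset_closedBall 0
  obtain ⟨B, hB1, hB⟩ := exists_abs_one_sub_deriv_ramp_le
  set A := (R + 2 * k) ^ 2 + (R + k) ^ 2 + 1 with hA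
  have hA0 : 0 < A := by positivity
  -- the bound for the contribution of the strip of height `2 A / (n + 1)`, which does not depend
  -- on time
  have hlim : Tendsto (fun n : ℕ => ENNReal.ofReal (B + 1) * (ENNReal.ofReal (R - -R) *
      ENNReal.ofReal (2 * (A * (1 / ((n : ℝ) + 1))))) ^ (1 / 2 : ℝ)) atTop (𝓝 0) := by
    have h1 : Tendsto (fun n : ℕ => ENNReal.ofReal (2 * (A * (1 / ((n : ℝ) + 1))))) atTop
        (𝓝 0) := by
      have := (tendsto_one_div_add_atTop_nhds_zero_nat (𝕜 := ℝ)).const_mul A |>.const_mul 2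
      simpa using ENNReal.tendsto_ofReal this
    have h2 := ENNReal.Tendsto.const_mul (a := ENNReal.ofReal (R - -R)) h1
      (Or.inr ENNReal.ofReal_ne_top)
    have h3 := (h2.ennrpow_const (1 / 2))
    have h4 := ENNReal.Tendsto.const_mul (a := ENNReal.ofReal (B + 1)) h3
      (Or.inr ENNReal.ofReal_ne_top)
    simpa using h4
  refine tendsto_of_tendsto_of_tendsto_of_le_of_le' tendsto_const_nhds hlim
    (Eventually.of_forall fun _ => zero_le) ?_
  obtain ⟨N, hN⟩ := exists_nat_gt (R + 3 * k)
  filter_upwards [eventually_ge_atTop N] with n hn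
  have hn' : R + 3 * k < (n : ℝ) + 1 := by
    have : (N : ℝ) ≤ n := by exact_mod_cast hn
    linarith
  refine iSup₂_le fun t _ => ?_
  have e : 2 * (A * (1 / ((n : ℝ) + 1))) = (height k t + A / (n + 1)) -
    (height k t - A / (n + 1)) := by ring
  rw [e]
  refine eLpNorm_le_of_eq_outside_box hK.measurableSet (fun x hx => ?_) fun x hx hxb => ?_
  · have hxR : ‖x‖ ≤ R := by simpa using hR hx
    rw [Pi.sub_apply, approxSolution_eq hk hxR hn']
    exact abs_one_sub_sub_chi_le (hB _) _ _
  · have hxR : ‖x‖ ≤ R := by simpa using hR hx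
    rw [Pi.sub_apply, approxSolution_eq_chi hk hxR hn', sub_self]
    by_contra hc
    have h0 := abs_le.1 ((abs_coord_le x 0).trans hxR)
    have h1 := abs_le.1 (not_lt.1 hc)
    exact hxb ⟨h0, by linarith, by linarith⟩

lemma not_ae_eq_chi_halfPlane {a b : ℝ} (h : a < b) :
    ¬ chi (halfPlane a) =ᵐ[volume] chi (halfPlane b) := by
  intro he
  have h1 : volume (box 0 1 a ((a + b) / 2)) = 0 := by
    refine measure_mono_null (fun p hp => ?_) he
    have ha : p ∈ halfPlane a := hp.2.1
    have hb : p ∉ halfPlane b := fun hb => by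
      linarith [hp.2.2, show b ≤ p 1 from hb]
    simp [chi, ha, hb]
  rw [volume_box] at h1
  have h2 : 0 < (a + b) / 2 - a := by linarith
  simp [h2.not_ge] at h1

/-! ### Local limits of the disks and of the ellipses -/

lemma ae_coord_one_ne (h : ℝ) : ∀ᵐ p : Plane, p 1 ≠ h := by
  rw [ae_iff]
  refine measure_mono_null (t := ⋃ n : ℕ, box (-n) n h h) (fun p hp => ?_)
    (measure_iUnion_null fun n => by simp [volume_box])
  obtain ⟨n, hn⟩ := exists_nat_ge |p 0|
  have hp' : p 1 = h := by simpa using hp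
  exact mem_iUnion.2 ⟨n, abs_le.1 hn, hp'.ge, hp'.le⟩

/-- Pointwise convergence of characteristic functions almost everywhere is enough: they are
dominated by an integrable function on compact sets. -/
lemma tendstoL2loc_chi {S : ℕ → Set Plane} {A : Set Plane} (hS : ∀ n, MeasurableSet (S n))
    (hA : MeasurableSet A) (h : ∀ᵐ p, ∀ᶠ n in atTop, p ∈ S n ↔ p ∈ A) :
    TendstoL2loc (fun n => chi (S n)) (chi A) := by
  have hm {B : Set Plane} (hB : MeasurableSet B) : Measurable (chi B) :=
    measurable_const.indicator hB
  have h1 (B : Set Plane) (p : Plane) : |chi B p| ≤ 1 := by by_cases h : p ∈ B <;> simp [chi, h]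
  refine ⟨fun n => (hm (hS n)).aestronglyMeasurable, (hm hA).aestronglyMeasurable, fun K hK => ?_⟩
  have hl : Tendsto (fun n => ∫⁻ p in K, ‖(chi (S n) - chi A) p‖ₑ ^ (2 : ℝ)) atTop
      (𝓝 (∫⁻ _ in K, 0)) := by
    refine tendsto_lintegral_of_dominated_convergence (fun _ => (ENNReal.ofReal 2) ^ (2 : ℝ))
      (fun n => ((hm (hS n)).sub (hm hA)).enorm.pow_const _) (fun n => ae_of_all _ fun p => ?_) ?_
      (ae_restrict_of_ae ?_)
    · beta_reduce
      rw [← ofReal_norm]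
      gcongr
      rw [Pi.sub_apply, Real.norm_eq_abs]
      linarith [abs_sub (chi (S n) p) (chi A p), h1 (S n) p, h1 A p]
    · rw [lintegral_const]
      exact ENNReal.mul_ne_top (by simp) (by simpa using hK.measure_lt_top.ne)
    · filter_upwards [h] with p hp
      refine tendsto_const_nhds.congr' ?_
      filter_upwards [hp] with n hn
      have : chi (S n) p = chi A p := by
        by_cases hA' : p ∈ A <;> simp [chi, hn, hA']
      simp [this]
  rw [lintegral_zero] at hl
  have h2 := hl.ennrpow_const (1 / 2)
  simp only [eLpNorm_eq_lintegral_rpow_enorm_toReal two_ne_zero ENNReal.ofNat_ne_top]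
  simpa using h2

lemma eventually_quadratic_neg {α : ℝ} (hα : α < 0) (β γ : ℝ) :
    ∀ᶠ n : ℕ in atTop, (α * n + β) * n + γ < 0 := by
  have h1 : Tendsto (fun n : ℕ => (n : ℝ)) atTop atTop := tendsto_natCast_atTop_atTop
  have h2 : Tendsto (fun n : ℕ => (α * n + β) * n + γ) atTop atBot :=
    tendsto_atBot_add_const_right _ _
      ((tendsto_atBot_add_const_right _ _ (h1.const_mul_atTop_of_neg hα)).atBot_mul_atTop₀ h1)
  exact h2.eventually_lt_atBot 0

/-- A domain bounded by a conic that is tangent to the horizontal axis at the origin. -/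
lemma eventually_mem_iff_of_tangent {p : Plane} (hp : p 1 ≠ 0) {c : ℝ} (hc : 0 ≤ c) :
    ∀ᶠ n : ℕ in atTop, c * p 0 ^ 2 + (p 1 - n) ^ 2 < (n : ℝ) ^ 2 ↔ p ∈ upperHalf := by
  rcases lt_or_gt_of_ne hp with h | h
  · refine Eventually.of_forall fun n => iff_of_false ?_ (fun h' => h'.not_gt h)
    have : (0 : ℝ) ≤ n := n.cast_nonneg
    have := mul_nonneg hc (sq_nonneg (p 0))
    nlinarith [sq_nonneg (p 1)]
  · obtain ⟨N, hN⟩ := exists_nat_gt ((c * p 0 ^ 2 + p 1 ^ 2) / (2 * p 1))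
    filter_upwards [eventually_ge_atTop N] with n hn
    refine iff_of_true ?_ h.le
    have h1 : (N : ℝ) ≤ n := by exact_mod_cast hn
    have h2 := (div_lt_iff₀ (by positivity)).1 (hN.trans_le h1)
    linarith

lemma mem_disk_iff {n : ℕ} (hn : 1 ≤ n) (p : Plane) :
    p ∈ disk n ↔ 1 * p 0 ^ 2 + (p 1 - n) ^ 2 < (n : ℝ) ^ 2 := by
  have hn' : (0 : ℝ) < n := by exact_mod_cast hn
  change _ / _ + _ / _ < (1 : ℝ) ↔ _
  rw [← add_div, div_lt_one (by positivity), one_mul]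

lemma mem_ellipse_iff {n : ℕ} (hn : 1 ≤ n) (p : Plane) :
    p ∈ ellipse n ↔ 1 / 4 * p 0 ^ 2 + (p 1 - n) ^ 2 < (n : ℝ) ^ 2 := by
  have hn' : (0 : ℝ) < n := by exact_mod_cast hn
  change _ / _ + _ / _ < (1 : ℝ) ↔ _
  have e : p 0 ^ 2 / (4 * (n : ℝ) ^ 2) + (p 1 - n) ^ 2 / (n : ℝ) ^ 2 =
      (1 / 4 * p 0 ^ 2 + (p 1 - n) ^ 2) / (n : ℝ) ^ 2 := by field_simp
  rw [e, div_lt_one (by positivity)]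

lemma measurableSet_disk (n : ℕ) : MeasurableSet (disk n) := by
  rw [disk_eq n 0]
  exact (isOpen_movedEllipse _ _ _ _).measurableSet

lemma measurableSet_rotatedEllipse (n : ℕ) (θ : ℝ) : MeasurableSet (rotatedEllipse n θ) := by
  rw [rotatedEllipse_eq]
  exact (isOpen_movedEllipse _ _ _ _).measurableSet

lemma measurableSet_ellipse (n : ℕ) : MeasurableSet (ellipse n) := by
  rw [ellipse_eq]
  exact (isOpen_movedEllipse _ _ _ _).measurableSet

lemma measurableSet_upperHalf : MeasurableSet upperHalf :=
  (isClosed_halfPlane 0).measurableSet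

lemma hasCompactSupport_chi_of_le {A : Set Plane} {n : ℕ}
    (h : ∀ p ∈ A, 1 / 4 * p 0 ^ 2 + (p 1 - n) ^ 2 < (n : ℝ) ^ 2) : HasCompactSupport (chi A) := by
  refine HasCompactSupport.intro (isCompact_closedBall (center n) (2 * n)) fun p hp => ?_
  refine indicator_of_notMem (fun hA => hp ?_) _
  rw [mem_closedBall_iff_norm]
  refine le_of_sq_le_sq ?_ (by positivity)
  rw [normSq_plane]
  have := h p hA
  simp only [PiLp.sub_apply, center_zero_coord, center_one_coord, sub_zero]
  nlinarith [sq_nonneg (p 1 - n)]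

lemma hasCompactSupport_chi_disk {n : ℕ} (hn : 1 ≤ n) : HasCompactSupport (chi (disk n)) :=
  hasCompactSupport_chi_of_le fun p hp => by
    refine lt_of_le_of_lt ?_ ((mem_disk_iff hn p).1 hp)
    gcongr
    norm_num

lemma hasCompactSupport_chi_ellipse {n : ℕ} (hn : 1 ≤ n) : HasCompactSupport (chi (ellipse n)) :=
  hasCompactSupport_chi_of_le fun p hp => (mem_ellipse_iff hn p).1 hp

theorem tendstoL2loc_disk : TendstoL2loc (fun n => chi (disk n)) (chi upperHalf) := by
  refine tendstoL2loc_chi measurableSet_disk measurableSet_upperHalf ?_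
  filter_upwards [ae_coord_one_ne 0] with p hp
  filter_upwards [eventually_mem_iff_of_tangent hp zero_le_one, eventually_ge_atTop 1] with n h hn
  rw [mem_disk_iff hn, h]

theorem tendstoL2loc_ellipse : TendstoL2loc (fun n => chi (ellipse n)) (chi upperHalf) := by
  refine tendstoL2loc_chi measurableSet_ellipse measurableSet_upperHalf ?_
  filter_upwards [ae_coord_one_ne 0] with p hp
  filter_upwards [eventually_mem_iff_of_tangent hp (by norm_num : (0 : ℝ) ≤ 1 / 4),
    eventually_ge_atTop 1] with n h hn
  rw [mem_ellipse_iff hn, h]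

/-- Unless the long axis of the ellipses is horizontal, the origin is an interior point, and the
ellipses fill the plane. -/
theorem tendstoL2loc_rotatedEllipse {θ : ℝ} (hθ : Real.sin θ ≠ 0) :
    TendstoL2loc (fun n => chi (rotatedEllipse n θ)) (fun _ => 1) := by
  have e : (fun _ => 1) = chi univ := by simp [chi]
  rw [e]
  refine tendstoL2loc_chi (fun n => measurableSet_rotatedEllipse n θ) MeasurableSet.univ
    (ae_of_all _ fun p => ?_)
  have hα : -(3 / 4) * Real.sin θ ^ 2 < 0 := by
    have := pow_pos (abs_pos.2 hθ) 2
    rw [sq_abs] at this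
    linarith
  set A := Real.cos θ * p 0 + Real.sin θ * p 1
  set B := -(Real.sin θ * p 0) + Real.cos θ * p 1
  filter_upwards [eventually_quadratic_neg hα (-(1 / 2) * A * Real.sin θ - 2 * B * Real.cos θ)
    (1 / 4 * A ^ 2 + B ^ 2), eventually_ge_atTop 1] with n h hn
  have hn' : (0 : ℝ) < n := by exact_mod_cast hn
  refine iff_of_true ?_ trivial
  rw [rotatedEllipse_eq]
  change (rot (-θ) (p - center n)) 0 ^ 2 / (2 * (n : ℝ)) ^ 2 +
    (rot (-θ) (p - center n)) 1 ^ 2 / (n : ℝ) ^ 2 < 1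
  have h0 : rot (-θ) (p - center n) 0 = A - Real.sin θ * n := by simp [A]; ring
  have h1 : rot (-θ) (p - center n) 1 = B - Real.cos θ * n := by simp [B]; ring
  have e : (A - Real.sin θ * n) ^ 2 / (2 * (n : ℝ)) ^ 2 + (B - Real.cos θ * n) ^ 2 / (n : ℝ) ^ 2 =
      (1 / 4 * (A - Real.sin θ * n) ^ 2 + (B - Real.cos θ * n) ^ 2) / (n : ℝ) ^ 2 := by
    field_simp
    ring
  rw [h0, h1, e, div_lt_one (by positivity), ← sub_neg]
  refine lt_of_eq_of_lt ?_ h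
  linear_combination (n : ℝ) ^ 2 * Real.sin_sq_add_cos_sq θ

/-! ### Half planes that are moved by a time dependent uniform flow -/

/-- The shear flow with vorticity `1` in the half plane `y ≥ h` that is at rest below. -/
noncomputable def shear (h : ℝ) (x : Plane) : Plane := -(max (x 1 - h) 0) • e₀

lemma norm_e₀ : ‖e₀‖ = 1 := by simp [e₀, EuclideanSpace.norm_eq]

lemma norm_e₁ : ‖e₁‖ = 1 := by simp [e₁, EuclideanSpace.norm_eq]

lemma shear_add (h : ℝ) (x : Plane) : shear h (x + h • e₁) = shear 0 x := by simp [shear]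

lemma norm_shear_le (h : ℝ) (x : Plane) : ‖shear h x‖ ≤ ‖x‖ + |h| := by
  rw [shear, norm_smul, norm_e₀, mul_one, norm_neg, Real.norm_of_nonneg (le_max_right _ _)]
  refine max_le ?_ (by positivity)
  linarith [(abs_le.1 (abs_coord_le x 1)).2, neg_abs_le h]

lemma lipschitzWith_shear (h : ℝ) : LipschitzWith 1 (shear h) := by
  refine LipschitzWith.of_dist_le_mul fun x y => ?_
  rw [dist_eq_norm, dist_eq_norm, shear, shear, ← sub_smul, norm_smul, norm_e₀, mul_one,
    NNReal.coe_one, one_mul, neg_sub_neg, ← norm_sub_rev y x]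
  refine (abs_max_sub_max_le_abs _ _ _).trans ?_
  rw [sub_sub_sub_cancel_right]
  exact abs_coord_le (y - x) 1

lemma hasFDerivAt_shear {h : ℝ} {x : Plane} (hx : x 1 ≠ h) :
    HasFDerivAt (shear h) ((-(chi (halfPlane h) x)) • (coordL 1).smulRight e₀) x := by
  rcases lt_or_gt_of_ne hx with hlt | hlt
  · have h1 : shear h =ᶠ[𝓝 x] fun _ => 0 := by
      filter_upwards [(coordL 1).continuous.continuousAt.eventually (gt_mem_nhds hlt)] with y hy
      rw [shear, max_eq_right (by simpa using hy.le), neg_zero, zero_smul]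
    have h2 : x ∉ halfPlane h := fun h' => h'.not_gt hlt
    refine ((hasFDerivAt_const 0 x).congr_of_eventuallyEq h1).congr_fderiv ?_
    ext v : 1
    simp [chi, h2]
  · have h1 : shear h =ᶠ[𝓝 x] fun y => (-(coordL 1).smulRight e₀) y + h • e₀ := by
      filter_upwards [(coordL 1).continuous.continuousAt.eventually (lt_mem_nhds hlt)] with y hy
      rw [shear, max_eq_left (by simpa using hy.le)]
      simp only [neg_apply, ContinuousLinearMap.smulRight_apply, coordL_apply]
      module
    have h2 : x ∈ halfPlane h := hlt.le
    refine (((-(coordL 1).smulRight e₀).hasFDerivAt.add_const _).congr_of_eventuallyEq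
      h1).congr_fderiv ?_
    ext v : 1
    simp [chi, h2]

lemma divergence_shear_add {h : ℝ} {x : Plane} (hx : x 1 ≠ h) (w : Plane) :
    divergence (fun y => shear h y + w) x = 0 := by
  simp [divergence, ((hasFDerivAt_shear hx).add_const w).fderiv]

lemma curl_shear_add {h : ℝ} {x : Plane} (hx : x 1 ≠ h) (w : Plane) :
    curl (fun y => shear h y + w) x = chi (halfPlane h) x := by
  simp [curl, ((hasFDerivAt_shear hx).add_const w).fderiv]

lemma lipschitzWith_shear_add (h : ℝ) (w : Plane) : LipschitzWith 1 fun y => shear h y + w := by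
  simpa using (lipschitzWith_shear h).add (LipschitzWith.const w)

lemma isWeakDivFree_shear_add (h : ℝ) (w : Plane) : IsWeakDivFree fun y => shear h y + w := by
  intro φ hφ hs
  obtain ⟨D, hD⟩ := hφ.lipschitzWith_of_hasCompactSupport hs (by simp)
  rw [integral_fderiv_apply_of_lipschitz (lipschitzWith_shear_add h w) hD hs, neg_eq_zero]
  refine integral_eq_zero_of_ae ?_
  filter_upwards [ae_coord_one_ne h] with x hx
  rw [divergence_shear_add hx, zero_mul, Pi.zero_apply]

lemma isWeakCurl_shear_add (h : ℝ) (w : Plane) :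
    IsWeakCurl (fun y => shear h y + w) (chi (halfPlane h)) := by
  intro φ hφ hs
  obtain ⟨D, hD⟩ := hφ.lipschitzWith_of_hasCompactSupport hs (by simp)
  have hp : LipschitzWith _ fun x => perp (shear h x + w) :=
    lipschitzWith_perp.comp (lipschitzWith_shear_add h w)
  beta_reduce
  rw [integral_fderiv_apply_of_lipschitz hp hD hs, ← integral_neg]
  refine integral_congr_ae ?_
  filter_upwards [ae_coord_one_ne h] with x hx
  have hd := ((hasFDerivAt_shear hx).add_const w).differentiableAt
  rw [divergence_perp hd, curl_shear_add hx]
  ring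

section Transport

variable {Ψ : ℝ × Plane → ℝ}

lemma continuous_fderiv_apply (hΨ : ContDiff ℝ 1 Ψ) {W : ℝ × Plane → ℝ × Plane}
    (hW : Continuous W) : Continuous fun p => fderiv ℝ Ψ p (W p) :=
  (hΨ.continuous_fderiv (by simp)).clm_apply hW

lemma hasCompactSupport_fderiv_apply (hs : HasCompactSupport Ψ) (W : ℝ × Plane → ℝ × Plane) :
    HasCompactSupport fun p => fderiv ℝ Ψ p (W p) :=
  (hs.fderiv ℝ).mono fun p hp h => hp (by simp [h])

lemma hasCompactSupport_slice {f : ℝ × Plane → ℝ} (hs : HasCompactSupport f) (t : ℝ) :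
    HasCompactSupport fun x => f (t, x) :=
  HasCompactSupport.intro (hs.isCompact.image continuous_snd) fun x hx => by
    by_contra h
    exact hx ⟨(t, x), subset_tsupport f h, rfl⟩

lemma hasCompactSupport_time {f : ℝ × Plane → ℝ} (hs : HasCompactSupport f) (x : Plane) :
    HasCompactSupport fun t => f (t, x) :=
  HasCompactSupport.intro (hs.isCompact.image continuous_fst) fun t ht => by
    by_contra h
    exact ht ⟨(t, x), subset_tsupport f h, rfl⟩

lemma chi_mul_eq_indicator (A : Set Plane) (f : Plane → ℝ) :
    (fun x => chi A x * f x) = A.indicator f := by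
  ext x; by_cases h : x ∈ A <;> simp [chi, h]

/-- The transport equation for the half plane `y ≥ 0`, in the frame that moves with it. The shear
flow does not contribute because it has no divergence and leaves the half plane invariant. -/
lemma integral_halfPlane_fderiv (hΨ : ContDiff ℝ 1 Ψ) (hs : HasCompactSupport Ψ) :
    ∫ t in Ici (0 : ℝ), ∫ x, chi (halfPlane 0) x * fderiv ℝ Ψ (t, x) (1, shear 0 x) =
      -∫ x, chi (halfPlane 0) x * Ψ (0, x) := by
  have hU := (isClosed_halfPlane 0).measurableSet
  have hV : Continuous fun p : ℝ × Plane => ((0 : ℝ), shear 0 p.2) :=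
    continuous_const.prodMk ((lipschitzWith_shear 0).continuous.comp continuous_snd)
  have hc1 := continuous_fderiv_apply hΨ (continuous_const (y := ((1 : ℝ), (0 : Plane))))
  have hc2 := continuous_fderiv_apply hΨ hV
  have hs1 := hasCompactSupport_fderiv_apply hs fun _ => ((1 : ℝ), (0 : Plane))
  have hs2 := hasCompactSupport_fderiv_apply hs fun p => ((0 : ℝ), shear 0 p.2)
  have hslice (t : ℝ) : Continuous fun x : Plane => (t, x) := continuous_const.prodMk continuous_id
  have hi1 (t : ℝ) : Integrable fun x => chi (halfPlane 0) x * fderiv ℝ Ψ (t, x) (1, 0) := by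
    rw [chi_mul_eq_indicator]
    exact ((hc1.comp (hslice t)).integrable_of_hasCompactSupport
      (hasCompactSupport_slice hs1 t)).indicator hU
  have hi2 (t : ℝ) : Integrable fun x => fderiv ℝ Ψ (t, x) (0, shear 0 x) :=
    (hc2.comp (hslice t)).integrable_of_hasCompactSupport (hasCompactSupport_slice hs2 t)
  have hshear (t : ℝ) : ∫ x, fderiv ℝ Ψ (t, x) (0, shear 0 x) = 0 := by
    have hct : ContDiff ℝ 1 fun x => Ψ (t, x) := hΨ.comp (contDiff_const.prodMk contDiff_id)
    have hst := hasCompactSupport_slice hs t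
    obtain ⟨D, hD⟩ := hct.lipschitzWith_of_hasCompactSupport hst (by simp)
    have h := integral_fderiv_apply_of_lipschitz (lipschitzWith_shear_add 0 0) hD hst
    have hz : ∫ x, divergence (fun y => shear 0 y + 0) x * Ψ (t, x) = 0 := by
      refine integral_eq_zero_of_ae ?_
      filter_upwards [ae_coord_one_ne 0] with x hx
      rw [divergence_shear_add hx, zero_mul, Pi.zero_apply]
    rw [hz, neg_zero] at h
    refine Eq.trans (integral_congr_ae (ae_of_all _ fun x => ?_)) h
    have hd : HasFDerivAt (fun x => Ψ (t, x)) _ x :=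
      (hΨ.differentiable (by simp) (t, x)).hasFDerivAt.comp x
        ((hasFDerivAt_const t x).prodMk (hasFDerivAt_id x))
    beta_reduce
    rw [hd.fderiv]
    simp
  have hinner (t : ℝ) : ∫ x, chi (halfPlane 0) x * fderiv ℝ Ψ (t, x) (1, shear 0 x) =
      ∫ x, chi (halfPlane 0) x * fderiv ℝ Ψ (t, x) (1, 0) := by
    refine Eq.trans ?_ ((integral_add (hi1 t) (hi2 t)).trans (by rw [hshear, add_zero]))
    refine integral_congr_ae (ae_of_all _ fun x => ?_)
    have e : ((1 : ℝ), shear 0 x) = (1, 0) + (0, shear 0 x) := by simp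
    beta_reduce
    rw [e, map_add]
    by_cases h : x ∈ halfPlane 0
    · simp [chi, h]
    · have : shear 0 x = 0 := by
        rw [shear, max_eq_right (by linarith [not_le.1 (show ¬ 0 ≤ x 1 from h)])]
        simp
      rw [this, ← Prod.zero_eq_mk]
      simp [chi, h]
  simp only [hinner]
  rw [integral_integral_swap]
  · rw [← integral_neg]
    refine integral_congr_ae (ae_of_all _ fun x => ?_)
    have hct : ContDiff ℝ 1 fun t => Ψ (t, x) := hΨ.comp (contDiff_id.prodMk contDiff_const)
    have hd (t : ℝ) : fderiv ℝ Ψ (t, x) (1, 0) = deriv (fun t => Ψ (t, x)) t := by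
      have : HasDerivAt (fun t => Ψ (t, x)) _ t :=
        (hΨ.differentiable (by simp) (t, x)).hasFDerivAt.comp_hasDerivAt t
          ((hasDerivAt_id t).prodMk (hasDerivAt_const t x))
      rw [this.deriv]
    beta_reduce
    simp only [hd]
    rw [integral_const_mul, integral_Ici_eq_integral_Ioi,
      (hasCompactSupport_time hs x).integral_Ioi_deriv_eq hct, mul_neg]
  · have h1 : Integrable (fun p : ℝ × Plane => fderiv ℝ Ψ p (1, 0)) (volume.prod volume) :=
      hc1.integrable_of_hasCompactSupport hs1
    have h2 := h1.indicator (measurable_snd hU)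
    have h3 := h2.integrableOn (s := Ici 0 ×ˢ univ)
    rw [IntegrableOn, ← Measure.prod_restrict, Measure.restrict_univ] at h3
    refine h3.congr (ae_of_all _ fun p => ?_)
    by_cases h : p.2 ∈ halfPlane 0 <;> simp [Function.uncurry, chi, h]

end Transport

/-- The half plane `y ≥ h(t)` is a weak solution for every height `h` with `h(0) = 0`. The velocity
is the uniform vertical velocity `h'(t)` plus the shear flow of the half plane, which is tangent to
its boundary. -/
theorem isWeakEulerSolution_halfPlane {h : ℝ → ℝ} (hh : ContDiff ℝ 1 h) (h0 : h 0 = 0) :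
    IsWeakEulerSolution (chi upperHalf) (fun t => chi (halfPlane (h t))) := by
  have hdc : Continuous (deriv h) := hh.continuous_deriv le_rfl
  have hS : MeasurableSet {p : ℝ × Plane | h p.1 ≤ p.2 1} :=
    (isClosed_le (hh.continuous.comp continuous_fst)
      ((coordL 1).continuous.comp continuous_snd)).measurableSet
  have hchi (A : Set Plane) (x : Plane) : |chi A x| ≤ 1 := by
    by_cases h : x ∈ A <;> simp [chi, h]
  have hω : Function.uncurry (fun t => chi (halfPlane (h t))) =
      {p : ℝ × Plane | h p.1 ≤ p.2 1}.indicator fun _ => 1 := rfl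
  have hu : Continuous fun p : ℝ × Plane => shear (h p.1) p.2 + deriv h p.1 • e₁ := by
    have h1 : Continuous fun p : ℝ × Plane => p.2 1 := (coordL 1).continuous.comp continuous_snd
    have h2 := hh.continuous
    unfold shear
    fun_prop
  refine ⟨?_, ⟨1, fun t _ => ⟨?_, ae_of_all _ (hchi _)⟩⟩, ?_,
    fun t x => shear (h t) x + deriv h t • e₁, hu.continuousOn, fun T => ?_,
    fun t _ => ⟨isWeakDivFree_shear_add _ _, isWeakCurl_shear_add _ _⟩, fun ψ hψ hs => ?_⟩
  · rw [hω]
    exact (measurable_const.indicator hS).aestronglyMeasurable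
  · exact (measurable_const.indicator (isClosed_halfPlane _).measurableSet).aestronglyMeasurable
  · simp only [h0]
    rfl
  · obtain ⟨A, hA⟩ := (isCompact_Icc (a := 0) (b := T)).exists_bound_of_continuousOn
      hh.continuous.continuousOn
    obtain ⟨B, hB⟩ := (isCompact_Icc (a := 0) (b := T)).exists_bound_of_continuousOn
      hdc.continuousOn
    refine ⟨1 + A + B, fun t ht x => ?_⟩
    have h1 : |h t| ≤ A := hA t ht
    have h2 := hB t ht
    have h3 : ‖deriv h t • e₁‖ ≤ B := by rw [norm_smul, norm_e₁, mul_one]; exact h2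
    have h4 : 0 ≤ A := (abs_nonneg _).trans h1
    have h5 : 0 ≤ B := (norm_nonneg _).trans h2
    have := norm_add_le (shear (h t) x) (deriv h t • e₁)
    nlinarith [norm_shear_le (h t) x, norm_nonneg x]
  -- the test function in the moving frame
  have hh1 : ContDiff ℝ 1 fun p : ℝ × Plane => (p.1, p.2 + h p.1 • e₁) :=
    contDiff_fst.prodMk (contDiff_snd.add ((hh.comp contDiff_fst).smul contDiff_const))
  have hψ1 : ContDiff ℝ 1 ψ := hψ.of_le (by simp)
  set Ψ : ℝ × Plane → ℝ := fun p => ψ (p.1, p.2 + h p.1 • e₁) with hΨ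
  have hΨc : ContDiff ℝ 1 Ψ := hψ1.comp hh1
  have hΨs : HasCompactSupport Ψ := by
    have hc : Continuous fun p : ℝ × Plane => (p.1, p.2 - h p.1 • e₁) := by
      have := hh.continuous
      fun_prop
    refine HasCompactSupport.intro (hs.isCompact.image hc) fun p hp => ?_
    by_contra hn
    exact hp ⟨(p.1, p.2 + h p.1 • e₁), subset_tsupport ψ hn, by simp⟩
  have hd (t : ℝ) (x v : Plane) :
      fderiv ℝ Ψ (t, x) (1, v) = fderiv ℝ ψ (t, x + h t • e₁) (1, v + deriv h t • e₁) := by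
    have h1 : HasFDerivAt (fun p : ℝ × Plane => h p.1) _ (t, x) :=
      ((hh.differentiable (by simp) t).hasDerivAt).hasFDerivAt.comp (t, x) hasFDerivAt_fst
    have h2 : HasFDerivAt Ψ _ (t, x) :=
      (hψ1.differentiable (by simp) (t, x + h t • e₁)).hasFDerivAt.comp (t, x)
        (hasFDerivAt_fst.prodMk (hasFDerivAt_snd.add (h1.smul_const e₁)))
    rw [h2.fderiv]
    simp
  have hint : IntegrableOn (fun p : ℝ × Plane => chi (halfPlane (h p.1)) p.2 *
      fderiv ℝ ψ p (1, shear (h p.1) p.2 + deriv h p.1 • e₁)) (Ici 0 ×ˢ univ)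
      (volume.prod volume) := by
    have hc := continuous_fderiv_apply hψ1 (continuous_const (y := (1 : ℝ)).prodMk hu)
    have hi : Integrable _ (volume.prod volume) :=
      hc.integrable_of_hasCompactSupport (hasCompactSupport_fderiv_apply hs _)
    refine ((hi.indicator hS).congr (ae_of_all _ fun p => ?_)).integrableOn
    by_cases hp : h p.1 ≤ p.2 1
    · have hp' : p.2 ∈ halfPlane (h p.1) := hp
      simp [chi, hp, hp']
    · have hp' : p.2 ∉ halfPlane (h p.1) := hp
      simp [chi, hp, hp']
  have hmain := integral_halfPlane_fderiv hΨc hΨs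
  have h00 : ∀ x, Ψ (0, x) = ψ (0, x) := fun x => by simp [hΨ, h0]
  simp only [h00] at hmain
  rw [← neg_eq_iff_add_eq_zero, neg_eq_iff_eq_neg]
  refine Eq.trans ?_ hmain
  rw [Measure.volume_eq_prod, setIntegral_prod _ hint]
  refine setIntegral_congr_fun measurableSet_Ici fun t _ => ?_
  beta_reduce
  rw [Measure.restrict_univ, ← integral_add_right_eq_self _ (h t • e₁)]
  refine integral_congr_ae (ae_of_all _ fun x => ?_)
  have hm : chi (halfPlane (h t)) (x + h t • e₁) = chi (halfPlane 0) x := by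
    have : x + h t • e₁ ∈ halfPlane (h t) ↔ x ∈ halfPlane 0 := by simp [halfPlane]
    by_cases hx : x ∈ halfPlane 0 <;> simp [chi, this, hx]
  beta_reduce
  rw [hm, hd, shear_add]

lemma contDiff_height (k : ℝ) : ContDiff ℝ 1 (height k) := by
  unfold height
  fun_prop

lemma height_zero (k : ℝ) : height k 0 = 0 := by simp [height]

lemma height_pi (k : ℝ) : height k Real.pi = k := by
  rw [height, one_div_mul_eq_div, Real.sin_pi_div_two, mul_one]

lemma not_ae_eq_chi_upperHalf_one : ¬ chi upperHalf =ᵐ[volume] fun _ => 1 := by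
  intro he
  have h1 : volume (box 0 1 (-2) (-1)) = 0 := by
    refine measure_mono_null (fun p hp => ?_) he
    have ha : p ∉ upperHalf := fun h => by linarith [hp.2.2, show 0 ≤ p 1 from h]
    simp [chi, ha]
  rw [volume_box] at h1
  norm_num at h1

end PlanarEuler

theorem mainTheorem9 :
    -- two sequences of compactly supported data which converge to `χ_{y ≥ 0}` in `L²_loc`
    (∀ n : ℕ, 1 ≤ n → HasCompactSupport (chi (disk n)) ∧ HasCompactSupport (chi (ellipse n))) ∧
    TendstoL2loc (fun n => chi (disk n)) (chi upperHalf) ∧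
    TendstoL2loc (fun n => chi (ellipse n)) (chi upperHalf) ∧
    -- their Yudovich solutions: stationary disks and ellipses rotating at the angular speed `2/9`
    (∀ n : ℕ, 1 ≤ n → IsUniqueYudovichSolution (chi (disk n)) (fun _ => chi (disk n))) ∧
    (∀ n : ℕ, 1 ≤ n → IsUniqueYudovichSolution (chi (ellipse n))
      (fun t => chi (rotatedEllipse n (2 / 9 * t)))) ∧
    -- at time `t = 1`, the solutions converge to different functions
    (∃ f g : Plane → ℝ,
      TendstoL2loc (fun n => chi (disk n)) f ∧
      TendstoL2loc (fun n => chi (rotatedEllipse n (2 / 9 * 1))) g ∧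
      ¬ f =ᵐ[volume] g) ∧
    -- the limit of the second sequence of solutions, before the half turn of the ellipses
    (∀ t : ℝ, 0 < t → t < 9 * Real.pi / 2 →
      TendstoL2loc (fun n => chi (rotatedEllipse n (2 / 9 * t))) (fun _ => 1)) ∧
    -- infinitely many solutions with initial vorticity `χ_{y ≥ 0}`, all of them limits of
    -- smooth compactly supported solutions
    (∃ ω : ℕ → ℝ → Plane → ℝ,
      (∀ k, IsWeakEulerSolution (chi upperHalf) (ω k) ∧
        ∃ w : ℕ → ℝ → Plane → ℝ,
          (∀ n, IsSmoothCompactSolution (w n)) ∧ TendstoL2locUniform w (ω k)) ∧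
      ∀ j k, j ≠ k → ∃ t : ℝ, 0 ≤ t ∧ ¬ ω j t =ᵐ[volume] ω k t) := by
  have hlim {t : ℝ} (h0 : 0 < t) (h1 : t < 9 * Real.pi / 2) :
      TendstoL2loc (fun n => chi (rotatedEllipse n (2 / 9 * t))) (fun _ => 1) :=
    tendstoL2loc_rotatedEllipse
      (Real.sin_pos_of_pos_of_lt_pi (by positivity) (by linarith)).ne'
  refine ⟨fun n hn => ⟨hasCompactSupport_chi_disk hn, hasCompactSupport_chi_ellipse hn⟩,
    tendstoL2loc_disk, tendstoL2loc_ellipse, fun n hn => isUniqueYudovichSolution_disk hn,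
    fun n hn => isUniqueYudovichSolution_ellipse hn,
    ⟨chi upperHalf, fun _ => 1, tendstoL2loc_disk,
      hlim one_pos (by linarith [Real.pi_gt_three]), not_ae_eq_chi_upperHalf_one⟩,
    fun t h0 h1 => hlim h0 h1, fun k t => chi (halfPlane (height k t)), fun k => ⟨?_, ?_⟩, ?_⟩
  · exact isWeakEulerSolution_halfPlane (contDiff_height k) (height_zero k)
  · exact ⟨fun n => approxSolution k (n + 1),
      fun n => isSmoothCompactSolution_approxSolution k.cast_nonneg (by positivity),
      tendstoL2locUniform_approxSolution k.cast_nonneg⟩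
  · intro j k hjk
    refine ⟨Real.pi, Real.pi_pos.le, ?_⟩
    beta_reduce
    rw [height_pi, height_pi]
    rcases lt_or_gt_of_ne hjk with h | h
    · exact not_ae_eq_chi_halfPlane (by exact_mod_cast h)
    · exact fun he => not_ae_eq_chi_halfPlane (by exact_mod_cast h) he.symm
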